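/- **Setting.** Let $R$ be a (commutative) local ring in which $2$ is invertible, let $V$ be a finite free $R$-module, and let $A=R\times V$ be the square-zero extension, with $(r,v)(r',v')=(rr',rv'+r'v)$. For a commutative ring $B$ write ${\rm SL}(B)=\bigcup_n{\rm SL}_n(B)$, let ${\rm St}(B)$ be the stable Steinberg group and ${\rm K}_2(B)=\ker({\rm St}(B)\to{\rm SL}(B))$, with Steinberg symbols $\{f,g\}=[h_{12}(f),h_{13}(g)]$, where $[a,b]=aba^{-1}b^{-1}$, $h_{ij}(u)=w_{ij}(u)w_{ij}(-1)$, $w_{ij}(u)=x_{ij}(u)x_{ji}(-u^{-1})x_{ij}(u)$. Let ${\rm M}^0(V)=\varinjlim_m {\rm M}^0_{m\times m}(V)$ be the module of trace-zero matrices with entries in $V$, and let $${\rm Tr}_{\rm alt}(X,Y)=\tfrac12\big({\rm Tr}(X\otimes Y)-{\rm Tr}(Y\otimes X)\big)=\tfrac12\sum_{i,j}X_{ij}\wedge Y_{ji}\in\wedge^2V\qquad (v\wedge w = v\otimes w-w\otimes v).$$ **Proposition.** 1. The map ${\rm St}(A)\to{\rm SL}(A)$ is surjective, and there is exactly one homomorphism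 $d\log:{\rm K}_2(A)\to\Omega^2_A:=\Omega^2_{A/\mathbb Z}$ with $d\log\{f,g\}=f^{-1}df\wedge g^{-1}dg$ for all $f,g\in A^\times$. 2. The map $\wedge^2V\to\Omega^2_{A/R}$, $v\wedge w\mapsto d(0,v)\wedge d(0,w)$, is injective, and the composite of $d\log$ with $\Omega^2_{A}\to\Omega^2_{A/R}$ takes values in its image $\wedge^2V$. If $\Omega^1_{R/\mathbb Z}=0$, then $\Omega^2_A\to\Omega^2_{A/R}$ is an isomorphism. 3. Let $\Gamma$ be a group, $\rho_0:\Gamma\to{\rm SL}(R)$ a homomorphism and $\rho:\Gamma\to{\rm SL}(A)$ a first-order deformation of $\rho_0$, i.e. a homomorphism that reduces to $\rho_0$ along $A\to R$. There is a unique $c:\Gamma\to{\rm M}^0(V)$ with $\rho(\gamma)=\rho_0(\gamma)(1+c(\gamma))$, and it is a $1$-cocycle for the adjoint action: $c(\gamma_1\gamma_2)=\rho_0(\gamma_2)^{-1}c(\gamma_1)\rho_0(\gamma_2)+c(\gamma_2)$. For any choice of lifts $s(\rho(\gamma))\in{\rm St}(A)$ of the $\rho(\gamma)$ put $$\kappa_\rho(\gamma_1,\gamma_2)=s(\rho(\gamma_1\gamma_2))\,s(\rho(\gamma_2))^{-1}s(\rho(\gamma_1))^{-1}\in{\rm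 K}_2(A),$$ and let $\omega_\rho\in {\rm H}^2(\Gamma,\wedge^2V)$ be the class of the $2$-cocycle $d\log\circ\kappa_\rho$, taken in $\wedge^2V\subset\Omega^2_{A/R}$. Then $$\omega_\rho=-{\rm Tr}_{\rm alt}(c\cup c)\quad\text{in } {\rm H}^2(\Gamma,\wedge^2V),$$ where ${\rm Tr}_{\rm alt}(c\cup c)$ is the class of the $2$-cocycle $(\gamma_1,\gamma_2)\mapsto{\rm Tr}_{\rm alt}\big(\rho_0(\gamma_2)^{-1}c(\gamma_1)\rho_0(\gamma_2),\,c(\gamma_2)\big)$. Equivalently, the class formed with the inverse cocycle $s(\rho(\gamma_1))s(\rho(\gamma_2))s(\rho(\gamma_1\gamma_2))^{-1}$ equals ${\rm Tr}_{\rm alt}(c\cup c)$. -/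

import Mathlib

open scoped KaehlerDifferential TensorProduct commutatorElement

universe u

noncomputable section

namespace SteinbergForm

section StableGroups

variable (A : Type*) [CommRing A]

/-- The ambient group of all `A`-linear automorphisms of the free module `A^(ℕ)` of column
vectors; it contains the stable groups `SL(A) ⊆ GL(A)`. -/
abbrev AutInf := (Module.End A (ℕ →₀ A))ˣ

variable {A}

/-- The `(i, j)` matrix entry of an automorphism of `A^(ℕ)`. -/
def entry (g : AutInf A) (i j : ℕ) : A := g.val (Finsupp.single j 1) i

variable (A)

/-- Restriction of a column vector to its first `n` coordinates. -/
def resFin (n : ℕ) : (ℕ →₀ A) →ₗ[A] (Fin n → A) :=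
  LinearMap.pi fun i => Finsupp.lapply (i : ℕ)

/-- Extension by zero of a column vector of length `n`. -/
def extFin (n : ℕ) : (Fin n → A) →ₗ[A] (ℕ →₀ A) :=
  ∑ i : Fin n, Finsupp.lsingle (i : ℕ) ∘ₗ LinearMap.proj i

lemma resFin_extFin (n : ℕ) : resFin A n ∘ₗ extFin A n = LinearMap.id := by
  apply LinearMap.ext
  intro y
  funext i
  simp [resFin, extFin, Finsupp.single_apply, ← Fin.ext_iff]

/-- The stabilisation `B ↦ diag(B, 1, 1, …)` from `n × n` matrices. -/
def stab (n : ℕ) : Matrix (Fin n) (Fin n) A →* Module.End A (ℕ →₀ A) where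
  toFun B := 1 + extFin A n ∘ₗ Matrix.mulVecLin (B - 1) ∘ₗ resFin A n
  map_one' := by simp
  map_mul' B C := by
    have h : ∀ x, resFin A n (extFin A n x) = x := fun x =>
      LinearMap.congr_fun (resFin_extFin A n) x
    apply LinearMap.ext
    intro x
    simp only [LinearMap.add_apply, Module.End.one_apply, LinearMap.comp_apply,
      Matrix.mulVecLin_apply, Module.End.mul_apply, map_add, h, Matrix.mulVec_mulVec]
    have : B * C - 1 = (C - 1) + (B - 1) + (B - 1) * (C - 1) := by noncomm_ring
    rw [this, Matrix.add_mulVec, Matrix.add_mulVec, map_add, map_add]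
    abel

/-- The stable special linear group `SL(A) = ⋃ₙ SLₙ(A)`, where `SLₙ(A)` sits in `SLₙ₊₁(A)` as
the matrices `diag(B, 1)`. (The supremum of this increasing chain of subgroups is its union.) -/
def SLInf : Subgroup (AutInf A) :=
  ⨆ n : ℕ, ((Units.map (stab A n)).comp
    (Matrix.SpecialLinearGroup.toGL (n := Fin n) (R := A))).range

end StableGroups

section Steinberg

variable (A : Type*) [CommRing A]

/-- The symbols `x i j a`, with `i ≠ j` and `a ∈ A`, generating the Steinberg group. -/
abbrev Gen := {p : ℕ × ℕ // p.1 ≠ p.2} × A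

variable {A}

/-- The free generator attached to `i ≠ j` and `a`. -/
def gen {i j : ℕ} (h : i ≠ j) (a : A) : FreeGroup (Gen A) := FreeGroup.of (⟨(i, j), h⟩, a)

variable (A)

/-- The Steinberg relations. -/
inductive IsSteinbergRel : FreeGroup (Gen A) → Prop
  | add {i j : ℕ} (h : i ≠ j) (a b : A) :
      IsSteinbergRel (gen h a * gen h b * (gen h (a + b))⁻¹)
  | comm_mul {i j k : ℕ} (hij : i ≠ j) (hjk : j ≠ k) (hik : i ≠ k) (a b : A) :
      IsSteinbergRel (⁅gen hij a, gen hjk b⁆ * (gen hik (a * b))⁻¹)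
  | comm_one {i j k l : ℕ} (hij : i ≠ j) (hkl : k ≠ l) (hjk : j ≠ k) (hil : i ≠ l) (a b : A) :
      IsSteinbergRel ⁅gen hij a, gen hkl b⁆

/-- The stable Steinberg group `St(A)`. -/
abbrev St := PresentedGroup {r : FreeGroup (Gen A) | IsSteinbergRel A r}

variable {A}

/-- The generator `x_ij(a)` of the Steinberg group. -/
def x {i j : ℕ} (h : i ≠ j) (a : A) : St A := PresentedGroup.of (⟨(i, j), h⟩, a)

/-- The elementary endomorphism `v ↦ v + a v_j e_i` of `A^(ℕ)`. -/
def elemEnd (i j : ℕ) (a : A) : Module.End A (ℕ →₀ A) :=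
  1 + a • (Finsupp.lsingle i ∘ₗ Finsupp.lapply j)

lemma elemEnd_apply (i j : ℕ) (a : A) (v : ℕ →₀ A) :
    elemEnd i j a v = v + Finsupp.single i (a * v j) := by
  simp [elemEnd]

lemma elemEnd_mul {i j : ℕ} (h : i ≠ j) (a b : A) :
    elemEnd i j a * elemEnd i j b = elemEnd i j (a + b) := by
  apply LinearMap.ext
  intro v
  simp [elemEnd_apply, h, add_mul, add_comm, add_left_comm]

lemma elemEnd_zero (i j : ℕ) : elemEnd i j (0 : A) = 1 := by simp [elemEnd]

/-- The elementary matrix `e_ij(a)`. -/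
def elem {i j : ℕ} (h : i ≠ j) (a : A) : AutInf A where
  val := elemEnd i j a
  inv := elemEnd i j (-a)
  val_inv := by rw [elemEnd_mul h, add_neg_cancel, elemEnd_zero]
  inv_val := by rw [elemEnd_mul h, neg_add_cancel, elemEnd_zero]

lemma lift_gen {i j : ℕ} (h : i ≠ j) (a : A) :
    FreeGroup.lift (fun p : Gen A => elem p.1.2 p.2) (gen h a) = elem h a := by
  simp [gen]

lemma lift_rel (r : FreeGroup (Gen A)) (hr : IsSteinbergRel A r) :
    FreeGroup.lift (fun p : Gen A => elem p.1.2 p.2) r = 1 := by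
  cases hr with
  | add h a b =>
    rw [map_mul, map_mul, map_inv, lift_gen, lift_gen, lift_gen, mul_inv_eq_one]
    exact Units.ext (elemEnd_mul h a b)
  | comm_mul hij hjk hik a b =>
    rw [map_mul, map_commutatorElement, map_inv, lift_gen, lift_gen, lift_gen, mul_inv_eq_one,
      commutatorElement_def, mul_inv_eq_iff_eq_mul, mul_inv_eq_iff_eq_mul]
    apply Units.ext
    apply LinearMap.ext
    intro v
    simp [elem, elemEnd_apply, hjk.symm, hik.symm, mul_add, mul_assoc]
    abel
  | comm_one hij hkl hjk hil a b =>
    rw [map_commutatorElement, lift_gen, lift_gen, commutatorElement_eq_one_iff_mul_comm]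
    apply Units.ext
    apply LinearMap.ext
    intro v
    simp [elem, elemEnd_apply, hjk.symm, hil]
    abel

variable (A)

/-- The canonical homomorphism from the Steinberg group to matrices, `x_ij(a) ↦ e_ij(a)`. -/
def stToAut : St A →* AutInf A :=
  PresentedGroup.toGroup (f := fun p : Gen A => elem p.1.2 p.2) lift_rel

/-- Milnor's `K₂(A)`, the kernel of `St(A) → SL(A)`. -/
abbrev K2 : Subgroup (St A) := (stToAut A).ker

variable {A}

lemma stToAut_x {i j : ℕ} (h : i ≠ j) (a : A) : stToAut A (x h a) = elem h a := by
  simp [stToAut, x]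

/-- `w_ij(u) = x_ij(u) x_ji(-u⁻¹) x_ij(u)`. -/
def w {i j : ℕ} (h : i ≠ j) (u : Aˣ) : St A :=
  x h (u : A) * x h.symm (-(↑u⁻¹ : A)) * x h (u : A)

/-- `h_ij(u) = w_ij(u) w_ij(-1)`, a lift of the diagonal matrix with entries `u` at `i` and
`u⁻¹` at `j`. -/
def hElt {i j : ℕ} (h : i ≠ j) (u : Aˣ) : St A := w h u * w h (-1)

lemma stToAut_w_apply {i j : ℕ} (h : i ≠ j) (u : Aˣ) (v : ℕ →₀ A) (k : ℕ) :
    (stToAut A (w h u)).val v k =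
      if k = i then u * v j else if k = j then -(↑u⁻¹ * v i) else v k := by
  simp only [w, map_mul, stToAut_x, Units.val_mul, Module.End.mul_apply, elem, elemEnd_apply,
    Finsupp.add_apply, Finsupp.single_apply]
  by_cases hi : k = i
  · subst hi
    simp [h, h.symm, mul_add]
  · by_cases hj : k = j
    · subst hj
      simp [h, h.symm, mul_add]
    · simp [hi, hj, Ne.symm hi, Ne.symm hj]

lemma stToAut_hElt_apply {i j : ℕ} (h : i ≠ j) (u : Aˣ) (v : ℕ →₀ A) (k : ℕ) :
    (stToAut A (hElt h u)).val v k =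
      if k = i then u * v i else if k = j then ↑u⁻¹ * v j else v k := by
  simp only [hElt, map_mul, Units.val_mul, Module.End.mul_apply, stToAut_w_apply]
  by_cases hi : k = i
  · subst hi
    simp [h.symm]
  · by_cases hj : k = j
    · subst hj
      simp [h.symm]
    · simp [hi, hj]

/-- The Steinberg symbol `{u, v} = [h₁₂(u), h₁₃(v)] ∈ K₂(A)` (rows and columns are numbered
from `0` here), with `[a, b] = a b a⁻¹ b⁻¹`. -/
def symbol (u v : Aˣ) : K2 A :=
  ⟨⁅hElt (i := 0) (j := 1) (by decide) u, hElt (i := 0) (j := 2) (by decide) v⁆, by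
    rw [MonoidHom.mem_ker, map_commutatorElement, commutatorElement_eq_one_iff_mul_comm]
    apply Units.ext
    apply LinearMap.ext
    intro y
    ext k
    simp only [Units.val_mul, Module.End.mul_apply, stToAut_hElt_apply]
    by_cases h0 : k = 0
    · subst h0
      simp [mul_left_comm]
    · by_cases h1 : k = 1
      · subst h1
        simp
      · simp [h0, h1]⟩

/-- The `K₂(A)`-valued cochain
`κ_ρ(γ₁, γ₂) = s(ρ(γ₁γ₂)) s(ρ(γ₂))⁻¹ s(ρ(γ₁))⁻¹` of a representation `ρ : Γ → SL(A)` and a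
choice `s` of lifts of the `ρ(γ)` to `St(A)`. -/
def kappa {Γ : Type*} [Group Γ] (ρ : Γ →* SLInf A) (s : Γ → St A)
    (hs : ∀ γ, stToAut A (s γ) = ρ γ) (γ₁ γ₂ : Γ) : K2 A :=
  ⟨s (γ₁ * γ₂) * (s γ₂)⁻¹ * (s γ₁)⁻¹, by simp [MonoidHom.mem_ker, hs]⟩

variable (A) in
/-- The absolute Kähler `2`-forms `Ω²_A = Ω²_{A/ℤ}`. -/
abbrev AbsForms := ⋀[A]^2 Ω[A⁄ℤ]

variable (A) in
/-- The canonical map `Ω²_{A/ℤ} → Ω²_{A/R}` from absolute to relative forms. -/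
def absToRel (R : Type*) [CommRing R] [Algebra R A] : AbsForms A →ₗ[A] ⋀[A]^2 Ω[A⁄R] :=
  exteriorPower.map 2 (KaehlerDifferential.map ℤ R A A)

/-- `dlog u ∧ dlog v` in the absolute Kähler `2`-forms, where `dlog u = u⁻¹ du`. -/
def dlogForm (u v : Aˣ) : AbsForms A :=
  exteriorPower.ιMulti A 2
    ![(↑u⁻¹ : A) • KaehlerDifferential.D ℤ A u, (↑v⁻¹ : A) • KaehlerDifferential.D ℤ A v]

/-- `δ` is a homomorphism `dlog : K₂(A) → Ω²_A` with `{u, v} ↦ dlog u ∧ dlog v`. -/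
def IsDlog (δ : Additive (K2 A) →+ AbsForms A) : Prop :=
  ∀ u v : Aˣ, δ (Additive.ofMul (symbol u v)) = dlogForm u v

end Steinberg

section Deformation

variable (R : Type*) [CommRing R] (V : Type*) [AddCommGroup V] [Module R V]

/-- `M⁰(V)`: matrices with entries in `V`, indexed by `ℕ × ℕ`, having finitely many nonzero
entries and trace zero; this is the direct limit of the `M⁰_{m × m}(V)`. -/
def MZero : Submodule R (Matrix ℕ ℕ V) where
  carrier := {X | {p : ℕ × ℕ | X p.1 p.2 ≠ 0}.Finite ∧ ∑ᶠ i, X i i = 0}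
  zero_mem' := by simp
  add_mem' := by
    have diag : ∀ X : Matrix ℕ ℕ V, {p : ℕ × ℕ | X p.1 p.2 ≠ 0}.Finite →
        (Function.support fun i => X i i).Finite := fun X h =>
      h.preimage (f := fun i => (i, i)) (fun a _ b _ hab => (Prod.ext_iff.mp hab).1)
    rintro X Y ⟨hX, tX⟩ ⟨hY, tY⟩
    refine ⟨(hX.union hY).subset fun p hp => ?_, ?_⟩
    · by_contra hc
      simp only [Set.mem_union, Set.mem_ofPred_eq, not_or, not_not] at hc
      exact hp (by simp [hc.1, hc.2])
    · simp only [Matrix.add_apply]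
      rw [finsum_add_distrib (diag X hX) (diag Y hY), tX, tY, add_zero]
  smul_mem' := by
    have diag : ∀ X : Matrix ℕ ℕ V, {p : ℕ × ℕ | X p.1 p.2 ≠ 0}.Finite →
        (Function.support fun i => X i i).Finite := fun X h =>
      h.preimage (f := fun i => (i, i)) (fun a _ b _ hab => (Prod.ext_iff.mp hab).1)
    rintro r X ⟨hX, tX⟩
    refine ⟨hX.subset fun p hp h0 => hp (by simp [h0]), ?_⟩
    simp only [Matrix.smul_apply]
    rw [← smul_finsum' r (diag X hX), tX, smul_zero]

variable {R V}

/-- The product `g X` of `g ∈ SL(R)` and a matrix `X` with entries in `V`. -/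
def leftMul (g : SLInf R) (X : Matrix ℕ ℕ V) : Matrix ℕ ℕ V :=
  fun i j => ∑ᶠ k, entry (g : AutInf R) i k • X k j

/-- The conjugate `g⁻¹ X g` of a finite matrix `X` with entries in `V` by `g ∈ SL(R)`. -/
def conj (g : SLInf R) (X : Matrix ℕ ℕ V) : Matrix ℕ ℕ V :=
  fun i j => ∑ᶠ p : ℕ × ℕ,
    (entry (g⁻¹ : AutInf R) i p.1 * entry (g : AutInf R) p.2 j) • X p.1 p.2

/-- `v ∧ w` in the exterior square. -/
def wedge (v w : V) : ⋀[R]^2 V := exteriorPower.ιMulti R 2 ![v, w]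

/-- The alternating trace `Tr_alt(X, Y) = ½ (Tr(X ⊗ Y) - Tr(Y ⊗ X))`. This tensor is
`½ ∑ (X_ij ⊗ Y_ji - Y_ji ⊗ X_ij)`, that is `½ ∑ X_ij ∧ Y_ji` where `v ∧ w` is the tensor
`v ⊗ w - w ⊗ v`; see `wedgeToTensor_trAlt`. -/
def trAlt [Invertible (2 : R)] (X Y : Matrix ℕ ℕ V) : ⋀[R]^2 V :=
  ⅟(2 : R) • ∑ᶠ p : ℕ × ℕ, wedge (X p.1 p.2) (Y p.2 p.1)

/-- `Tr(X ⊗ Y) = ∑ X_ij ⊗ Y_ji`. -/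
def trTensor (X Y : Matrix ℕ ℕ V) : V ⊗[R] V :=
  ∑ᶠ p : ℕ × ℕ, X p.1 p.2 ⊗ₜ[R] Y p.2 p.1

variable (R V) in
/-- The map `⋀² V → V ⊗ V`, `v ∧ w ↦ v ⊗ w - w ⊗ v`. -/
def wedgeToTensor : ⋀[R]^2 V →ₗ[R] V ⊗[R] V :=
  exteriorPower.alternatingMapLinearEquiv
    { toFun := fun v => v 0 ⊗ₜ[R] v 1 - v 1 ⊗ₜ[R] v 0
      map_update_add' := by
        intro _ m i a b
        fin_cases i <;> simp [TensorProduct.add_tmul, TensorProduct.tmul_add] <;> abel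
      map_update_smul' := by
        intro _ m i c a
        fin_cases i <;> simp [TensorProduct.smul_tmul', smul_sub]
      map_eq_zero_of_eq' := by
        intro v i j h hij
        fin_cases i <;> fin_cases j <;> simp_all }

lemma wedgeToTensor_wedge (v w : V) :
    wedgeToTensor R V (wedge v w) = v ⊗ₜ[R] w - w ⊗ₜ[R] v := by
  simp [wedgeToTensor, wedge]

lemma wedgeToTensor_trAlt [Invertible (2 : R)] (X Y : MZero R V) :
    wedgeToTensor R V (trAlt (X : Matrix ℕ ℕ V) (Y : Matrix ℕ ℕ V)) =
      ⅟(2 : R) • (trTensor (R := R) (X : Matrix ℕ ℕ V) (Y : Matrix ℕ ℕ V) -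
        trTensor (R := R) (Y : Matrix ℕ ℕ V) (X : Matrix ℕ ℕ V)) := by
  have hX := X.2.1
  have key : ∀ f : V → V → V ⊗[R] V, (∀ w, f 0 w = 0) →
      (Function.support fun p : ℕ × ℕ => f (X.1 p.1 p.2) (Y.1 p.2 p.1)).Finite := fun f hf =>
    hX.subset fun p hp h0 => hp (by simp only [h0, hf])
  have hswap : trTensor (R := R) (Y : Matrix ℕ ℕ V) (X : Matrix ℕ ℕ V) =
      ∑ᶠ p : ℕ × ℕ, Y.1 p.2 p.1 ⊗ₜ[R] X.1 p.1 p.2 :=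
    (finsum_comp_equiv (Equiv.prodComm ℕ ℕ)
      (f := fun p : ℕ × ℕ => Y.1 p.1 p.2 ⊗ₜ[R] X.1 p.2 p.1)).symm
  have hw : (Function.support fun p : ℕ × ℕ =>
      wedge (R := R) (X.1 p.1 p.2) (Y.1 p.2 p.1)).Finite :=
    hX.subset fun p hp h0 => hp (by
      simp only [h0, wedge]
      exact (exteriorPower.ιMulti R 2).map_coord_zero 0 rfl)
  rw [trAlt, map_smul, hswap, trTensor,
    ← finsum_sub_distrib (key (fun a b => a ⊗ₜ[R] b) (by simp))
      (key (fun a b => b ⊗ₜ[R] a) (by simp))]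
  congr 1
  have := (wedgeToTensor R V).toAddMonoidHom.map_finsum hw
  simpa [wedgeToTensor_wedge] using this

end Deformation

section SquareZero

variable (R : Type*) [CommRing R] (V : Type*) [AddCommGroup V] [Module R V] [Module Rᵐᵒᵖ V]
  [IsCentralScalar R V]

/-- The canonical map `⋀²_R V → Ω²_{A/R}`, `v ∧ w ↦ d(0, v) ∧ d(0, w)`, where `A = R × V` is
the square-zero extension of `R` by `V`. -/
def wedgeToForms : ⋀[R]^2 V →ₗ[R] ⋀[TrivSqZeroExt R V]^2 Ω[TrivSqZeroExt R V⁄R] :=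
  exteriorPower.alternatingMapLinearEquiv <|
    AlternatingMap.compLinearMap
      ({ (exteriorPower.ιMulti (TrivSqZeroExt R V) 2
            (M := Ω[TrivSqZeroExt R V⁄R])).toMultilinearMap.restrictScalars R with
          map_eq_zero_of_eq' :=
            (exteriorPower.ιMulti (TrivSqZeroExt R V) 2).map_eq_zero_of_eq' } :
        Ω[TrivSqZeroExt R V⁄R] [⋀^Fin 2]→ₗ[R]
          (⋀[TrivSqZeroExt R V]^2 Ω[TrivSqZeroExt R V⁄R]))
      ((KaehlerDifferential.D R (TrivSqZeroExt R V)).toLinearMap ∘ₗ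
        TrivSqZeroExt.inrHom R V)

lemma wedgeToForms_wedge (v w : V) :
    wedgeToForms R V (wedge v w) = exteriorPower.ιMulti (TrivSqZeroExt R V) 2
      ![KaehlerDifferential.D R (TrivSqZeroExt R V) (TrivSqZeroExt.inr v),
        KaehlerDifferential.D R (TrivSqZeroExt R V) (TrivSqZeroExt.inr w)] := by
  rw [wedgeToForms, wedge, exteriorPower.alternatingMapLinearEquiv_apply_ιMulti]
  change exteriorPower.ιMulti (TrivSqZeroExt R V) 2 _ = _
  congr 1
  ext i
  fin_cases i <;> rfl

variable {R V}

/-- `ρ = ρ₀ (1 + c)` as matrices over `A = R × V`. For a given `ρ₀`, such a `ρ` is a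
first-order deformation of `ρ₀`, and `c` is its associated cocycle. -/
def EqMulOneAdd {Γ : Type*} [Group Γ] (ρ₀ : Γ →* SLInf R) (ρ : Γ →* SLInf (TrivSqZeroExt R V))
    (c : Γ → MZero R V) : Prop :=
  ∀ γ i j, entry (ρ γ : AutInf (TrivSqZeroExt R V)) i j =
    TrivSqZeroExt.inl (entry (ρ₀ γ : AutInf R) i j) +
      TrivSqZeroExt.inr (leftMul (ρ₀ γ) (c γ : Matrix ℕ ℕ V) i j)

/-- `ρ` is a first-order deformation of `ρ₀`: it reduces to `ρ₀` along `A = R × V → R`. -/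
def IsDeformation {Γ : Type*} [Group Γ] (ρ₀ : Γ →* SLInf R)
    (ρ : Γ →* SLInf (TrivSqZeroExt R V)) : Prop :=
  ∀ γ i j, (entry (ρ γ : AutInf (TrivSqZeroExt R V)) i j).fst = entry (ρ₀ γ : AutInf R) i j

/-- The cochain `(γ₁, γ₂) ↦ Tr_alt((c ∪ c)(γ₁, γ₂))`, where
`(c ∪ c)(γ₁, γ₂) = ρ₀(γ₂)⁻¹ c(γ₁) ρ₀(γ₂) ⊗ c(γ₂)`. -/
def trAltCup [Invertible (2 : R)] {Γ : Type*} [Group Γ] (ρ₀ : Γ →* SLInf R)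
    (c : Γ → MZero R V) : Γ × Γ → ⋀[R]^2 V :=
  fun p => trAlt (conj (ρ₀ p.2) (c p.1 : Matrix ℕ ℕ V)) (c p.2 : Matrix ℕ ℕ V)

end SquareZero

end SteinbergForm

end

open SteinbergForm groupCohomology

noncomputable section

namespace SteinbergForm

/-! ### Elementary consequences of the Steinberg relations -/

section Relations

variable {A : Type*} [CommRing A]

/-! Both sides of the formula come from one trace cocycle. Let `d` be a derivation from `A` to a
ring `Λ` over which `A` is central. Then `g ↦ g⁻¹ dg` is a 1-cocycle for conjugation, and the trace
of its cup square, `Tr(g⁻¹ dg · dh h⁻¹)`, is a `Λ`-valued 2-cocycle on the finite automorphisms of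
`A^(ℕ)` (`cochain_cocycle`). In the central extension it defines, the elements `(e_ij(a), 0)`
satisfy the Steinberg relations (`lift_genLift_rel`). This gives `stHom` on `St(A)` and, by
restriction, a homomorphism `traceHom` on `K₂(A)`. On a symbol it is the antisymmetrisation of `u⁻¹
du · dv v⁻¹` (`traceHom_symbol`), which in an exterior algebra is twice `dlog u ∧ dlog v`; half of
`traceHom` is therefore `dlog`.

Uniqueness, the fact that values lie in degree two, and the comparison of `dlog` with its `⋀²
V`-valued version all rest on the generation of `K₂` by symbols over a local ring with `2`
invertible (`K2_le_symbolSubgroup`). A rank-one identity (`exists_rank_one`) yields a Gauss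
decomposition `St(A) = H U⁺ U⁻ U⁺`. Since the unipotent groups embed in matrices, `K₂` lies in the
group `H` generated by the `h_ij(u)`. Modulo symbols the `h_0j` are commuting homomorphisms that
generate `H`, so an element of `H` is determined there by its diagonal matrix.

For a deformation, take `d` to be `(r, v) ↦ v` with values in the exterior algebra of `V`. Then `ρ⁻¹
dρ = c`, so the trace cocycle on `ρ(γ₁), ρ(γ₂)` is exactly `2 Tr_alt(c ∪ c)` (`coe_trAltCup`). The
central coordinates of the lifts `s(ρ(γ))`, halved and negated, form a cochain whose coboundary is
`dlog κ_ρ + Tr_alt(c ∪ c)`. -/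

lemma x_congr {i j i' j' : ℕ} {a a' : A} {h : i ≠ j} {h' : i' ≠ j'} (hi : i = i') (hj : j = j')
    (ha : a = a') : x h a = x h' a' := by
  subst hi hj ha
  rfl

lemma x_mul {i j : ℕ} (h : i ≠ j) (a b : A) : x h a * x h b = x h (a + b) :=
  mul_inv_eq_one.mp <| (PresentedGroup.one_of_mem (IsSteinbergRel.add h a b) :
    PresentedGroup.mk {r : FreeGroup (Gen A) | IsSteinbergRel A r} _ = 1)

@[simp]
lemma x_zero {i j : ℕ} (h : i ≠ j) : x h (0 : A) = 1 := by
  simpa using x_mul h (0 : A) 0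

lemma x_inv {i j : ℕ} (h : i ≠ j) (a : A) : (x h a)⁻¹ = x h (-a) := by
  rw [inv_eq_iff_mul_eq_one, x_mul, add_neg_cancel, x_zero]

lemma x_commutator {i j k : ℕ} (hij : i ≠ j) (hjk : j ≠ k) (hik : i ≠ k) (a b : A) :
    ⁅x hij a, x hjk b⁆ = x hik (a * b) :=
  mul_inv_eq_one.mp <| (PresentedGroup.one_of_mem (IsSteinbergRel.comm_mul hij hjk hik a b) :
    PresentedGroup.mk {r : FreeGroup (Gen A) | IsSteinbergRel A r} _ = 1)

lemma x_commute {i j k l : ℕ} (hij : i ≠ j) (hkl : k ≠ l) (hjk : j ≠ k) (hil : i ≠ l) (a b : A) :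
    Commute (x hij a) (x hkl b) :=
  commutatorElement_eq_one_iff_mul_comm.mp <|
    (PresentedGroup.one_of_mem (IsSteinbergRel.comm_one hij hkl hjk hil a b) :
      PresentedGroup.mk {r : FreeGroup (Gen A) | IsSteinbergRel A r} _ = 1)

lemma conj_mul_eq {G : Type*} [Group G] (g a b : G) :
    g * (a * b) * g⁻¹ = g * a * g⁻¹ * (g * b * g⁻¹) := by
  group

lemma conj_x_of_commute {i j k l : ℕ} (hij : i ≠ j) (hkl : k ≠ l) (hjk : j ≠ k) (hil : i ≠ l)
    (t a : A) : x hij t * x hkl a * (x hij t)⁻¹ = x hkl a := by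
  rw [(x_commute hij hkl hjk hil t a).eq, mul_inv_cancel_right]

lemma conj_x_left {i j l : ℕ} (hij : i ≠ j) (hjl : j ≠ l) (hil : i ≠ l) (t a : A) :
    x hij t * x hjl a * (x hij t)⁻¹ = x hil (t * a) * x hjl a := by
  rw [← x_commutator hij hjl hil, commutatorElement_def]
  group

lemma conj_x_right {i j k : ℕ} (hij : i ≠ j) (hki : k ≠ i) (hkj : k ≠ j) (t a : A) :
    x hij t * x hki a * (x hij t)⁻¹ = x hkj (-(a * t)) * x hki a := by
  rw [← x_inv, ← x_commutator hki hij hkj, commutatorElement_def]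
  group

/-- Elements of the Steinberg group are determined by their effect on the generators. -/
lemma St.induction {p : St A → Prop} (one : p 1) (mul : ∀ s t, p s → p t → p (s * t))
    (x : ∀ (i j : ℕ) (h : i ≠ j) (a : A), p (x h a)) (s : St A) : p s := by
  obtain ⟨s, rfl⟩ := PresentedGroup.mk_surjective _ s
  induction s using FreeGroup.induction_on with
  | C1 => simpa using one
  | of g => exact x _ _ g.1.2 g.2
  | inv_of g _ =>
    have := x _ _ g.1.2 (-g.2)
    rwa [← x_inv] at this
  | mul a b ha hb => rw [map_mul]; exact mul _ _ ha hb

end Relations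

/-! ### Monomial elements `w_ij(u)` and `h_ij(u)` -/

section Monomial

variable {A : Type*} [CommRing A]

/-- `g` acts on the generators by conjugation as the monomial matrix sending `e_k` to
`μ_k e_{σ k}`. -/
def IsMonomial (g : St A) (σ : Equiv.Perm ℕ) (μ : ℕ → Aˣ) : Prop :=
  ∀ (k l : ℕ) (h : k ≠ l) (a : A),
    g * x h a * g⁻¹ = x (σ.injective.ne h) (μ k * a * ↑(μ l)⁻¹)

lemma IsMonomial.one : IsMonomial (1 : St A) 1 1 := by
  intro k l h a
  simp

lemma IsMonomial.mul {g g' : St A} {σ σ' : Equiv.Perm ℕ} {μ μ' : ℕ → Aˣ}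
    (hg : IsMonomial g σ μ) (hg' : IsMonomial g' σ' μ') :
    IsMonomial (g * g') (σ * σ') (fun k => μ (σ' k) * μ' k) := by
  intro k l h a
  have : g * g' * x h a * (g * g')⁻¹ = g * (g' * x h a * g'⁻¹) * g⁻¹ := by group
  rw [this, hg', hg]
  refine x_congr rfl rfl ?_
  simp only [Units.val_mul, mul_inv]
  ring

lemma w_neg {i j : ℕ} (h : i ≠ j) (u : Aˣ) : w h (-u) = (w h u)⁻¹ := by
  simp only [w, mul_inv_rev, x_inv, Units.val_neg, inv_neg, mul_assoc]

lemma hElt_eq {i j : ℕ} (h : i ≠ j) (u : Aˣ) : hElt h u = w h u * (w h 1)⁻¹ := by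
  rw [hElt, ← w_neg]

@[simp]
lemma hElt_one {i j : ℕ} (h : i ≠ j) : hElt h (1 : Aˣ) = 1 := by
  rw [hElt_eq, mul_inv_cancel]

/-- The coefficients of the monomial matrix of `w_ij(u)`. -/
def wCoeff (i j : ℕ) (u : Aˣ) (k : ℕ) : Aˣ := if k = j then u else if k = i then -u⁻¹ else 1

/-- This and the next three lemmas treat the roots sharing exactly one index with `{i, j}`.
Conjugating by the three factors of `w_ij(u)` in turn produces commuting root elements, and the
contributions in the original position cancel. -/
lemma conj_w_aux₁ {i j l : ℕ} (h : i ≠ j) (hil : i ≠ l) (hjl : j ≠ l) (u : Aˣ) (a : A) :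
    w h u * x hil a * (w h u)⁻¹ = x hjl (-(↑u⁻¹ * a)) := by
  have : w h u * x hil a * (w h u)⁻¹ = x h (u : A) * (x h.symm (-(↑u⁻¹ : A)) *
    (x h (u : A) * x hil a * (x h (u : A))⁻¹) * (x h.symm (-(↑u⁻¹ : A)))⁻¹) *
      (x h (u : A))⁻¹ := by
    rw [w]; group
  rw [this, conj_x_of_commute h hil h.symm hil, conj_x_left h.symm hil hjl, conj_mul_eq,
    conj_x_left h hjl hil, conj_x_of_commute h hil h.symm hil,
    mul_assoc (x hil _), (x_commute hjl hil hil.symm hjl _ _).eq, ← mul_assoc, x_mul]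
  simp

lemma conj_w_aux₂ {i j l : ℕ} (h : i ≠ j) (hil : i ≠ l) (hjl : j ≠ l) (u : Aˣ) (a : A) :
    w h u * x hjl a * (w h u)⁻¹ = x hil (↑u * a) := by
  have : w h u * x hjl a * (w h u)⁻¹ = x h (u : A) * (x h.symm (-(↑u⁻¹ : A)) *
    (x h (u : A) * x hjl a * (x h (u : A))⁻¹) * (x h.symm (-(↑u⁻¹ : A)))⁻¹) *
      (x h (u : A))⁻¹ := by
    rw [w]; group
  rw [this, conj_x_left h hjl hil, conj_mul_eq (x h.symm _), conj_x_left h.symm hil hjl,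
    conj_x_of_commute h.symm hjl h hjl,
    mul_assoc (x hjl _), (x_commute hil hjl hjl.symm hil _ _).eq, ← mul_assoc (x hjl _), x_mul]
  simp only [neg_mul, Units.inv_mul_cancel_left, neg_add_cancel, x_zero, one_mul]
  rw [conj_x_of_commute h hil h.symm hil]

lemma conj_w_aux₃ {i j k : ℕ} (h : i ≠ j) (hki : k ≠ i) (hkj : k ≠ j) (u : Aˣ) (a : A) :
    w h u * x hki a * (w h u)⁻¹ = x hkj (-(a * u)) := by
  have : w h u * x hki a * (w h u)⁻¹ = x h (u : A) * (x h.symm (-(↑u⁻¹ : A)) *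
    (x h (u : A) * x hki a * (x h (u : A))⁻¹) * (x h.symm (-(↑u⁻¹ : A)))⁻¹) *
      (x h (u : A))⁻¹ := by
    rw [w]; group
  rw [this, conj_x_right h hki hkj, conj_mul_eq (x h.symm _), conj_x_right h.symm hkj hki,
    conj_x_of_commute h.symm hki hki.symm h.symm,
    mul_assoc (x hki _), (x_commute hkj hki hkj.symm hki _ _).eq, ← mul_assoc (x hki _),
    x_mul]
  simp only [neg_mul, mul_neg, neg_neg, Units.mul_inv_cancel_right, neg_add_cancel, x_zero,
    one_mul]
  rw [conj_x_of_commute h hkj hkj.symm h]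

lemma conj_w_aux₄ {i j k : ℕ} (h : i ≠ j) (hki : k ≠ i) (hkj : k ≠ j) (u : Aˣ) (a : A) :
    w h u * x hkj a * (w h u)⁻¹ = x hki (a * ↑u⁻¹) := by
  have : w h u * x hkj a * (w h u)⁻¹ = x h (u : A) * (x h.symm (-(↑u⁻¹ : A)) *
    (x h (u : A) * x hkj a * (x h (u : A))⁻¹) * (x h.symm (-(↑u⁻¹ : A)))⁻¹) *
      (x h (u : A))⁻¹ := by
    rw [w]; group
  rw [this, conj_x_of_commute h hkj hkj.symm h, conj_x_right h.symm hkj hki, conj_mul_eq (x h _),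
    conj_x_right h hki hkj, conj_x_of_commute h hkj hkj.symm h,
    mul_assoc, (x_commute hki hkj hki.symm hkj _ _).eq, ← mul_assoc, x_mul]
  simp

lemma isMonomial_w {i j : ℕ} (h : i ≠ j) (u : Aˣ) :
    IsMonomial (w h u) (Equiv.swap i j) (wCoeff i j u) := by
  have key : ∀ (k l : ℕ) (hkl : k ≠ l), ¬ (k = i ∧ l = j) → ¬ (k = j ∧ l = i) → ∀ a : A,
      w h u * x hkl a * (w h u)⁻¹ = x ((Equiv.swap i j).injective.ne hkl)
        (wCoeff i j u k * a * ↑(wCoeff i j u l)⁻¹) := by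
    intro k l hkl h1 h2 a
    rcases eq_or_ne k i with rfl | hki
    · have hjl : j ≠ l := fun e => h1 ⟨rfl, e.symm⟩
      rw [conj_w_aux₁ h hkl hjl]
      exact x_congr (by simp) (by rw [Equiv.swap_apply_of_ne_of_ne hkl.symm hjl.symm])
        (by simp [wCoeff, h, hkl.symm, hjl.symm])
    rcases eq_or_ne k j with rfl | hkj
    · have hil : i ≠ l := fun e => h2 ⟨rfl, e.symm⟩
      rw [conj_w_aux₂ h hil hkl]
      exact x_congr (by simp) (by rw [Equiv.swap_apply_of_ne_of_ne hil.symm hkl.symm])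
        (by simp [wCoeff, hil.symm, hkl.symm])
    rcases eq_or_ne l i with rfl | hli
    · rw [conj_w_aux₃ h hkl hkj]
      exact x_congr (by rw [Equiv.swap_apply_of_ne_of_ne hkl hkj]) (by simp)
        (by simp [wCoeff, hkl, hkj, h, inv_neg])
    rcases eq_or_ne l j with rfl | hlj
    · rw [conj_w_aux₄ h hki hkl]
      exact x_congr (by rw [Equiv.swap_apply_of_ne_of_ne hki hkl]) (by simp)
        (by simp [wCoeff, hki, hkl])
    have hc : Commute (w h u) (x hkl a) :=
      ((x_commute h hkl hkj.symm hli.symm _ _).mul_left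
        (x_commute h.symm hkl hki.symm hlj.symm _ _)).mul_left
          (x_commute h hkl hkj.symm hli.symm _ _)
    rw [hc.eq, mul_inv_cancel_right]
    exact x_congr (by rw [Equiv.swap_apply_of_ne_of_ne hki hkj])
      (by rw [Equiv.swap_apply_of_ne_of_ne hli hlj]) (by simp [wCoeff, hki, hkj, hli, hlj])
  intro k l hkl a
  by_cases hc : (k = i ∧ l = j) ∨ (k = j ∧ l = i)
  -- For the roots `(i, j)` and `(j, i)` a third index `p` writes `x_kl(a)` as `[x_kp(a), x_pl(1)]`,
  -- and `key` applies to both entries.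
  · obtain ⟨p, hp⟩ := Infinite.exists_notMem_finset ({i, j} : Finset ℕ)
    simp only [Finset.mem_insert, Finset.mem_singleton, not_or] at hp
    have hkp : k ≠ p := by rcases hc with ⟨rfl, rfl⟩ | ⟨rfl, rfl⟩ <;> tauto
    have hpl : p ≠ l := by rcases hc with ⟨rfl, rfl⟩ | ⟨rfl, rfl⟩ <;> tauto
    have e : w h u * x hkl a * (w h u)⁻¹ =
        ⁅w h u * x hkp a * (w h u)⁻¹, w h u * x hpl 1 * (w h u)⁻¹⁆ := by
      have := x_commutator hkp hpl hkl a 1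
      rw [mul_one] at this
      rw [← this]
      simp only [commutatorElement_def]
      group
    rw [e, key k p hkp (by tauto) (by tauto), key p l hpl (by tauto) (by tauto),
      x_commutator _ _ ((Equiv.swap i j).injective.ne hkl)]
    refine x_congr rfl rfl ?_
    rw [mul_one, mul_assoc, mul_assoc, Units.inv_mul_cancel_left, ← mul_assoc]
  · push Not at hc
    exact key k l hkl (by tauto) (by tauto) a

lemma IsMonomial.conj_w {g : St A} {σ : Equiv.Perm ℕ} {μ : ℕ → Aˣ} (hg : IsMonomial g σ μ)
    {k l : ℕ} (h : k ≠ l) (u : Aˣ) :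
    g * w h u * g⁻¹ = w (σ.injective.ne h) (μ k * u * (μ l)⁻¹) := by
  rw [w, conj_mul_eq, conj_mul_eq, hg, hg, w]
  congr 2
  exact x_congr rfl rfl (by simp only [mul_inv, inv_inv, Units.val_mul]; ring)

lemma IsMonomial.conj_hElt {g : St A} {σ : Equiv.Perm ℕ} {μ : ℕ → Aˣ} (hg : IsMonomial g σ μ)
    {k l : ℕ} (h : k ≠ l) (u : Aˣ) :
    g * hElt h u * g⁻¹ = hElt (σ.injective.ne h) (μ k * u * (μ l)⁻¹) *
      (hElt (σ.injective.ne h) (μ k * (μ l)⁻¹))⁻¹ := by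
  rw [hElt_eq, conj_mul_eq, ← conj_inv, hg.conj_w, hg.conj_w, hElt_eq, hElt_eq, mul_one]
  group

/-- Conjugating `w_ij(u)` by itself changes nothing, whereas the monomial formula swaps the indices
and replaces `u` by `-u⁻¹`. -/
lemma w_symm {i j : ℕ} (h : i ≠ j) (u : Aˣ) : w h.symm (-u⁻¹) = w h u := by
  have := (isMonomial_w h u).conj_w h u
  rw [mul_inv_cancel_right] at this
  rw [this]
  -- The index `swap i j i` equals `j` only propositionally, so the indices are generalised before
  -- substituting.
  have e : ∀ {i' j' : ℕ} (h' : i' ≠ j') (v : Aˣ), i' = j → j' = i → v = -u⁻¹ →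
      w h.symm (-u⁻¹) = w h' v := by
    rintro _ _ h' v rfl rfl rfl
    rfl
  exact e _ _ (by simp) (by simp) (by simp [wCoeff, h])

lemma hElt_symm {i j : ℕ} (h : i ≠ j) (u : Aˣ) :
    hElt h.symm u = hElt h (-u⁻¹) * (hElt h (-1))⁻¹ := by
  have h1 := w_symm h.symm u
  have h2 := w_symm h.symm (1 : Aˣ)
  rw [hElt_eq, hElt_eq, hElt_eq, ← h1, ← h2]
  simp only [inv_one]
  group

/-- The coefficients of the diagonal matrix of `h_ij(u)`. -/
def hCoeff (i j : ℕ) (u : Aˣ) (k : ℕ) : Aˣ := if k = i then u else if k = j then u⁻¹ else 1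

lemma isMonomial_hElt {i j : ℕ} (h : i ≠ j) (u : Aˣ) :
    IsMonomial (hElt h u) 1 (hCoeff i j u) := by
  have := (isMonomial_w h u).mul (isMonomial_w h (-1))
  rw [Equiv.swap_mul_self] at this
  refine (congrArg _ (funext fun k => ?_)).mp this
  by_cases hi : k = i
  · subst hi; simp [hCoeff, wCoeff, h, inv_neg]
  by_cases hj : k = j
  · subst hj; simp [hCoeff, wCoeff, h, h.symm]
  simp [hCoeff, wCoeff, hi, hj, Equiv.swap_apply_of_ne_of_ne hi hj]

end Monomial

/-! ### The group generated by the `h_ij(u)`, modulo symbols -/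

section Torus

variable {A : Type*} [CommRing A]

/-- `y` lifts the diagonal matrix with entries `d` and acts on the generators accordingly. -/
def IsDiagonal (y : St A) (d : ℕ → Aˣ) : Prop :=
  IsMonomial y 1 d ∧ ∀ v k, (stToAut A y).val v k = d k * v k

lemma IsDiagonal.one : IsDiagonal (1 : St A) 1 := ⟨IsMonomial.one, by simp⟩

lemma IsDiagonal.mul {y z : St A} {d e : ℕ → Aˣ} (hy : IsDiagonal y d) (hz : IsDiagonal z e) :
    IsDiagonal (y * z) (d * e) :=
  ⟨hy.1.mul hz.1, fun v k => by
    simp [map_mul, Units.val_mul, Module.End.mul_apply, hy.2, hz.2, mul_assoc]⟩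

lemma IsDiagonal.inv {y : St A} {d : ℕ → Aˣ} (hy : IsDiagonal y d) : IsDiagonal y⁻¹ d⁻¹ := by
  refine ⟨fun k l h a => ?_, fun v k => ?_⟩
  · have := hy.1 k l h (↑(d k)⁻¹ * a * ↑(d l))
    rw [mul_inv_eq_iff_eq_mul] at this
    rw [inv_inv, mul_assoc, inv_mul_eq_iff_eq_mul]
    refine Eq.trans ?_ (Eq.trans this.symm ?_)
    · congr 1
      exact x_congr rfl rfl (by simp [mul_assoc])
    · congr 1
  · have h1 : (stToAut A y).val ((stToAut A y⁻¹).val v) k = v k := by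
      rw [← Module.End.mul_apply, ← Units.val_mul, ← map_mul, mul_inv_cancel, map_one]
      rfl
    rw [hy.2] at h1
    rw [← h1]
    simp

lemma isDiagonal_hElt {i j : ℕ} (h : i ≠ j) (u : Aˣ) :
    IsDiagonal (hElt h u) (hCoeff i j u) :=
  ⟨isMonomial_hElt h u, fun v k => by
    rw [stToAut_hElt_apply]
    by_cases hi : k = i
    · subst hi; simp [hCoeff]
    by_cases hj : k = j
    · subst hj; simp [hCoeff, hi]
    simp [hCoeff, hi, hj]⟩

lemma IsDiagonal.stToAut_eq {y z : St A} {d : ℕ → Aˣ} (hy : IsDiagonal y d)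
    (hz : IsDiagonal z d) : stToAut A y = stToAut A z := by
  apply Units.ext
  apply LinearMap.ext
  intro v
  ext k
  rw [hy.2, hz.2]

lemma IsDiagonal.eq_one {y : St A} {d : ℕ → Aˣ} (hy : IsDiagonal y d)
    (h : stToAut A y = 1) : d = 1 := by
  funext k
  have := hy.2 (Finsupp.single k 1) k
  rw [h] at this
  apply Units.ext
  simpa using this.symm

lemma IsDiagonal.mem_center {y : St A} (hy : IsDiagonal y 1) : y ∈ Subgroup.center (St A) := by
  rw [Subgroup.mem_center_iff]
  intro g
  induction g using St.induction with
  | one => simp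
  | mul s t hs ht => rw [mul_assoc, ht, ← mul_assoc, hs, mul_assoc]
  | x i j h a =>
    have := hy.1 i j h a
    rw [mul_inv_eq_iff_eq_mul] at this
    rw [this]
    congr 1
    exact x_congr rfl rfl (by simp)

/-- Two such lifts of the same diagonal matrix differ by a central element, which drops out of
commutators. -/
lemma IsDiagonal.commutator_congr {y z y' z' : St A} {d e : ℕ → Aˣ} (hy : IsDiagonal y d)
    (hz : IsDiagonal z e) (hy' : IsDiagonal y' d) (hz' : IsDiagonal z' e) :
    ⁅y, z⁆ = ⁅y', z'⁆ := by
  have h1 : y⁻¹ * y' ∈ Subgroup.center (St A) :=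
    IsDiagonal.mem_center (by simpa using hy.inv.mul hy')
  have h2 : z⁻¹ * z' ∈ Subgroup.center (St A) :=
    IsDiagonal.mem_center (by simpa using hz.inv.mul hz')
  obtain ⟨p, hp, rfl⟩ : ∃ p ∈ Subgroup.center (St A), y' = y * p := ⟨_, h1, by group⟩
  obtain ⟨q, hq, rfl⟩ : ∃ q ∈ Subgroup.center (St A), z' = z * q := ⟨_, h2, by group⟩
  rw [Subgroup.mem_center_iff] at hp hq
  simp only [commutatorElement_def, mul_inv_rev]
  have e : y * p * (z * q) * (p⁻¹ * y⁻¹) * (q⁻¹ * z⁻¹) =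
      y * (p * (z * q) * p⁻¹) * y⁻¹ * q⁻¹ * z⁻¹ := by group
  rw [e, ← hp, mul_inv_cancel_right, ← mul_assoc y z q, mul_assoc (y * z) q, ← hq y⁻¹]
  group

variable (A) in
/-- The subgroup of the Steinberg group generated by the `h_ij(u)`. -/
def torusLift : Subgroup (St A) :=
  Subgroup.closure {y | ∃ (i j : ℕ) (h : i ≠ j) (u : Aˣ), y = hElt h u}

lemma hElt_mem_torusLift {i j : ℕ} (h : i ≠ j) (u : Aˣ) : hElt h u ∈ torusLift A :=
  Subgroup.subset_closure ⟨i, j, h, u, rfl⟩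

lemma exists_isDiagonal {y : St A} (hy : y ∈ torusLift A) : ∃ d, IsDiagonal y d := by
  induction hy using Subgroup.closure_induction with
  | mem y hy =>
    obtain ⟨i, j, h, u, rfl⟩ := hy
    exact ⟨_, isDiagonal_hElt h u⟩
  | one => exact ⟨_, IsDiagonal.one⟩
  | mul y z _ _ hy hz => exact ⟨_, hy.choose_spec.mul hz.choose_spec⟩
  | inv y _ hy => exact ⟨_, hy.choose_spec.inv⟩

lemma coe_symbol (u v : Aˣ) : (symbol u v : St A) =
    ⁅hElt (i := 0) (j := 1) (by decide) u, hElt (i := 0) (j := 2) (by decide) v⁆ := rfl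

lemma isDiagonal_symbol (u v : Aˣ) : IsDiagonal (symbol u v : St A) 1 := by
  have := (((isDiagonal_hElt (i := 0) (j := 1) (by decide) u).mul
    (isDiagonal_hElt (i := 0) (j := 2) (by decide) v)).mul
    (isDiagonal_hElt (i := 0) (j := 1) (by decide) u).inv).mul
    (isDiagonal_hElt (i := 0) (j := 2) (by decide) v).inv
  rw [← commutatorElement_def] at this
  rw [coe_symbol]
  convert this using 1
  rw [mul_right_comm (hCoeff 0 1 u)]
  simp

lemma exists_isMonomial_swap (i j : ℕ) :
    ∃ (g : St A) (μ : ℕ → Aˣ), IsMonomial g (Equiv.swap i j) μ := by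
  rcases eq_or_ne i j with rfl | h
  · rw [Equiv.swap_self]
    exact ⟨1, 1, IsMonomial.one⟩
  · exact ⟨_, _, isMonomial_w h 1⟩

/-- The Steinberg symbol can be computed with any pair of distinct indices. -/
lemma commutator_hElt {i j : ℕ} (hi : 0 ≠ i) (hj : 0 ≠ j) (hij : i ≠ j) (u v : Aˣ) :
    ⁅hElt hi u, hElt hj v⁆ = (symbol u v : St A) := by
  -- The indices `0, 1, 2` are moved to `0, i, j` by two swaps; the second one starts at the image
  -- of `2` under the first.
  obtain ⟨g, μ, σ, hg, h0, h1, h2⟩ : ∃ (g : St A) (μ : ℕ → Aˣ) (σ : Equiv.Perm ℕ),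
      IsMonomial g σ μ ∧ σ 0 = 0 ∧ σ 1 = i ∧ σ 2 = j := by
    obtain ⟨g₁, μ₁, hg₁⟩ := exists_isMonomial_swap (A := A) 1 i
    obtain ⟨g₂, μ₂, hg₂⟩ := exists_isMonomial_swap (A := A) (Equiv.swap 1 i 2) j
    have e0 : Equiv.swap 1 i 0 = 0 := Equiv.swap_apply_of_ne_of_ne (by decide) hi
    refine ⟨_, _, _, hg₂.mul hg₁, ?_, ?_, ?_⟩
    · rw [Equiv.Perm.mul_apply, e0]
      refine Equiv.swap_apply_of_ne_of_ne ?_ hj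
      rw [← e0]
      exact (Equiv.injective _).ne (by decide)
    · rw [Equiv.Perm.mul_apply, Equiv.swap_apply_left]
      refine Equiv.swap_apply_of_ne_of_ne ?_ hij
      conv_lhs => rw [← Equiv.swap_apply_left 1 i]
      exact (Equiv.injective _).ne (by decide)
    · rw [Equiv.Perm.mul_apply, Equiv.swap_apply_left]
  have key : ∀ {p : ℕ} (hp : 0 ≠ p) {q : ℕ} (hq : 0 ≠ q) (_ : σ p = q) (t : Aˣ),
      IsDiagonal (g * hElt hp t * g⁻¹) (hCoeff 0 q t) := by
    rintro p hp q hq rfl t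
    rw [hg.conj_hElt hp t]
    have := (isDiagonal_hElt (σ.injective.ne hp) (μ 0 * t * (μ p)⁻¹)).mul
      (isDiagonal_hElt (σ.injective.ne hp) (μ 0 * (μ p)⁻¹)).inv
    convert this using 1
    funext k
    by_cases hk : k = 0
    · subst hk
      simp only [hCoeff, h0, if_true, Pi.mul_apply, Pi.inv_apply]
      rw [mul_right_comm (μ 0) t, mul_comm (μ 0 * _) t, mul_inv_cancel_right]
    by_cases hk' : k = σ p
    · simp [hCoeff, h0, hk', hq.symm, mul_comm, mul_left_comm]
    simp [hCoeff, h0, hk, hk']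
  -- The symbol is central, hence fixed by conjugation with `g`; of the conjugated `h`'s only the
  -- diagonals matter.
  have hs := (isDiagonal_symbol u v).mem_center
  rw [Subgroup.mem_center_iff] at hs
  have : (symbol u v : St A) = g * symbol u v * g⁻¹ := by rw [hs, mul_inv_cancel_right]
  rw [this, coe_symbol, show ∀ a b : St A, g * ⁅a, b⁆ * g⁻¹ = ⁅g * a * g⁻¹, g * b * g⁻¹⁆ by
    intro a b; simp only [commutatorElement_def]; group]
  exact (isDiagonal_hElt hi u).commutator_congr (isDiagonal_hElt hj v)
    (key _ hi h1 u) (key _ hj h2 v)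

variable (A) in
/-- The subgroup generated by the Steinberg symbols. -/
def symbolSubgroup : Subgroup (St A) :=
  Subgroup.closure (Set.range fun p : Aˣ × Aˣ => (symbol p.1 p.2 : St A))

lemma symbol_mem (u v : Aˣ) : (symbol u v : St A) ∈ symbolSubgroup A :=
  Subgroup.subset_closure ⟨(u, v), rfl⟩

lemma symbolSubgroup_le_center : symbolSubgroup A ≤ Subgroup.center (St A) := by
  rw [symbolSubgroup, Subgroup.closure_le]
  rintro _ ⟨p, rfl⟩
  exact (isDiagonal_symbol p.1 p.2).mem_center

instance : (symbolSubgroup A).Normal :=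
  ⟨fun s hs g => by
    rwa [Subgroup.mem_center_iff.mp (symbolSubgroup_le_center hs) g, mul_inv_cancel_right]⟩

lemma hElt_comm_mod {i j : ℕ} (hi : 0 ≠ i) (hj : 0 ≠ j) (hij : i ≠ j) (u v : Aˣ) :
    Commute (hElt hi u : St A ⧸ symbolSubgroup A) (hElt hj v : St A ⧸ symbolSubgroup A) := by
  rw [← commutatorElement_eq_one_iff_commute]
  exact (QuotientGroup.eq_one_iff ⁅hElt hi u, hElt hj v⁆).mpr
    (commutator_hElt hi hj hij u v ▸ symbol_mem u v)

/-- Conjugation by `h_0i(u)`, for a third index `i`, sends `h_0j(v)` to `h_0j(uv) h_0j(u)⁻¹`, but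
modulo symbols it fixes `h_0j(v)`. -/
lemma hElt_mul_mod {j : ℕ} (hj : 0 ≠ j) (u v : Aˣ) :
    (hElt hj (u * v) : St A ⧸ symbolSubgroup A) = hElt hj v * hElt hj u := by
  obtain ⟨i, hi⟩ := Infinite.exists_notMem_finset ({0, j} : Finset ℕ)
  simp only [Finset.mem_insert, Finset.mem_singleton, not_or] at hi
  have h0i : 0 ≠ i := fun e => hi.1 e.symm
  have h1 := (isDiagonal_hElt h0i u).1.conj_hElt hj v
  have e : hCoeff 0 i u 0 * v * (hCoeff 0 i u j)⁻¹ = u * v := by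
    simp [hCoeff, hj.symm, Ne.symm hi.2]
  have e' : hCoeff 0 i u 0 * (hCoeff 0 i u j)⁻¹ = u := by
    simp [hCoeff, hj.symm, Ne.symm hi.2]
  rw [e, e'] at h1
  have h2 := hElt_comm_mod h0i hj hi.2 u v
  have h3 := congrArg (QuotientGroup.mk (s := symbolSubgroup A)) h1
  simp only [QuotientGroup.mk_mul, QuotientGroup.mk_inv] at h3
  rw [h2.eq, mul_inv_cancel_right, eq_mul_inv_iff_mul_eq] at h3
  exact h3.symm

/-- Modulo symbols, `h_0j` is a homomorphism. -/
def hEltMod (j : ℕ) : Aˣ →* St A ⧸ symbolSubgroup A where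
  toFun u := hElt (Nat.succ_ne_zero j).symm u
  map_one' := by rw [hElt_one]; rfl
  map_mul' u v := by rw [mul_comm u v]; exact hElt_mul_mod _ v u

lemma hEltMod_commute (i j : ℕ) (u v : Aˣ) : Commute (hEltMod i u) (hEltMod j v) := by
  rcases eq_or_ne i j with rfl | h
  · exact (Commute.all u v).map (hEltMod i)
  · exact hElt_comm_mod _ _ (by omega) u v

/-- The canonical lift of the diagonal matrix with entries `d`, modulo symbols. -/
def diagMod (n : ℕ) (d : ℕ → Aˣ) : St A ⧸ symbolSubgroup A :=
  -- The diagonal entry of `h_0,j+1(u)` at `j + 1` is `u⁻¹`, whence the inverse. The entry of `d` at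
  -- `0` plays no role: for products of `h_ij(u)` the others force it.
  ((List.range n).map fun j => hEltMod j (d (j + 1))⁻¹).prod

lemma diagMod_succ (n : ℕ) (d : ℕ → Aˣ) :
    diagMod (n + 1) d = diagMod n d * hEltMod n (d (n + 1))⁻¹ := by
  simp [diagMod, List.range_succ]

lemma hEltMod_commute_diagMod (i n : ℕ) (u : Aˣ) (d : ℕ → Aˣ) :
    Commute (hEltMod i u) (diagMod n d) := by
  refine Commute.list_prod_right _ _ ?_
  simp only [List.mem_map, List.mem_range, forall_exists_index, and_imp, forall_apply_eq_imp_iff₂]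
  exact fun j _ => hEltMod_commute i j u _

lemma diagMod_one (n : ℕ) : diagMod n (1 : ℕ → Aˣ) = 1 := by
  simp [diagMod]

lemma diagMod_mul (n : ℕ) (d e : ℕ → Aˣ) : diagMod n (d * e) = diagMod n d * diagMod n e := by
  induction n with
  | zero => simp [diagMod]
  | succ n ih =>
    rw [diagMod_succ, diagMod_succ, diagMod_succ, ih, Pi.mul_apply, mul_inv, map_mul,
      mul_assoc (diagMod n d) (hEltMod n _), ← mul_assoc (hEltMod n _) (diagMod n e),
      (hEltMod_commute_diagMod n n _ e).eq]
    simp only [mul_assoc]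

lemma diagMod_hCoeff (n j : ℕ) (u : Aˣ) :
    diagMod n (hCoeff 0 (j + 1) u) = if j < n then hEltMod j u else 1 := by
  induction n with
  | zero => simp [diagMod]
  | succ n ih =>
    rw [diagMod_succ, ih]
    rcases lt_trichotomy j n with h | h | h
    · simp [h, h.trans (Nat.lt_succ_self n), hCoeff, h.ne']
    · simp [h, hCoeff]
    · simp [h.not_gt, show ¬ j < n + 1 by omega, hCoeff, h.ne]

/-- For `i, j ≠ 0` the conjugate of `h_0j(t)` by `w_0i(1)` is both `h_0i(t)⁻¹ h_0j(t)` and `h_ij(-t)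
h_ij(-1)⁻¹`. Taking `t = -1` and `t = -u` isolates `h_ij(u)`. -/
lemma hElt_mem_closure {i j : ℕ} (h : i ≠ j) (u : Aˣ) :
    hElt h u ∈ Subgroup.closure
      {y : St A | ∃ (j : ℕ) (u : Aˣ), y = hElt (Nat.succ_ne_zero j).symm u} := by
  set K := Subgroup.closure
    {y : St A | ∃ (j : ℕ) (u : Aˣ), y = hElt (Nat.succ_ne_zero j).symm u}
  have h0 : ∀ {j : ℕ} (h : 0 ≠ j) (u : Aˣ), hElt h u ∈ K := by
    intro j h u
    obtain ⟨j, rfl⟩ := Nat.exists_eq_succ_of_ne_zero h.symm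
    exact Subgroup.subset_closure ⟨j, u, rfl⟩
  rcases eq_or_ne 0 i with rfl | hi
  · exact h0 h u
  rcases eq_or_ne 0 j with rfl | hj
  · rw [hElt_symm hi]
    exact K.mul_mem (h0 _ _) (K.inv_mem (h0 _ _))
  have e1 : ∀ t : Aˣ, w hi 1 * hElt hj t * (w hi 1)⁻¹ = (hElt hi t)⁻¹ * hElt hj t := by
    intro t
    have h2 := (isDiagonal_hElt hj t).1.conj_w hi 1
    have h3 : hElt hj t * w hi 1 * (hElt hj t)⁻¹ = w hi t := by
      rw [h2]
      change w hi _ = _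
      congr 1
      simp [hCoeff, hi.symm, h]
    rw [hElt_eq hi t, ← h3]
    group
  have e2 : ∀ t : Aˣ, hElt h (-t) * (hElt h (-1))⁻¹ ∈ K := by
    intro t
    have h2 := (isMonomial_w hi 1).conj_hElt hj t
    rw [e1] at h2
    have e : ∀ {i' j' : ℕ} (h' : i' ≠ j') (a b : Aˣ), i' = i → j' = j → a = -t → b = -1 →
        hElt h' a * (hElt h' b)⁻¹ ∈ K → hElt h (-t) * (hElt h (-1))⁻¹ ∈ K := by
      rintro _ _ h' a b rfl rfl rfl rfl hK
      exact hK
    refine e _ _ _ (by simp) (Equiv.swap_apply_of_ne_of_ne hj.symm h.symm) ?_ ?_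
      (h2 ▸ K.mul_mem (K.inv_mem (h0 _ _)) (h0 _ _))
    · simp [wCoeff, hi, hj.symm, h.symm]
    · simp [wCoeff, hi, hj.symm, h.symm]
  have h3 := e2 (-1)
  rw [neg_neg, hElt_one, one_mul] at h3
  have h4 := K.mul_mem (e2 (-u)) (K.inv_mem h3)
  simpa using h4

/-- The bound `N` makes factors involving different indices comparable: for large `n` the product no
longer changes. -/
lemma torusLift_eq_diagMod {y : St A} (hy : y ∈ torusLift A) :
    ∃ d, IsDiagonal y d ∧ ∃ N, ∀ n ≥ N, (y : St A ⧸ symbolSubgroup A) = diagMod n d := by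
  have hy' : y ∈ Subgroup.closure
      {y : St A | ∃ (j : ℕ) (u : Aˣ), y = hElt (Nat.succ_ne_zero j).symm u} := by
    refine (Subgroup.closure_le _).mpr ?_ hy
    rintro _ ⟨i, j, h, u, rfl⟩
    exact hElt_mem_closure h u
  clear hy
  induction hy' using Subgroup.closure_induction with
  | mem y hy =>
    obtain ⟨j, u, rfl⟩ := hy
    refine ⟨_, isDiagonal_hElt _ u, j + 1, fun n hn => ?_⟩
    rw [diagMod_hCoeff, if_pos (by omega)]
    rfl
  | one => exact ⟨_, IsDiagonal.one, 0, fun n _ => (diagMod_one n).symm⟩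
  | mul y z _ _ hy hz =>
    obtain ⟨d, hd, N, hN⟩ := hy
    obtain ⟨e, he, M, hM⟩ := hz
    refine ⟨_, hd.mul he, max N M, fun n hn => ?_⟩
    rw [QuotientGroup.mk_mul, hN n (by omega), hM n (by omega), diagMod_mul]
  | inv y _ hy =>
    obtain ⟨d, hd, N, hN⟩ := hy
    refine ⟨_, hd.inv, N, fun n hn => ?_⟩
    rw [QuotientGroup.mk_inv, hN n hn, inv_eq_iff_mul_eq_one, ← diagMod_mul, mul_inv_cancel,
      diagMod_one]

/-- The part of `K₂` lying in the group generated by the `h_ij(u)` is generated by symbols. -/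
lemma mem_symbolSubgroup_of_mem_torusLift {y : St A} (hy : y ∈ torusLift A)
    (h : stToAut A y = 1) : y ∈ symbolSubgroup A := by
  obtain ⟨d, hd, N, hN⟩ := torusLift_eq_diagMod hy
  rw [← QuotientGroup.eq_one_iff, hN N le_rfl, hd.eq_one h, diagMod_one]

end Torus

/-! ### Unipotent subgroups and radicals of minimal parabolics -/

section RootGroups

variable {A : Type*} [CommRing A]

variable (A) in
/-- The subgroup generated by the `x_ij(a)` with `P i j`. -/
def rootGroup (P : ℕ → ℕ → Prop) : Subgroup (St A) :=
  Subgroup.closure {y | ∃ (i j : ℕ) (h : i ≠ j) (a : A), P i j ∧ y = x h a}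

lemma x_mem_rootGroup {P : ℕ → ℕ → Prop} {i j : ℕ} (hP : P i j) (h : i ≠ j) (a : A) :
    x h a ∈ rootGroup A P :=
  Subgroup.subset_closure ⟨i, j, h, a, hP, rfl⟩

lemma rootGroup_le {P : ℕ → ℕ → Prop} {K : Subgroup (St A)}
    (H : ∀ (i j : ℕ) (h : i ≠ j) (a : A), P i j → x h a ∈ K) : rootGroup A P ≤ K := by
  rw [rootGroup, Subgroup.closure_le]
  rintro _ ⟨i, j, h, a, hP, rfl⟩
  exact H i j h a hP

lemma rootGroup_conj {P : ℕ → ℕ → Prop} {K : Subgroup (St A)} {g : St A}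
    (H : ∀ (i j : ℕ) (h : i ≠ j) (a : A), P i j → g * x h a * g⁻¹ ∈ K) {y : St A}
    (hy : y ∈ rootGroup A P) : g * y * g⁻¹ ∈ K :=
  rootGroup_le (K := K.comap (MulAut.conj g).toMonoidHom) H hy

lemma IsDiagonal.conj_mem {P : ℕ → ℕ → Prop} {g y : St A} {d : ℕ → Aˣ} (hg : IsDiagonal g d)
    (hy : y ∈ rootGroup A P) : g * y * g⁻¹ ∈ rootGroup A P := by
  refine rootGroup_conj (fun i j h a hP => ?_) hy
  rw [hg.1]
  exact x_mem_rootGroup hP _ _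

lemma torusLift_conj_mem {P : ℕ → ℕ → Prop} {g y : St A} (hg : g ∈ torusLift A)
    (hy : y ∈ rootGroup A P) : g * y * g⁻¹ ∈ rootGroup A P :=
  (exists_isDiagonal hg).choose_spec.conj_mem hy

variable (A) in
/-- The unipotent subgroup attached to the ordering of the indices by the values of `f`. -/
abbrev upper (f : ℕ → ℤ) : Subgroup (St A) := rootGroup A fun i j => f i < f j

variable (A) in
/-- The unipotent radical of the minimal parabolic subgroup attached to a simple root `(k, k')`. -/
abbrev radical (f : ℕ → ℤ) (k k' : ℕ) : Subgroup (St A) :=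
  rootGroup A fun i j => f i < f j ∧ ¬ (i = k ∧ j = k')

variable {f : ℕ → ℤ} {k k' : ℕ}

lemma radical_le_upper : radical A f k k' ≤ upper A f :=
  rootGroup_le fun _ _ h a hP => x_mem_rootGroup (P := fun i j => f i < f j) hP.1 h a

/-- The root `(k, k')` is simple, so it is not a sum of two positive roots; the commutators produce
only other positive roots. -/
lemma radical_conj_pos (hk : f k' = f k + 1) (hkk : k ≠ k') (t : A)
    {y : St A} (hy : y ∈ radical A f k k') :
    x hkk t * y * (x hkk t)⁻¹ ∈ radical A f k k' := by
  refine rootGroup_conj (fun i j h a hP => ?_) hy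
  obtain ⟨hij, hne⟩ := hP
  rcases eq_or_ne k' i with rfl | h1
  · have hkj : k ≠ j := by rintro rfl; omega
    rw [conj_x_left hkk h hkj]
    exact mul_mem (x_mem_rootGroup ⟨by omega, fun e => h e.2.symm⟩ _ _)
      (x_mem_rootGroup ⟨hij, hne⟩ _ _)
  rcases eq_or_ne k j with rfl | h2
  · have hik : i ≠ k' := by rintro rfl; omega
    rw [conj_x_right hkk h hik]
    exact mul_mem (x_mem_rootGroup ⟨by omega, fun e => h e.1⟩ _ _)
      (x_mem_rootGroup ⟨hij, hne⟩ _ _)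
  rw [conj_x_of_commute hkk h h1 h2]
  exact x_mem_rootGroup ⟨hij, hne⟩ _ _

/-- Adding `(k', k)` to a positive root leaves the positive ones only from `(k, k')`, which the
radical omits; injectivity of `f` rules out ties. -/
lemma radical_conj_neg (hf : Function.Injective f) (hk : f k' = f k + 1) (hkk : k' ≠ k) (t : A)
    {y : St A} (hy : y ∈ radical A f k k') :
    x hkk t * y * (x hkk t)⁻¹ ∈ radical A f k k' := by
  refine rootGroup_conj (fun i j h a hP => ?_) hy
  obtain ⟨hij, hne⟩ := hP
  rcases eq_or_ne k i with rfl | h1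
  · have hkj : k' ≠ j := fun e => hne ⟨rfl, e.symm⟩
    have hfj := hf.ne hkj
    rw [conj_x_left hkk h hkj]
    exact mul_mem (x_mem_rootGroup ⟨by omega, fun e => hkk e.1⟩ _ _)
      (x_mem_rootGroup ⟨hij, hne⟩ _ _)
  rcases eq_or_ne k' j with rfl | h2
  · have hik : i ≠ k := fun e => hne ⟨e, rfl⟩
    have hfi := hf.ne hik
    rw [conj_x_right hkk h hik]
    exact mul_mem (x_mem_rootGroup ⟨by omega, fun e => hik e.1⟩ _ _)
      (x_mem_rootGroup ⟨hij, hne⟩ _ _)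
  rw [conj_x_of_commute hkk h h1 h2]
  exact x_mem_rootGroup ⟨hij, hne⟩ _ _

lemma exists_radical_mul (hk : f k' = f k + 1) (hkk : k ≠ k')
    {y : St A} (hy : y ∈ upper A f) : ∃ n ∈ radical A f k k', ∃ a, y = n * x hkk a := by
  induction hy using Subgroup.closure_induction with
  | mem y hy =>
    obtain ⟨i, j, h, a, hij, rfl⟩ := hy
    by_cases hc : i = k ∧ j = k'
    · obtain ⟨rfl, rfl⟩ := hc
      exact ⟨1, one_mem _, a, by simp⟩
    · exact ⟨x h a, x_mem_rootGroup ⟨hij, hc⟩ _ _, 0, by simp⟩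
  | one => exact ⟨1, one_mem _, 0, by simp⟩
  | mul y z _ _ hy hz =>
    obtain ⟨n, hn, a, rfl⟩ := hy
    obtain ⟨m, hm, b, rfl⟩ := hz
    refine ⟨_, mul_mem hn (radical_conj_pos hk hkk a hm), a + b, ?_⟩
    rw [← x_mul]
    group
  | inv y _ hy =>
    obtain ⟨n, hn, a, rfl⟩ := hy
    refine ⟨_, radical_conj_pos hk hkk (-a) (inv_mem hn), -a, ?_⟩
    rw [← x_inv]
    group

lemma exists_mul_radical (hk : f k' = f k + 1) (hkk : k ≠ k')
    {y : St A} (hy : y ∈ upper A f) : ∃ n ∈ radical A f k k', ∃ a, y = x hkk a * n := by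
  obtain ⟨n, hn, a, e⟩ := exists_radical_mul hk hkk (inv_mem hy)
  refine ⟨n⁻¹, inv_mem hn, -a, ?_⟩
  rw [← x_inv, ← mul_inv_rev, ← e, inv_inv]

end RootGroups

/-! ### Exchanging opposite root elements over a local ring -/

section RankOne

variable {A : Type*} [CommRing A]

lemma w_mul_w_mem {i j : ℕ} (h : i ≠ j) (u v : Aˣ) : w h u * w h v ∈ torusLift A := by
  have : w h u * w h v = hElt h u * (hElt h (-v))⁻¹ := by
    rw [hElt_eq, hElt_eq, w_neg]
    group
  rw [this]
  exact mul_mem (hElt_mem_torusLift _ _) (inv_mem (hElt_mem_torusLift _ _))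

lemma exists_x_mul_torus {g : St A} (hg : g ∈ torusLift A) {i j : ℕ} (h : i ≠ j) (a : A) :
    ∃ v : Aˣ, x h a * g = g * x h (v * a) := by
  obtain ⟨d, hd⟩ := exists_isDiagonal hg
  refine ⟨(d i)⁻¹ * d j, ?_⟩
  have := hd.inv.1 i j h a
  rw [inv_inv, mul_assoc, inv_mul_eq_iff_eq_mul] at this
  rw [this]
  congr 1
  exact x_congr rfl rfl (by simp; ring)

/-- With `e = u⁻¹ + d`, both `x_ij(u)` and `x_ji(e)` are expanded through `w_ij`, and the `w`'s are
collected on the left. The coefficient is recorded as `d * p` because `exists_swap` needs it to be a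
non-unit whenever `d` is. -/
lemma exists_swap_of_isUnit {i j : ℕ} (h : i ≠ j) (u : Aˣ) (d : A)
    (hu : IsUnit (1 + u * d)) : ∃ g ∈ torusLift A, ∃ p q : A,
      x h (u : A) * x h.symm d = g * x h.symm (d * p) * x h q := by
  obtain ⟨e, he⟩ : ∃ e : Aˣ, (e : A) = ↑u⁻¹ + d := by
    refine ⟨u⁻¹ * hu.unit, ?_⟩
    rw [Units.val_mul, IsUnit.unit_spec, mul_add, mul_one, Units.inv_mul_cancel_left]
  have e1 : x h (u : A) = w h u * x h (-(u : A)) * x h.symm (↑u⁻¹ : A) := by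
    simp only [w, ← x_inv]
    group
  have e2 : x h.symm (e : A) = x h (↑e⁻¹ : A) * w h (-e⁻¹) * x h (↑e⁻¹ : A) := by
    simp only [w, Units.val_neg, inv_neg, inv_inv, neg_neg, ← x_inv (a := (↑e⁻¹ : A))]
    group
  have e3 := isMonomial_w h e⁻¹ i j h (-(u : A) + ↑e⁻¹)
  have e4 : w h e⁻¹ * x h (-(u : A) + ↑e⁻¹) * (w h e⁻¹)⁻¹ = x h.symm (d * (e * u)) := by
    rw [e3]
    refine x_congr (by simp) (by simp) ?_
    have h1 : (e : A) * ↑e⁻¹ = 1 := e.mul_inv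
    have h2 : (e : A) * u = 1 + d * u := by rw [he, add_mul, Units.inv_mul]
    simp only [wCoeff, h, if_true, if_false, inv_inv, Units.val_neg]
    linear_combination (-e : A) * h1 + (e : A) * h2
  refine ⟨_, w_mul_w_mem h u (-e⁻¹), e * u, ↑e⁻¹, ?_⟩
  rw [← e4, e1, mul_assoc, x_mul, ← he, e2, ← x_mul, w_neg]
  group

lemma exists_swap [IsLocalRing A] {i j : ℕ} (h : i ≠ j) (c d : A) (hu : IsUnit (1 + c * d)) :
    ∃ g ∈ torusLift A, ∃ p q : A, x h c * x h.symm d = g * x h.symm p * x h q := by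
  by_cases hc : IsUnit c
  · obtain ⟨u, rfl⟩ := hc
    obtain ⟨g, hg, p, q, e⟩ := exists_swap_of_isUnit h u d hu
    exact ⟨g, hg, _, q, e⟩
  by_cases hd : IsUnit d
  · obtain ⟨u, rfl⟩ := hd
    -- The exchange is applied to the inverse `x_ji(-d) x_ij(-c)`, whose first coefficient is a
    -- unit.
    obtain ⟨g, hg, p, q, e⟩ := exists_swap_of_isUnit h.symm (-u) (-c)
      (by convert hu using 1; simp; ring)
    obtain ⟨v, hv⟩ := exists_x_mul_torus (inv_mem hg) h (-(-c * p))
    obtain ⟨v', hv'⟩ := exists_x_mul_torus (inv_mem hg) h.symm (-q)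
    refine ⟨_, inv_mem hg, v' * -q, v * -(-c * p), ?_⟩
    · rw [← hv', mul_assoc, ← hv, ← x_inv, ← x_inv, ← mul_assoc, ← mul_inv_rev, ← mul_inv_rev,
        ← mul_assoc, ← e, Units.val_neg, ← x_inv, ← x_inv]
      group
  -- Both coefficients are non-units: `c = (c - 1) + 1` is a sum of two units, and the exchange is
  -- made twice. After the first, `d * p` is still a non-unit, which permits the second.
  · have h1 : IsUnit (1 + (1 : Aˣ) * d) := by
      rw [Units.val_one, one_mul, add_comm]
      by_contra hn
      exact (IsLocalRing.nonunits_add hn (by simpa using hd : -d ∈ nonunits A)) (by simp)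
    obtain ⟨g, hg, p, q, e⟩ := exists_swap_of_isUnit h 1 d h1
    obtain ⟨v, hv⟩ := exists_x_mul_torus hg h (c - 1)
    have hc1 : IsUnit (c - 1) := by
      by_contra hn
      exact (IsLocalRing.nonunits_add (a := -(c - 1)) (fun hh => hn ((IsUnit.neg_iff _).mp hh)) hc) (by simp)
    obtain ⟨t, ht⟩ : ∃ t : Aˣ, (t : A) = v * (c - 1) := ⟨v * hc1.unit, by simp⟩
    have h2 : IsUnit (1 + t * (d * p)) := by
      by_contra hn
      refine IsLocalRing.nonunits_add hn (b := -(t * (d * p))) ?_ (by simp)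
      rw [mem_nonunits_iff, IsUnit.neg_iff]
      intro hh
      exact hd (isUnit_of_mul_isUnit_left (isUnit_of_mul_isUnit_right hh))
    obtain ⟨g', hg', p', q', e'⟩ := exists_swap_of_isUnit h t (d * p) h2
    refine ⟨g * g', mul_mem hg hg', d * p * p', q' + q, ?_⟩
    · have : x h c = x h (c - 1) * x h ((1 : Aˣ) : A) := by rw [x_mul]; simp
      rw [this, mul_assoc, e, ← mul_assoc, ← mul_assoc, hv, ← ht, mul_assoc g, e', ← x_mul]
      simp only [mul_assoc]

/-- Splitting the middle coefficient as `c₁ + c₂` reduces this to one exchange on each side,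
provided `1 + b c₁` and `1 + c₂ d` are units. -/
lemma exists_rank_one [IsLocalRing A] (two : IsUnit (2 : A)) {i j : ℕ} (h : i ≠ j)
    (b c d : A) : ∃ g ∈ torusLift A, ∃ p q r : A,
      x h.symm b * x h c * x h.symm d = g * x h p * x h.symm q * x h r := by
  have key : ∀ c₁ c₂ : A, IsUnit (1 + b * c₁) → IsUnit (1 + c₂ * d) → c₁ + c₂ = c →
      ∃ g ∈ torusLift A, ∃ p q r : A,
        x h.symm b * x h c * x h.symm d = g * x h p * x h.symm q * x h r := by
    rintro c₁ c₂ h1 h2 rfl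
    obtain ⟨g, hg, p, q, e⟩ := exists_swap h.symm b c₁ h1
    obtain ⟨g', hg', p', q', e'⟩ := exists_swap h c₂ d h2
    obtain ⟨v, hv⟩ := exists_x_mul_torus hg' h p
    obtain ⟨v', hv'⟩ := exists_x_mul_torus hg' h.symm q
    refine ⟨g * g', mul_mem hg hg', v * p, v' * q + p', q', ?_⟩
    have : x h.symm b * x h (c₁ + c₂) * x h.symm d =
        (x h.symm b * x h c₁) * (x h c₂ * x h.symm d) := by
      rw [← x_mul]; group
    rw [this, e, e', ← x_mul]
    calc g * x h p * x h.symm q * (g' * x h.symm p' * x h q')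
        = g * (x h p * (x h.symm q * g')) * x h.symm p' * x h q' := by group
      _ = _ := by
        rw [hv', ← mul_assoc (x h p), hv]
        group
  by_cases h1 : IsUnit (1 + b * c)
  · exact key c 0 h1 (by simp) (by simp)
  by_cases h2 : IsUnit (1 + c * d)
  · exact key 0 c (by simp) h2 (by simp)
  -- Now `bc` and `cd` are `-1` modulo the maximal ideal, so `1 - bc` becomes `2` and `1 + 2cd`
  -- becomes `-1`. The invertibility of `2` enters here.
  refine key (-c) (2 * c) ?_ ?_ (by ring)
  · by_contra hn
    refine IsLocalRing.nonunits_add hn h1 ?_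
    convert two using 1
    ring
  · by_contra hn
    refine IsLocalRing.nonunits_add (b := -2 * (1 + c * d)) hn ?_ ?_
    · exact fun hh => h2 (isUnit_of_mul_isUnit_right hh)
    · rw [show 1 + 2 * c * d + -2 * (1 + c * d) = -1 by ring]
      exact isUnit_one.neg

end RankOne

/-! ### Gauss decomposition -/

section Gauss

variable {A : Type*} [CommRing A]

/-- `y` lies in `H U⁺ U⁻ U⁺`. -/
def HasGauss (f : ℕ → ℤ) (y : St A) : Prop :=
  ∃ g ∈ torusLift A, ∃ u ∈ upper A f, ∃ v ∈ upper A (-f), ∃ u' ∈ upper A f, y = g * u * v * u'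

/-- Only the rank-one product `x_k'k(c) x_kk'(a) x_k'k(t)` in the middle has to be rewritten. The
radicals of `U⁺` and `U⁻` are normalised by both root groups, so their factors can be moved out of
the way. -/
lemma HasGauss.mul_x [IsLocalRing A] (two : IsUnit (2 : A)) {f : ℕ → ℤ} {k k' : ℕ}
    (hf : Function.Injective f) (hk : f k' = f k + 1) (hkk : k ≠ k') {y : St A}
    (hy : HasGauss f y) (t : A) : HasGauss f (y * x hkk.symm t) := by
  obtain ⟨g, hg, u, hu, v, hv, u', hu', rfl⟩ := hy
  have hf' : Function.Injective (-f) := fun i j e => hf (neg_injective e)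
  have hk' : (-f) k = (-f) k' + 1 := by simp [hk]
  obtain ⟨n, hn, a, rfl⟩ := exists_mul_radical hk hkk hu'
  obtain ⟨l, hl, c, rfl⟩ := exists_radical_mul hk' hkk.symm hv
  obtain ⟨g', hg', p, q, r, e⟩ := exists_rank_one two hkk c a t
  have hn' := radical_conj_neg hf hk hkk.symm (-t) hn
  obtain ⟨s, hs⟩ := exists_x_mul_torus (inv_mem hg') hkk p
  have hl' := radical_conj_neg hf' hk' hkk (-(s * p)) hl
  have hsimple : ∀ b : A, x hkk b ∈ upper A f := fun b => x_mem_rootGroup (by omega) _ _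
  have hsimple' : ∀ b : A, x hkk.symm b ∈ upper A (-f) := fun b =>
    x_mem_rootGroup (by simp; omega) _ _
  have hl'' := torusLift_conj_mem (inv_mem hg') (radical_le_upper hl')
  have hu2 := torusLift_conj_mem (inv_mem hg') (mul_mem hu (hsimple (s * p)))
  refine ⟨g * g', mul_mem hg hg', _, hu2, _, mul_mem hl'' (hsimple' q), _,
    mul_mem (hsimple r) (radical_le_upper hn'), ?_⟩
  have e5 : g' * x hkk p = x hkk (s * p) * g' := by
    rw [← mul_inv_eq_iff_eq_mul, mul_assoc, hs, mul_inv_cancel_left]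
  rw [← x_inv] at hn' hl'
  calc g * u * (l * x hkk.symm c) * (x hkk a * n) * x hkk.symm t
      = g * u * l * (x hkk.symm c * x hkk a * x hkk.symm t) *
        ((x hkk.symm t)⁻¹ * n * x hkk.symm t) := by group
    _ = g * u * l * (g' * x hkk p) * x hkk.symm q * x hkk r *
        ((x hkk.symm t)⁻¹ * n * x hkk.symm t) := by rw [e]; group
    _ = _ := by
      rw [e5, ← x_inv, ← x_inv]
      group

lemma HasGauss.mul_x_pos {f : ℕ → ℤ} {i j : ℕ} (hij : f i < f j) (h : i ≠ j) {y : St A}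
    (hy : HasGauss f y) (t : A) : HasGauss f (y * x h t) := by
  obtain ⟨g, hg, u, hu, v, hv, u', hu', rfl⟩ := hy
  exact ⟨g, hg, u, hu, v, hv, _, mul_mem hu' (x_mem_rootGroup hij h t), by group⟩

-- Induction on `|i - j|`: a root element is the commutator of a shorter one and a simple one.
variable (A) in
lemma closure_simple_eq_top : Subgroup.closure
    {y : St A | ∃ (k : ℕ) (a : A), y = x (Nat.succ_ne_self k).symm a ∨
      y = x (Nat.succ_ne_self k) a} = ⊤ := by
  set K := Subgroup.closure {y : St A | ∃ (k : ℕ) (a : A), y = x (Nat.succ_ne_self k).symm a ∨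
      y = x (Nat.succ_ne_self k) a} with hK
  have key : ∀ (m i j : ℕ) (h : i ≠ j) (a : A), j = i + (m + 1) → x h a ∈ K ∧ x h.symm a ∈ K := by
    intro m
    induction m with
    | zero =>
      rintro i _ h a rfl
      exact ⟨Subgroup.subset_closure ⟨i, a, Or.inl rfl⟩,
        Subgroup.subset_closure ⟨i, a, Or.inr rfl⟩⟩
    | succ m ih =>
      rintro i j h a hj
      have h1 : i ≠ i + (m + 1) := by omega
      have h2 : i + (m + 1) ≠ j := by omega
      obtain ⟨p1, q1⟩ := ih i (i + (m + 1)) h1 a rfl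
      have p2 : ∀ b, x h2 b ∈ K := fun b =>
        Subgroup.subset_closure ⟨i + (m + 1), b, Or.inl (x_congr rfl (by omega) rfl)⟩
      have q2 : ∀ b, x h2.symm b ∈ K := fun b =>
        Subgroup.subset_closure ⟨i + (m + 1), b, Or.inr (x_congr (by omega) rfl rfl)⟩
      constructor
      · have := x_commutator h1 h2 h a 1
        rw [mul_one] at this
        rw [← this, commutatorElement_def]
        exact mul_mem (mul_mem (mul_mem p1 (p2 _)) (inv_mem p1)) (inv_mem (p2 _))
      · have := x_commutator h2.symm h1.symm h.symm 1 a
        rw [one_mul] at this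
        rw [← this, commutatorElement_def]
        exact mul_mem (mul_mem (mul_mem (q2 _) q1) (inv_mem (q2 _))) (inv_mem q1)
  rw [eq_top_iff]
  intro s _
  induction s using St.induction with
  | one => exact one_mem _
  | mul s t hs ht => exact mul_mem (hs trivial) (ht trivial)
  | x i j h a =>
    rcases lt_or_gt_of_ne h with hlt | hlt
    · exact (key (j - i - 1) i j h a (by omega)).1
    · exact (key (i - j - 1) j i h.symm a (by omega)).2

/-- The Gauss decomposition `St(A) = H U⁺ U⁻ U⁺` over a local ring. -/
theorem hasGauss [IsLocalRing A] (two : IsUnit (2 : A)) (y : St A) :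
    HasGauss (fun n => (n : ℤ)) y := by
  have hstep : ∀ (y : St A) (k : ℕ) (a : A), HasGauss (fun n => (n : ℤ)) y →
      HasGauss (fun n => (n : ℤ)) (y * x (Nat.succ_ne_self k).symm a) ∧
      HasGauss (fun n => (n : ℤ)) (y * x (Nat.succ_ne_self k) a) := fun y k a hy =>
    ⟨hy.mul_x_pos (by simp) _ a,
      hy.mul_x two Nat.cast_injective (by simp) (Nat.succ_ne_self k).symm a⟩
  have hy : y ∈ Subgroup.closure {y : St A | ∃ (k : ℕ) (a : A),
      y = x (Nat.succ_ne_self k).symm a ∨ y = x (Nat.succ_ne_self k) a} := by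
    rw [closure_simple_eq_top]
    trivial
  induction hy using Subgroup.closure_induction_right with
  | one => exact ⟨1, one_mem _, 1, one_mem _, 1, one_mem _, 1, one_mem _, by simp⟩
  | mul_right y z _ hz ih =>
    obtain ⟨k, a, rfl | rfl⟩ := hz
    · exact (hstep y k a ih).1
    · exact (hstep y k a ih).2
  | mul_inv_cancel y z _ hz ih =>
    obtain ⟨k, a, rfl | rfl⟩ := hz
    · rw [x_inv]
      exact (hstep y k (-a) ih).1
    · rw [x_inv]
      exact (hstep y k (-a) ih).2

end Gauss

/-! ### Faithfulness on unipotent groups; generation of `K₂` by symbols -/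

section Faithful

variable {A : Type*} [CommRing A]

lemma stToAut_x_apply {i j : ℕ} (h : i ≠ j) (a : A) (v : ℕ →₀ A) :
    (stToAut A (x h a)).val v = v + Finsupp.single i (a * v j) := by
  rw [stToAut_x]
  exact elemEnd_apply i j a v

lemma stToAut_mul_apply (y z : St A) (v : ℕ →₀ A) :
    (stToAut A (y * z)).val v = (stToAut A y).val ((stToAut A z).val v) := by
  rw [map_mul]
  rfl

lemma stToAut_inv_apply_apply (y : St A) (v : ℕ →₀ A) :
    (stToAut A y⁻¹).val ((stToAut A y).val v) = v := by
  rw [← stToAut_mul_apply, inv_mul_cancel, map_one]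
  rfl

lemma rootGroup_fix {P : ℕ → ℕ → Prop} {v : ℕ →₀ A} (hv : ∀ i j, P i j → v j = 0) {y : St A}
    (hy : y ∈ rootGroup A P) : (stToAut A y).val v = v := by
  induction hy using Subgroup.closure_induction with
  | mem y hy =>
    obtain ⟨i, j, h, a, hP, rfl⟩ := hy
    simp [stToAut_x_apply, hv i j hP]
  | one => simp
  | mul y z _ _ hy hz => rw [stToAut_mul_apply, hz, hy]
  | inv y _ hy => conv_lhs => rw [← hy, stToAut_inv_apply_apply]

lemma rootGroup_coord {P : ℕ → ℕ → Prop} {i : ℕ} (hi : ∀ j, ¬ P i j) {y : St A}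
    (hy : y ∈ rootGroup A P) (v : ℕ →₀ A) : (stToAut A y).val v i = v i := by
  induction hy using Subgroup.closure_induction generalizing v with
  | mem y hy =>
    obtain ⟨i', j, h, a, hP, rfl⟩ := hy
    have : i' ≠ i := by rintro rfl; exact hi j hP
    simp [stToAut_x_apply, this]
  | one => simp
  | mul y z _ _ hy hz => rw [stToAut_mul_apply, hy, hz]
  | inv y _ hy =>
    rw [← hy, ← stToAut_mul_apply, mul_inv_cancel, map_one]
    rfl

/-- A product of `x_im(a)` with a fixed column `m` is determined by its `m`-th column. -/
lemma column_eq_one (m : ℕ) (F : Finset ℕ) (hm : m ∉ F) {y : St A}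
    (hy : y ∈ rootGroup A fun i j => i ∈ F ∧ j = m)
    (h : (stToAut A y).val (Finsupp.single m 1) = Finsupp.single m 1) : y = 1 := by
  induction F using Finset.induction_on generalizing y with
  | empty =>
    have : rootGroup A (fun i j => i ∈ (∅ : Finset ℕ) ∧ j = m) ≤ ⊥ :=
      rootGroup_le fun i j _ _ hP => by simp at hP
    exact Subgroup.mem_bot.mp (this hy)
  | insert k F hk ih =>
    have hkm : k ≠ m := by rintro rfl; simp at hm
    have hmF : m ∉ F := fun e => hm (Finset.mem_insert_of_mem e)
    have dec : ∃ z ∈ rootGroup A (fun i j => i ∈ F ∧ j = m), ∃ a, y = z * x hkm a := by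
      clear h
      have comm : ∀ (a : A), ∀ z ∈ rootGroup A (fun i j => i ∈ F ∧ j = m),
          x hkm a * z * (x hkm a)⁻¹ ∈ rootGroup A (fun i j => i ∈ F ∧ j = m) := by
        refine fun a z hz => rootGroup_conj (fun i j h b hP => ?_) hz
        obtain ⟨hi, rfl⟩ := hP
        rw [conj_x_of_commute hkm h h.symm hkm]
        exact x_mem_rootGroup ⟨hi, rfl⟩ _ _
      induction hy using Subgroup.closure_induction with
      | mem y hy =>
        obtain ⟨i, j, h, a, ⟨hi, rfl⟩, rfl⟩ := hy
        rcases Finset.mem_insert.mp hi with rfl | hi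
        · exact ⟨1, one_mem _, a, by simp⟩
        · exact ⟨x h a, x_mem_rootGroup ⟨hi, rfl⟩ _ _, 0, by simp⟩
      | one => exact ⟨1, one_mem _, 0, by simp⟩
      | mul y z _ _ hy hz =>
        obtain ⟨n, hn, a, rfl⟩ := hy
        obtain ⟨n', hn', b, rfl⟩ := hz
        refine ⟨_, mul_mem hn (comm a n' hn'), a + b, ?_⟩
        rw [← x_mul]
        group
      | inv y _ hy =>
        obtain ⟨n, hn, a, rfl⟩ := hy
        refine ⟨_, comm (-a) _ (inv_mem hn), -a, ?_⟩
        rw [← x_inv]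
        group
    obtain ⟨z, hz, a, rfl⟩ := dec
    have ha : a = 0 := by
      have h1 := DFunLike.congr_fun h k
      rw [stToAut_mul_apply, rootGroup_coord (by simp [hk]) hz, stToAut_x_apply] at h1
      simpa [hkm.symm] using h1
    subst ha
    rw [x_zero, mul_one] at h ⊢
    exact ih hmF hz h

lemma upper_finite {f : ℕ → ℤ} {y : St A} (hy : y ∈ upper A f) :
    ∃ F : Finset ℕ, y ∈ rootGroup A fun i j => f i < f j ∧ i ∈ F ∧ j ∈ F := by
  have mono : ∀ {F G : Finset ℕ}, F ⊆ G → (rootGroup A fun i j => f i < f j ∧ i ∈ F ∧ j ∈ F) ≤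
      rootGroup A fun i j => f i < f j ∧ i ∈ G ∧ j ∈ G := fun hFG =>
    rootGroup_le fun i j h a hP => x_mem_rootGroup ⟨hP.1, hFG hP.2.1, hFG hP.2.2⟩ h a
  induction hy using Subgroup.closure_induction with
  | mem y hy =>
    obtain ⟨i, j, h, a, hP, rfl⟩ := hy
    exact ⟨{i, j}, x_mem_rootGroup ⟨hP, by simp, by simp⟩ h a⟩
  | one => exact ⟨∅, one_mem _⟩
  | mul y z _ _ hy hz =>
    obtain ⟨F, hF⟩ := hy
    obtain ⟨G, hG⟩ := hz
    exact ⟨F ∪ G, mul_mem (mono Finset.subset_union_left hF) (mono Finset.subset_union_right hG)⟩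
  | inv y _ hy => exact ⟨hy.choose, inv_mem hy.choose_spec⟩

/-- The unipotent subgroups of the Steinberg group map injectively to matrices. -/
lemma eq_one_of_mem_upper {f : ℕ → ℤ} {y : St A} (hy : y ∈ upper A f)
    (h : stToAut A y = 1) : y = 1 := by
  obtain ⟨F, hF⟩ := upper_finite hy
  clear hy
  induction F using Finset.induction_on_max_value f generalizing y with
  | empty =>
    have : rootGroup A (fun i j => f i < f j ∧ i ∈ (∅ : Finset ℕ) ∧ j ∈ (∅ : Finset ℕ)) ≤ ⊥ :=
      rootGroup_le fun i j _ _ hP => by simp at hP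
    exact Subgroup.mem_bot.mp (this hF)
  | insert m F hm hmax ih =>
    -- As `f` is maximal at `m`, the index `m` occurs only as a column. Root elements with indices
    -- in `F` normalise the column group, which therefore splits off on the right.
    have dec : ∃ z ∈ rootGroup A (fun i j => f i < f j ∧ i ∈ F ∧ j ∈ F),
        ∃ c ∈ rootGroup A (fun i j => i ∈ F ∧ j = m), y = z * c := by
      clear h
      have norm : ∀ (i j : ℕ) (h : i ≠ j) (a : A), i ∈ F → j ∈ F →
          ∀ c ∈ rootGroup A (fun i j => i ∈ F ∧ j = m),
          x h a * c * (x h a)⁻¹ ∈ rootGroup A (fun i j => i ∈ F ∧ j = m) := by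
        intro i j h a hi hj c hc
        refine rootGroup_conj (fun k l hkl b hP => ?_) hc
        obtain ⟨hk, rfl⟩ := hP
        have hil : i ≠ l := by rintro rfl; exact hm hi
        rcases eq_or_ne j k with rfl | hjk
        · rw [conj_x_left h hkl hil]
          exact mul_mem (x_mem_rootGroup ⟨hi, rfl⟩ _ _) (x_mem_rootGroup ⟨hk, rfl⟩ _ _)
        · rw [conj_x_of_commute h hkl hjk hil]
          exact x_mem_rootGroup ⟨hk, rfl⟩ _ _
      have step : ∀ (i j : ℕ) (h : i ≠ j) (a : A), f i < f j → i ∈ insert m F →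
          j ∈ insert m F → ∀ z ∈ rootGroup A (fun i j => f i < f j ∧ i ∈ F ∧ j ∈ F),
          ∀ c ∈ rootGroup A (fun i j => i ∈ F ∧ j = m),
          ∃ z' ∈ rootGroup A (fun i j => f i < f j ∧ i ∈ F ∧ j ∈ F),
          ∃ c' ∈ rootGroup A (fun i j => i ∈ F ∧ j = m), z * c * x h a = z' * c' := by
        intro i j h a hij hi hj z hz c hc
        have hi' : i ∈ F := by
          rcases Finset.mem_insert.mp hi with rfl | hi
          · have := hmax j ((Finset.mem_insert.mp hj).resolve_left h.symm)
            omega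
          · exact hi
        rcases Finset.mem_insert.mp hj with rfl | hj
        · exact ⟨z, hz, _, mul_mem hc (x_mem_rootGroup ⟨hi', rfl⟩ h a), by group⟩
        · refine ⟨_, mul_mem hz (x_mem_rootGroup ⟨hij, hi', hj⟩ h a), _,
            norm i j h (-a) hi' hj c hc, ?_⟩
          rw [← x_inv]
          group
      induction hF using Subgroup.closure_induction_right with
      | one => exact ⟨1, one_mem _, 1, one_mem _, by simp⟩
      | mul_right y t _ ht ih =>
        obtain ⟨i, j, h, a, ⟨hij, hi, hj⟩, rfl⟩ := ht
        obtain ⟨z, hz, c, hc, rfl⟩ := ih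
        exact step i j h a hij hi hj z hz c hc
      | mul_inv_cancel y t _ ht ih =>
        obtain ⟨i, j, h, a, ⟨hij, hi, hj⟩, rfl⟩ := ht
        obtain ⟨z, hz, c, hc, rfl⟩ := ih
        rw [x_inv]
        exact step i j h (-a) hij hi hj z hz c hc
    obtain ⟨z, hz, c, hc, rfl⟩ := dec
    have hc1 : c = 1 := by
      refine column_eq_one m F hm hc ?_
      have h1 : stToAut A c = stToAut A z⁻¹ := by
        rw [map_inv, eq_inv_iff_mul_eq_one, ← map_mul]
        rw [map_mul] at h ⊢
        exact mul_eq_one_comm.mp h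
      rw [h1]
      refine rootGroup_fix (fun i j hP => ?_) (inv_mem hz)
      rw [Finsupp.single_apply, if_neg]
      rintro rfl
      exact hm hP.2.2
    subst hc1
    rw [mul_one] at h ⊢
    exact ih h hz

lemma upper_apply {f : ℕ → ℤ} {y : St A} (hy : y ∈ upper A f) (v : ℕ →₀ A) (i : ℕ)
    (hv : ∀ j, f i < f j → v j = 0) : (stToAut A y).val v i = v i := by
  induction hy using Subgroup.closure_induction_right generalizing v i with
  | one => simp
  | mul_right y z _ hz ih =>
    obtain ⟨k, l, h, a, hkl, rfl⟩ := hz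
    have key : ∀ j, f i ≤ f j → (stToAut A (x h a)).val v j = v j := by
      intro j hj
      rw [stToAut_x_apply, Finsupp.add_apply, Finsupp.single_apply]
      split_ifs with e
      · subst e; rw [hv l (by omega)]; simp
      · simp
    rw [stToAut_mul_apply, ih, key i le_rfl]
    intro j hj
    rw [key j hj.le, hv j hj]
  | mul_inv_cancel y z _ hz ih =>
    obtain ⟨k, l, h, a, hkl, rfl⟩ := hz
    have key : ∀ j, f i ≤ f j → (stToAut A (x h (-a))).val v j = v j := by
      intro j hj
      rw [stToAut_x_apply, Finsupp.add_apply, Finsupp.single_apply]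
      split_ifs with e
      · subst e; rw [hv l (by omega)]; simp
      · simp
    rw [x_inv, stToAut_mul_apply, ih, key i le_rfl]
    intro j hj
    rw [key j hj.le, hv j hj]

/-- `K₂` of a local ring in which `2` is invertible is generated by Steinberg symbols. -/
theorem K2_le_symbolSubgroup [IsLocalRing A] (two : IsUnit (2 : A)) :
    K2 A ≤ symbolSubgroup A := by
  intro y hy
  rw [MonoidHom.mem_ker] at hy
  obtain ⟨g, hg, u, hu, v, hv, u', hu', rfl⟩ := hasGauss two y
  obtain ⟨d, hd⟩ := exists_isDiagonal hg
  -- The image of `v` is lower unitriangular and equals the upper triangular image of `u⁻¹ g⁻¹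
  -- u'⁻¹`, so it is the identity.
  have hv1 : stToAut A v = 1 := by
    have e : stToAut A v = stToAut A (u⁻¹ * (g⁻¹ * u'⁻¹)) := by
      have : v = u⁻¹ * (g⁻¹ * (g * u * v * u') * u'⁻¹) := by group
      conv_lhs => rw [this]
      simp only [map_mul] at hy ⊢
      rw [hy, mul_one]
    apply Units.ext
    refine Finsupp.lhom_ext fun j a => ?_
    ext i
    rw [Units.val_one, Module.End.one_apply]
    rcases le_or_gt i j with hij | hij
    · refine upper_apply hv _ i fun k hk => ?_
      rw [Finsupp.single_apply, if_neg]
      simp at hk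
      omega
    · have h2 : ∀ k, i ≤ k →
          (stToAut A (g⁻¹ * u'⁻¹)).val (Finsupp.single j a) k = 0 := by
        intro k hk
        rw [stToAut_mul_apply, hd.inv.2, upper_apply (inv_mem hu'), Finsupp.single_apply,
          if_neg (by omega), mul_zero]
        intro l hl
        simp only [Nat.cast_lt] at hl
        rw [Finsupp.single_apply, if_neg (by omega)]
      rw [e, stToAut_mul_apply, upper_apply (inv_mem hu), h2 i le_rfl, Finsupp.single_apply,
        if_neg (by omega)]
      intro l hl
      simp only [Nat.cast_lt] at hl
      exact h2 l hl.le
  obtain rfl := eq_one_of_mem_upper hv hv1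
  have huu := mul_mem hu hu'
  have hy' : stToAut A (g * (u * u')) = 1 := by rwa [mul_one, mul_assoc] at hy
  -- Once `v = 1`, the diagonal of the image of `g u u'` is `d`.
  have hd1 : d = 1 := by
    funext k
    have h3 : (stToAut A (g * (u * u'))).val (Finsupp.single k 1) k = 1 := by
      rw [hy']
      simp
    rw [stToAut_mul_apply, hd.2, upper_apply huu] at h3
    · apply Units.ext
      simpa using h3
    · intro l hl
      simp only [Nat.cast_lt] at hl
      rw [Finsupp.single_apply, if_neg (by omega)]
  subst hd1
  have hg1 : stToAut A g = 1 := by rw [hd.stToAut_eq IsDiagonal.one, map_one]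
  rw [map_mul, hg1, one_mul] at hy'
  have := eq_one_of_mem_upper huu hy'
  rw [mul_one, mul_assoc, this, mul_one]
  exact mem_symbolSubgroup_of_mem_torusLift hg hg1

end Faithful

/-! ### Elementary generation of `SL` over a local ring -/

section SpecialLinear

variable {A : Type*} [CommRing A]

lemma extFin_apply {n : ℕ} (y : Fin n → A) (k : ℕ) :
    extFin A n y k = if h : k < n then y ⟨k, h⟩ else 0 := by
  simp only [extFin, LinearMap.sum_apply, LinearMap.comp_apply, LinearMap.proj_apply,
    Finsupp.lsingle_apply, Finsupp.finsetSum_apply, Finsupp.single_apply]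
  split_ifs with h
  · rw [Finset.sum_eq_single ⟨k, h⟩]
    · simp
    · intro b _ hb
      rw [if_neg]
      rintro rfl
      exact hb rfl
    · simp
  · refine Finset.sum_eq_zero fun i _ => ?_
    rw [if_neg]
    rintro rfl
    exact h i.2

lemma stab_apply {n : ℕ} (B : Matrix (Fin n) (Fin n) A) (v : ℕ →₀ A) (k : ℕ) :
    stab A n B v k = if h : k < n then B.mulVec (fun i : Fin n => v i) ⟨k, h⟩ else v k := by
  simp only [stab, MonoidHom.coe_mk, OneHom.coe_mk, LinearMap.add_apply, Module.End.one_apply,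
    LinearMap.comp_apply, Finsupp.add_apply, extFin_apply, Matrix.mulVecLin_apply]
  split_ifs with h
  · rw [Matrix.sub_mulVec, Matrix.one_mulVec, Pi.sub_apply]
    simp [resFin]
    rfl
  · simp

lemma stab_transvection {n : ℕ} (i j : Fin n) (a : A) :
    stab A n (Matrix.transvection i j a) = elemEnd (i : ℕ) (j : ℕ) a := by
  apply LinearMap.ext
  intro v
  ext k
  rw [stab_apply, elemEnd_apply, Finsupp.add_apply, Finsupp.single_apply]
  split_ifs with h h' h'
  · obtain rfl : i = ⟨k, h⟩ := Fin.ext h'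
    simp [Matrix.transvection, Matrix.add_mulVec, Matrix.single_mulVec]
  · have : (⟨k, h⟩ : Fin n) ≠ i := fun e => h' (by rw [← e])
    simp [Matrix.transvection, Matrix.add_mulVec, Matrix.single_mulVec, this]
  · exact absurd (h' ▸ i.2) h
  · simp

variable (A) in
lemma range_stToAut_le : (stToAut A).range ≤ SLInf A := by
  rintro _ ⟨y, rfl⟩
  induction y using St.induction with
  | one => rw [map_one]; exact one_mem _
  | mul s t hs ht => rw [map_mul]; exact mul_mem hs ht
  | x i j h a =>
    refine (le_iSup (fun n : ℕ => ((Units.map (stab A n)).comp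
      (Matrix.SpecialLinearGroup.toGL (n := Fin n) (R := A))).range) (i + j + 1)) ?_
    have hij : (⟨i, by omega⟩ : Fin (i + j + 1)) ≠ ⟨j, by omega⟩ := by simpa using h
    refine ⟨⟨Matrix.transvection ⟨i, by omega⟩ ⟨j, by omega⟩ a,
      Matrix.det_transvection_of_ne _ _ hij a⟩, ?_⟩
    rw [stToAut_x]
    apply Units.ext
    exact stab_transvection _ _ a

/-- The stabilisation of the matrix `B` lifts to the Steinberg group. -/
def IsElementary {n : ℕ} (B : Matrix (Fin n) (Fin n) A) : Prop :=
  ∃ y : St A, (stToAut A y).val = stab A n B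

lemma IsElementary.one {n : ℕ} : IsElementary (1 : Matrix (Fin n) (Fin n) A) :=
  ⟨1, by simp⟩

lemma IsElementary.mul {n : ℕ} {B C : Matrix (Fin n) (Fin n) A} (hB : IsElementary B)
    (hC : IsElementary C) : IsElementary (B * C) := by
  obtain ⟨y, hy⟩ := hB
  obtain ⟨z, hz⟩ := hC
  exact ⟨y * z, by rw [map_mul, map_mul, Units.val_mul, hy, hz]⟩

lemma isElementary_transvection {n : ℕ} {i j : Fin n} (h : i ≠ j) (a : A) :
    IsElementary (Matrix.transvection i j a) := by
  refine ⟨x (Fin.val_injective.ne h) a, ?_⟩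
  rw [stToAut_x, stab_transvection]
  rfl

lemma IsElementary.of_transvection_mul {n : ℕ} {i j : Fin n} (h : i ≠ j) (a : A)
    {B : Matrix (Fin n) (Fin n) A} (hB : IsElementary (Matrix.transvection i j a * B)) :
    IsElementary B := by
  have := (isElementary_transvection h (-a)).mul hB
  rwa [← mul_assoc, Matrix.transvection_mul_transvection_same _ _ h, neg_add_cancel,
    Matrix.transvection_zero, one_mul] at this

/-- A matrix in block form, as a matrix indexed by `Fin (n + 1)`. -/
def joinBlocks {n : ℕ} (M : Matrix (Fin n ⊕ Fin 1) (Fin n ⊕ Fin 1) A) :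
    Matrix (Fin (n + 1)) (Fin (n + 1)) A :=
  M.submatrix finSumFinEquiv.symm finSumFinEquiv.symm

lemma joinBlocks_mul {n : ℕ} (M N : Matrix (Fin n ⊕ Fin 1) (Fin n ⊕ Fin 1) A) :
    joinBlocks (M * N) = joinBlocks M * joinBlocks N :=
  (Matrix.submatrix_mul_equiv M N _ _ _).symm

lemma joinBlocks_transvection {n : ℕ} (i j : Fin n ⊕ Fin 1) (a : A) :
    joinBlocks (Matrix.transvection i j a) =
      Matrix.transvection (finSumFinEquiv i) (finSumFinEquiv j) a := by
  ext p q
  simp [joinBlocks, Matrix.transvection, Matrix.single_apply, Matrix.one_apply,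
    Equiv.eq_symm_apply]

/-- The block matrix turns sums of `X` into products, so an `X` with a single nonzero entry
suffices, and this one gives a transvection. -/
lemma isElementary_upper {n : ℕ} (X : Matrix (Fin n) (Fin 1) A) :
    IsElementary (joinBlocks (Matrix.fromBlocks 1 X 0 1)) := by
  induction X using Matrix.induction_on' with
  | h_zero =>
    rw [Matrix.fromBlocks_one]
    simpa [joinBlocks] using IsElementary.one
  | h_add X Y hX hY =>
    have := hX.mul hY
    rw [← joinBlocks_mul, Matrix.fromBlocks_multiply] at this
    simpa [add_comm] using this
  | h_std_basis i j a =>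
    have : Matrix.fromBlocks 1 (Matrix.single i j a) 0 1 =
        Matrix.transvection (Sum.inl i : Fin n ⊕ Fin 1) (Sum.inr j) a := by
      rw [Matrix.transvection, ← Matrix.fromBlocks_one]
      ext (p | p) (q | q) <;> simp [Matrix.single_apply, Matrix.one_apply]
    rw [this, joinBlocks_transvection]
    exact isElementary_transvection (finSumFinEquiv.injective.ne Sum.inl_ne_inr) a

lemma isElementary_lower {n : ℕ} (X : Matrix (Fin 1) (Fin n) A) :
    IsElementary (joinBlocks (Matrix.fromBlocks 1 0 X 1)) := by
  induction X using Matrix.induction_on' with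
  | h_zero =>
    rw [Matrix.fromBlocks_one]
    simpa [joinBlocks] using IsElementary.one
  | h_add X Y hX hY =>
    have := hX.mul hY
    rw [← joinBlocks_mul, Matrix.fromBlocks_multiply] at this
    simpa [add_comm] using this
  | h_std_basis i j a =>
    have : Matrix.fromBlocks 1 0 (Matrix.single i j a) 1 =
        Matrix.transvection (Sum.inr i : Fin n ⊕ Fin 1) (Sum.inl j) a := by
      rw [Matrix.transvection, ← Matrix.fromBlocks_one]
      ext (p | p) (q | q) <;> simp [Matrix.single_apply, Matrix.one_apply]
    rw [this, joinBlocks_transvection]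
    exact isElementary_transvection (finSumFinEquiv.injective.ne Sum.inr_ne_inl) a

lemma stab_joinBlocks {n : ℕ} (B : Matrix (Fin n) (Fin n) A) :
    stab A (n + 1) (joinBlocks (Matrix.fromBlocks B 0 0 1)) = stab A n B := by
  apply LinearMap.ext
  intro v
  ext k
  rw [stab_apply, stab_apply]
  rcases lt_trichotomy k n with h | rfl | h
  · rw [dif_pos h, dif_pos (by omega)]
    have : finSumFinEquiv.symm (⟨k, by omega⟩ : Fin (n + 1)) = Sum.inl ⟨k, h⟩ :=
      finSumFinEquiv_symm_apply_castAdd ⟨k, h⟩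
    simp [Matrix.mulVec, dotProduct, Fin.sum_univ_castSucc, joinBlocks, this]
  · rw [dif_neg (lt_irrefl k), dif_pos (by omega)]
    have : (⟨k, by omega⟩ : Fin (k + 1)) = Fin.last k := rfl
    rw [this]
    simp [Matrix.mulVec, dotProduct, Fin.sum_univ_castSucc, joinBlocks]
  · rw [dif_neg (by omega), dif_neg (by omega)]

/-- The Schur complement at the corner entry `1` factors `B` into an upper unipotent, `diag(B', 1)`
with `det B' = 1`, and a lower unipotent matrix. -/
lemma isElementary_of_corner {n : ℕ}
    (ih : ∀ B : Matrix (Fin n) (Fin n) A, B.det = 1 → IsElementary B)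
    {B : Matrix (Fin (n + 1)) (Fin (n + 1)) A} (hB : B.det = 1)
    (h : B (Fin.last n) (Fin.last n) = 1) : IsElementary B := by
  set M : Matrix (Fin n ⊕ Fin 1) (Fin n ⊕ Fin 1) A :=
    B.submatrix finSumFinEquiv finSumFinEquiv with hM
  have hBM : B = joinBlocks M := by ext; simp [joinBlocks, hM]
  have hdet : M.det = 1 := by rw [hM, Matrix.det_submatrix_equiv_self, hB]
  have h22 : M.toBlocks₂₂ = 1 := by
    ext i j
    fin_cases i; fin_cases j
    exact h
  have hM' : M = Matrix.fromBlocks M.toBlocks₁₁ M.toBlocks₁₂ M.toBlocks₂₁ 1 := by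
    rw [← h22, Matrix.fromBlocks_toBlocks]
  let _ : Invertible (1 : Matrix (Fin 1) (Fin 1) A) := invertibleOne
  rw [hBM, hM', Matrix.fromBlocks_eq_of_invertible₂₂, joinBlocks_mul, joinBlocks_mul]
  rw [hM', Matrix.det_fromBlocks₂₂, Matrix.det_one, one_mul] at hdet
  obtain ⟨y, hy⟩ := ih _ hdet
  exact ((isElementary_upper _).mul ⟨y, by rw [stab_joinBlocks, hy]⟩).mul (isElementary_lower _)

lemma isElementary_of_det [IsLocalRing A] {n : ℕ} (B : Matrix (Fin n) (Fin n) A)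
    (hB : B.det = 1) : IsElementary B := by
  induction n with
  | zero =>
    rw [Subsingleton.elim B 1]
    exact IsElementary.one
  | succ n ih =>
    have key : ∀ (B : Matrix (Fin (n + 1)) (Fin (n + 1)) A), B.det = 1 → ∀ i ≠ Fin.last n,
        IsUnit (B i (Fin.last n)) → IsElementary B := by
      intro B hB i hi hu
      obtain ⟨u, hu⟩ := hu
      refine IsElementary.of_transvection_mul hi.symm
        ((1 - B (Fin.last n) (Fin.last n)) * ↑u⁻¹) (isElementary_of_corner ih ?_ ?_)
      · rw [Matrix.det_mul, Matrix.det_transvection_of_ne _ _ hi.symm, one_mul, hB]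
      · rw [Matrix.transvection_mul_apply_same, ← hu, Units.inv_mul_cancel_right]
        ring
    by_cases hex : ∃ i ≠ Fin.last n, IsUnit (B i (Fin.last n))
    · obtain ⟨i, hi, hu⟩ := hex
      exact key B hB i hi hu
    push Not at hex
    -- A last column inside the maximal ideal would force the entry `1` of `adjugate B * B = 1` into
    -- it.
    have hll : IsUnit (B (Fin.last n) (Fin.last n)) := by
      by_contra hl
      have h1 : ∀ i, B i (Fin.last n) ∈ IsLocalRing.maximalIdeal A := by
        intro i
        rw [IsLocalRing.mem_maximalIdeal]
        rcases eq_or_ne i (Fin.last n) with rfl | hi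
        · exact hl
        · exact hex i hi
      have h2 : (B.adjugate * B) (Fin.last n) (Fin.last n) ∈ IsLocalRing.maximalIdeal A := by
        rw [Matrix.mul_apply]
        exact sum_mem fun i _ => Ideal.mul_mem_left _ _ (h1 i)
      rw [Matrix.adjugate_mul, hB, one_smul, Matrix.one_apply_eq, IsLocalRing.mem_maximalIdeal] at h2
      exact h2 isUnit_one
    rcases Nat.eq_zero_or_pos n with rfl | hn
    · have : B = 1 := by
        ext i j
        fin_cases i; fin_cases j
        simpa using hB
      rw [this]
      exact IsElementary.one
    · have h0 : (⟨0, by omega⟩ : Fin (n + 1)) ≠ Fin.last n := by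
        intro e
        have := congrArg Fin.val e
        simp at this
        omega
      -- Adding the last row to row `0` creates a unit in the last column off the corner, the case
      -- settled by `key`.
      refine IsElementary.of_transvection_mul h0 1 (key _ ?_ _ h0 ?_)
      · rw [Matrix.det_mul, Matrix.det_transvection_of_ne _ _ h0, one_mul, hB]
      · rw [Matrix.transvection_mul_apply_same, one_mul]
        by_contra hnu
        refine IsLocalRing.nonunits_add (b := -B ⟨0, by omega⟩ (Fin.last n)) hnu ?_ ?_
        · exact fun e => hex _ h0 ((IsUnit.neg_iff _).mp e)
        · simpa using hll

variable (A) in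
/-- `SL(A)` is generated by elementary matrices if `A` is local. -/
theorem range_stToAut [IsLocalRing A] : (stToAut A).range = SLInf A := by
  refine le_antisymm (range_stToAut_le A) (iSup_le fun n => ?_)
  rintro _ ⟨B, rfl⟩
  obtain ⟨y, hy⟩ := isElementary_of_det (B : Matrix (Fin n) (Fin n) A) B.2
  exact ⟨y, Units.ext hy⟩

end SpecialLinear

/-! ### Automorphisms given by finite matrices, and their corners -/

section FiniteAutomorphisms

variable (A : Type*) [CommRing A]

/-- Automorphisms of the form `diag(B, 1, 1, …)` with `B` of size `N × N`. -/
def fixing (N : ℕ) : Subgroup (AutInf A) where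
  carrier := {g | (∀ j ≥ N, g.val (Finsupp.single j 1) = Finsupp.single j 1) ∧
    ∀ v, ∀ i ≥ N, g.val v i = v i}
  one_mem' := by simp
  mul_mem' := by
    rintro g h ⟨hg, hg'⟩ ⟨hh, hh'⟩
    refine ⟨fun j hj => ?_, fun v i hi => ?_⟩
    · rw [Units.val_mul, Module.End.mul_apply, hh j hj, hg j hj]
    · rw [Units.val_mul, Module.End.mul_apply, hg' _ i hi, hh' _ i hi]
  inv_mem' := by
    rintro g ⟨hg, hg'⟩
    have h1 : ∀ v, g⁻¹.val (g.val v) = v := fun v => by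
      rw [← Module.End.mul_apply, Units.inv_mul, Module.End.one_apply]
    have h2 : ∀ v, g.val (g⁻¹.val v) = v := fun v => by
      rw [← Module.End.mul_apply, Units.mul_inv, Module.End.one_apply]
    refine ⟨fun j hj => ?_, fun v i hi => ?_⟩
    · conv_lhs => rw [← hg j hj, h1]
    · conv_rhs => rw [← h2 v, hg' _ i hi]

lemma fixing_mono {N M : ℕ} (h : N ≤ M) : fixing A N ≤ fixing A M := fun _ hg =>
  ⟨fun j hj => hg.1 j (h.trans hj), fun v i hi => hg.2 v i (h.trans hi)⟩

/-- The automorphisms differing from the identity by a finite matrix. -/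
def finAut : Subgroup (AutInf A) where
  carrier := {g | ∃ N, g ∈ fixing A N}
  one_mem' := ⟨0, one_mem _⟩
  mul_mem' := by
    rintro g h ⟨N, hg⟩ ⟨M, hh⟩
    exact ⟨max N M, mul_mem (fixing_mono A (le_max_left _ _) hg)
      (fixing_mono A (le_max_right _ _) hh)⟩
  inv_mem' := by
    rintro g ⟨N, hg⟩
    exact ⟨N, inv_mem hg⟩

variable {A}

lemma elem_mem_fixing {i j N : ℕ} (h : i ≠ j) (hi : i < N) (hj : j < N) (a : A) :
    elem h a ∈ fixing A N := by
  refine ⟨fun k hk => ?_, fun v k hk => ?_⟩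
  · have : k ≠ j := by omega
    simp [elem, elemEnd_apply, this]
  · have : i ≠ k := by omega
    simp [elem, elemEnd_apply, this]

variable (A) in
lemma range_stToAut_le_finAut : (stToAut A).range ≤ finAut A := by
  rintro _ ⟨y, rfl⟩
  induction y using St.induction with
  | one => rw [map_one]; exact one_mem _
  | mul s t hs ht => rw [map_mul]; exact mul_mem hs ht
  | x i j h a =>
    rw [stToAut_x]
    exact ⟨i + j + 1, elem_mem_fixing h (by omega) (by omega) a⟩

lemma stToAut_mem_finAut (y : St A) : stToAut A y ∈ finAut A :=
  range_stToAut_le_finAut A ⟨y, rfl⟩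

lemma entry_one (i j : ℕ) : entry (1 : AutInf A) i j = if i = j then 1 else 0 := by
  simp [entry, Finsupp.single_apply, eq_comm]

lemma entry_of_le_right {N i j : ℕ} {g : AutInf A} (hg : g ∈ fixing A N) (hj : N ≤ j) :
    entry g i j = if i = j then 1 else 0 := by
  rw [entry, hg.1 j hj, Finsupp.single_apply]
  simp only [eq_comm]

lemma entry_of_le_left {N i j : ℕ} {g : AutInf A} (hg : g ∈ fixing A N) (hi : N ≤ i) :
    entry g i j = if i = j then 1 else 0 := by
  rw [entry, hg.2 _ i hi, Finsupp.single_apply]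
  simp only [eq_comm]

lemma entry_elem {i j : ℕ} (h : i ≠ j) (a : A) (p q : ℕ) :
    entry (elem h a) p q = (if p = q then 1 else 0) + if i = p ∧ j = q then a else 0 := by
  simp only [entry, elem, elemEnd_apply, Finsupp.add_apply, Finsupp.single_apply]
  by_cases hp : i = p <;> by_cases hq : j = q <;> simp [hp, hq, eq_comm]

lemma elem_inv {i j : ℕ} (h : i ≠ j) (a : A) : (elem h a)⁻¹ = elem h (-a) := by
  rw [← stToAut_x, ← map_inv, x_inv, stToAut_x]

lemma apply_eq_sum {N : ℕ} (g : AutInf A) (v : ℕ →₀ A) (hv : ∀ i ≥ N, v i = 0) (i : ℕ) :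
    g.val v i = ∑ k ∈ Finset.range N, entry g i k * v k := by
  have e : v = ∑ k ∈ Finset.range N, v k • Finsupp.single k 1 := by
    ext i
    simp only [Finsupp.finsetSum_apply, Finsupp.smul_apply, Finsupp.single_apply, smul_eq_mul,
      mul_ite, mul_one, mul_zero, Finset.sum_ite_eq', Finset.mem_range]
    split_ifs with h
    · rfl
    · exact hv i (not_lt.mp h)
  conv_lhs => rw [e]
  rw [map_sum, Finsupp.finsetSum_apply]
  refine Finset.sum_congr rfl fun k _ => ?_
  rw [map_smul, Finsupp.smul_apply, smul_eq_mul, mul_comm]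
  rfl

lemma entry_mul {N : ℕ} (g : AutInf A) {h : AutInf A} (hh : h ∈ fixing A N) (i : ℕ) {j : ℕ}
    (hj : j < N) :
    entry (g * h) i j = ∑ k ∈ Finset.range N, entry g i k * entry h k j := by
  refine apply_eq_sum g _ (fun k hk => ?_) i
  rw [hh.2 _ k hk, Finsupp.single_apply, if_neg (by omega)]

/-- The upper left `N × N` corner. -/
def corner (N : ℕ) (g : AutInf A) : Matrix (Fin N) (Fin N) A := fun i j => entry g i j

lemma corner_one (N : ℕ) : corner N (1 : AutInf A) = 1 := by
  ext i j
  simp [corner, entry_one, Matrix.one_apply, Fin.ext_iff]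

lemma corner_mul {N : ℕ} (g : AutInf A) {h : AutInf A} (hh : h ∈ fixing A N) :
    corner N (g * h) = corner N g * corner N h := by
  ext i j
  rw [Matrix.mul_apply]
  exact (entry_mul g hh i j.2).trans
    (Finset.sum_range fun k => entry g i k * entry h k j)

lemma corner_inv_mul {N : ℕ} {g : AutInf A} (hg : g ∈ fixing A N) :
    corner N g⁻¹ * corner N g = 1 := by
  rw [← corner_mul _ hg, inv_mul_cancel, corner_one]

lemma corner_mul_inv {N : ℕ} {g : AutInf A} (hg : g ∈ fixing A N) :
    corner N g * corner N g⁻¹ = 1 := by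
  rw [← corner_mul _ (inv_mem hg), mul_inv_cancel, corner_one]

lemma corner_elem {N i j : ℕ} (h : i ≠ j) (hi : i < N) (hj : j < N) (a : A) :
    corner N (elem h a) = Matrix.transvection ⟨i, hi⟩ ⟨j, hj⟩ a := by
  ext p q
  simp [corner, entry_elem, Matrix.transvection, Matrix.one_apply, Matrix.single_apply,
    Fin.ext_iff]

end FiniteAutomorphisms

/-! ### The trace cocycle and its central extension -/

section Cocycle

/-- A ring `Λ` with a central homomorphism and a derivation from a commutative ring `A`. -/
structure CentralDerivation (A Λ : Type*) [CommRing A] [Ring Λ] where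
  /-- the structure map -/
  ι : A →+* Λ
  /-- the derivation -/
  d : A →+ Λ
  ι_comm : ∀ a z, ι a * z = z * ι a
  d_mul : ∀ a b, d (a * b) = d a * ι b + ι a * d b

namespace CentralDerivation

variable {A Λ : Type*} [CommRing A] [Ring Λ] (D : CentralDerivation A Λ)

@[simp]
lemma d_one : D.d 1 = 0 := by
  have := D.d_mul 1 1
  simpa using this

lemma d_ite (p : Prop) [Decidable p] : D.d (if p then 1 else 0) = 0 := by
  split_ifs <;> simp

section Matrices

variable {n : Type*} [DecidableEq n]

/-- The derivation applied to the entries of a matrix. -/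
def dMat (M : Matrix n n A) : Matrix n n Λ := M.map D.d

@[simp]
lemma dMat_one : D.dMat (1 : Matrix n n A) = 0 := by
  ext i j
  simp [dMat, Matrix.one_apply, D.d_ite]

variable [Fintype n]

/-- The structure map applied to the entries of a matrix. -/
def ιMat : Matrix n n A →+* Matrix n n Λ := D.ι.mapMatrix

lemma dMat_mul (M N : Matrix n n A) :
    D.dMat (M * N) = D.dMat M * D.ιMat N + D.ιMat M * D.dMat N := by
  ext i j
  simp [dMat, ιMat, Matrix.mul_apply, D.d_mul, Finset.sum_add_distrib]

lemma trace_comm (M : Matrix n n A) (X : Matrix n n Λ) :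
    (D.ιMat M * X).trace = (X * D.ιMat M).trace := by
  simp only [Matrix.trace, Matrix.diag, Matrix.mul_apply]
  rw [Finset.sum_comm]
  simp [ιMat, D.ι_comm]

/-- The trace cochain `Tr(g⁻¹ dg dh h⁻¹)`, in terms of `g`, `h` and their inverses. -/
def traceForm (g' g h h' : Matrix n n A) : Λ :=
  (D.ιMat g' * D.dMat g * D.dMat h * D.ιMat h').trace

/-- The Leibniz rule expands `d(gh)` and `d(hk)`, and the two mixed terms in `dg` and `dk` agree by
cyclicity of the trace. As `Λ` need not be commutative, only matrices coming from `A` may be cycled.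
-/
lemma traceForm_cocycle {g g' h h' k k' : Matrix n n A} (hg : g' * g = 1) (hk : k * k' = 1) :
    D.traceForm g' g h h' + D.traceForm (h' * g') (g * h) k k' =
      D.traceForm h' h k k' + D.traceForm g' g (h * k) (k' * h') := by
  have e1 : D.ιMat g' * D.ιMat g = 1 := by rw [← map_mul, hg, map_one]
  have e2 : D.ιMat k * D.ιMat k' = 1 := by rw [← map_mul, hk, map_one]
  have t1 : D.traceForm (h' * g') (g * h) k k' =
      (D.ιMat h' * (D.ιMat g' * D.dMat g * D.ιMat h * D.dMat k * D.ιMat k')).trace +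
      (D.ιMat h' * (D.ιMat g' * D.ιMat g) * D.dMat h * D.dMat k * D.ιMat k').trace := by
    rw [traceForm, dMat_mul, map_mul, ← Matrix.trace_add]
    congr 1
    noncomm_ring
  have t2 : D.traceForm g' g (h * k) (k' * h') =
      (D.ιMat g' * D.dMat g * D.dMat h * (D.ιMat k * D.ιMat k') * D.ιMat h').trace +
      (D.ιMat g' * D.dMat g * D.ιMat h * D.dMat k * D.ιMat k' * D.ιMat h').trace := by
    rw [traceForm, dMat_mul, map_mul, ← Matrix.trace_add]
    congr 1
    noncomm_ring
  rw [t1, t2, trace_comm, e1, e2, mul_one, mul_one, traceForm, traceForm]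
  abel

end Matrices

/-- The trace cochain `Tr(g⁻¹ dg dh h⁻¹)` on automorphisms. -/
def cochain (g h : AutInf A) : Λ :=
  ∑ᶠ q : ℕ × ℕ × ℕ × ℕ, D.ι (entry g⁻¹ q.1 q.2.1) * D.d (entry g q.2.1 q.2.2.1) *
    D.d (entry h q.2.2.1 q.2.2.2) * D.ι (entry h⁻¹ q.2.2.2 q.1)

/-- Outside the corner the entries are `0` or `1`, so either `d` kills them or a factor vanishes;
every common size `N` gives the same value. -/
lemma cochain_eq {N : ℕ} {g h : AutInf A} (hg : g ∈ fixing A N) (hh : h ∈ fixing A N) :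
    D.cochain g h = D.traceForm (corner N g⁻¹) (corner N g) (corner N h) (corner N h⁻¹) := by
  rw [cochain, finsum_eq_sum_of_support_subset (s := Finset.range N ×ˢ Finset.range N ×ˢ
    Finset.range N ×ˢ Finset.range N)]
  · simp only [Finset.sum_product, Finset.sum_range]
    simp only [traceForm, Matrix.trace, Matrix.diag, Matrix.mul_apply, Finset.sum_mul]
    refine Finset.sum_congr rfl fun i _ => ?_
    rw [Finset.sum_comm, Finset.sum_congr rfl fun k _ => Finset.sum_comm, Finset.sum_comm]
    rfl
  · rintro ⟨i, j, k, l⟩ hq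
    simp only [Finset.coe_product, Set.mem_prod, Finset.coe_range, Set.mem_Iio]
    by_contra hc
    apply hq
    dsimp only
    by_cases hj : N ≤ j
    · rw [entry_of_le_left hg hj, d_ite]; simp
    by_cases hk : N ≤ k
    · rw [entry_of_le_right hg hk, d_ite]; simp
    by_cases hl : N ≤ l
    · rw [entry_of_le_right hh hl, d_ite]; simp
    · rw [entry_of_le_left (inv_mem hg) (show N ≤ i by omega), if_neg (by omega)]
      simp

lemma cochain_mem {W : AddSubgroup Λ}
    (hW : ∀ a p q b, D.ι a * D.d p * D.d q * D.ι b ∈ W) (g h : AutInf A) :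
    D.cochain g h ∈ W :=
  finsum_induction (· ∈ W) W.zero_mem (fun _ _ => W.add_mem) fun _ => hW _ _ _ _

lemma cochain_cocycle {g h k : AutInf A} (hg : g ∈ finAut A) (hh : h ∈ finAut A)
    (hk : k ∈ finAut A) :
    D.cochain g h + D.cochain (g * h) k = D.cochain h k + D.cochain g (h * k) := by
  obtain ⟨N, hg⟩ := hg
  obtain ⟨M, hh⟩ := hh
  obtain ⟨L, hk⟩ := hk
  replace hg := fixing_mono A (show N ≤ max N (max M L) by omega) hg
  replace hh := fixing_mono A (show M ≤ max N (max M L) by omega) hh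
  replace hk := fixing_mono A (show L ≤ max N (max M L) by omega) hk
  rw [D.cochain_eq hg hh, D.cochain_eq (mul_mem hg hh) hk, D.cochain_eq hh hk,
    D.cochain_eq hg (mul_mem hh hk), mul_inv_rev, mul_inv_rev, corner_mul _ hh, corner_mul _ hk,
    corner_mul _ (inv_mem hg), corner_mul _ (inv_mem hh)]
  exact D.traceForm_cocycle (corner_inv_mul hg)
    (corner_mul_inv hk)

@[simp]
lemma cochain_one_left (h : AutInf A) : D.cochain 1 h = 0 := by
  simp [cochain, entry_one, d_ite]

/-- The central extension of the group of finite automorphisms defined by the trace cocycle. -/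
@[ext]
structure Extension (D : CentralDerivation A Λ) where
  /-- the underlying automorphism -/
  aut : finAut A
  /-- the central component -/
  val : Λ

namespace Extension

instance : Mul D.Extension := ⟨fun s t => ⟨s.aut * t.aut, s.val + t.val + D.cochain s.aut t.aut⟩⟩

instance : One D.Extension := ⟨⟨1, 0⟩⟩

instance : Inv D.Extension := ⟨fun s => ⟨s.aut⁻¹, -s.val - D.cochain (s.aut⁻¹ : finAut A) s.aut⟩⟩

variable {D}

@[simp] lemma aut_mul (s t : D.Extension) : (s * t).aut = s.aut * t.aut := rfl
@[simp] lemma val_mul (s t : D.Extension) :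
    (s * t).val = s.val + t.val + D.cochain s.aut t.aut := rfl
@[simp] lemma aut_one : (1 : D.Extension).aut = 1 := rfl
@[simp] lemma val_one : (1 : D.Extension).val = 0 := rfl

instance : Group D.Extension := Group.ofLeftAxioms
  (fun s t r => Extension.ext (mul_assoc _ _ _) (by
    have := D.cochain_cocycle s.aut.2 t.aut.2 r.aut.2
    simp only [val_mul, aut_mul, Subgroup.coe_mul]
    calc _ = s.val + t.val + r.val +
          (D.cochain s.aut t.aut + D.cochain (s.aut * t.aut : AutInf A) r.aut) := by abel
      _ = _ := by rw [this]; abel))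
  (fun s => Extension.ext (one_mul _) (by simp))
  (fun s => Extension.ext (inv_mul_cancel _) (by
    change -s.val - D.cochain (s.aut⁻¹ : finAut A) s.aut + s.val +
      D.cochain (s.aut⁻¹ : finAut A) s.aut = 0
    abel))

end Extension

/-- The only nonzero entry of `d e_ij(a)` meets only row `j` of `dh`, which is zero. -/
lemma cochain_elem_of_row {i j : ℕ} (hij : i ≠ j) (a : A) {h : AutInf A}
    (hrow : ∀ q, entry h j q = if j = q then 1 else 0) : D.cochain (elem hij a) h = 0 := by
  rw [cochain]
  refine finsum_eq_zero_of_forall_eq_zero fun q => ?_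
  rw [entry_elem, map_add, d_ite, zero_add]
  split_ifs with hq
  · rw [← hq.2, hrow, d_ite]
    simp
  · simp

/-- The product `d e_ij(a) · d e_kl(b)` vanishes unless `j = k`. In that case it is supported at
`(i, l)` with `i ≠ l`, and the outer inverses do not bring it onto the diagonal. -/
lemma cochain_elem_elem {i j k l : ℕ} (hij : i ≠ j) (hkl : k ≠ l) (h : i ≠ l ∨ j ≠ k)
    (a b : A) : D.cochain (elem hij a) (elem hkl b) = 0 := by
  rw [cochain]
  refine finsum_eq_zero_of_forall_eq_zero fun q => ?_
  rw [elem_inv, elem_inv, entry_elem hij a, entry_elem hkl b, map_add, d_ite, zero_add, map_add,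
    d_ite, zero_add]
  by_cases h1 : i = q.2.1 ∧ j = q.2.2.1
  · by_cases h2 : k = q.2.2.1 ∧ l = q.2.2.2
    · have hil : i ≠ l := h.resolve_right (by rw [h1.2, h2.1]; simp)
      by_cases h3 : q.1 = i
      · rw [entry_elem hkl, ← h2.2, h3, if_neg hil.symm, if_neg (show ¬ (k = l ∧ l = i) from fun e => hkl e.1)]
        simp
      · rw [entry_elem hij, ← h1.1, if_neg h3, if_neg (show ¬ (i = q.1 ∧ j = i) from fun e => hij e.2.symm)]
        simp
    · simp [h2]
  · simp [h1]

/-- The lift of the generator `x_ij(a)` to the central extension. -/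
def genLift (p : Gen A) : D.Extension :=
  ⟨⟨elem p.1.2 p.2, stToAut_x p.1.2 p.2 ▸ stToAut_mem_finAut _⟩, 0⟩

lemma lift_genLift_gen {i j : ℕ} (h : i ≠ j) (a : A) :
    FreeGroup.lift D.genLift (gen h a) = D.genLift (⟨(i, j), h⟩, a) := by
  simp [gen]

lemma lift_genLift_rel (r : FreeGroup (Gen A)) (hr : IsSteinbergRel A r) :
    FreeGroup.lift D.genLift r = 1 := by
  have haut : ∀ {s t : D.Extension}, ((s.aut : AutInf A) = t.aut) → s.val = t.val → s = t :=
    fun h1 h2 => Extension.ext (Subtype.ext h1) h2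
  cases hr with
  | add h a b =>
    rw [map_mul, map_mul, map_inv, lift_genLift_gen, lift_genLift_gen, lift_genLift_gen,
      mul_inv_eq_one]
    refine haut ?_ ?_
    · exact Units.ext (elemEnd_mul h a b)
    · simp [genLift, D.cochain_elem_elem h h (Or.inl h)]
  | comm_mul hij hjk hik a b =>
    rename_i i j k
    rw [map_mul, map_commutatorElement, map_inv, lift_genLift_gen, lift_genLift_gen,
      lift_genLift_gen, mul_inv_eq_one, commutatorElement_def, mul_inv_eq_iff_eq_mul,
      mul_inv_eq_iff_eq_mul, mul_assoc]
    refine haut ?_ ?_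
    · have := congrArg (stToAut A) (x_commutator hij hjk hik a b)
      rw [map_commutatorElement, commutatorElement_def, mul_inv_eq_iff_eq_mul,
        mul_inv_eq_iff_eq_mul, mul_assoc] at this
      simp only [stToAut_x] at this
      exact this
    -- In the form `e_ij e_jk = e_ik (e_jk e_ij)` the relation involves no inverses, and row `k` of
    -- `e_jk e_ij` is trivial.
    · have hrow : ∀ q, entry (elem hjk b * elem hij a) k q = if k = q then 1 else 0 := by
        intro q
        rw [entry, Units.val_mul, Module.End.mul_apply]
        simp [elem, elemEnd_apply, Finsupp.single_apply, hjk, hik, eq_comm]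
      simp only [genLift, Extension.val_mul, Extension.aut_mul, Subgroup.coe_mul]
      rw [D.cochain_elem_elem hij hjk (Or.inl hik), D.cochain_elem_of_row hik _ hrow,
        D.cochain_elem_elem hjk hij (Or.inr hik.symm)]
      simp
  | comm_one hij hkl hjk hil a b =>
    rw [map_commutatorElement, lift_genLift_gen, lift_genLift_gen,
      commutatorElement_eq_one_iff_mul_comm]
    refine haut ?_ ?_
    · have := congrArg (stToAut A) (x_commute hij hkl hjk hil a b).eq
      simp only [map_mul, stToAut_x] at this
      exact this
    · simp [genLift, D.cochain_elem_elem hij hkl (Or.inl hil),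
        D.cochain_elem_elem hkl hij (Or.inl hjk.symm)]

/-- The lift of `St(A) → SL(A)` to the central extension. -/
def stHom : St A →* D.Extension :=
  PresentedGroup.toGroup (f := D.genLift) D.lift_genLift_rel

lemma stHom_x {i j : ℕ} (h : i ≠ j) (a : A) : D.stHom (x h a) = D.genLift (⟨(i, j), h⟩, a) := by
  simp [stHom, x]

lemma aut_stHom (y : St A) : ((D.stHom y).aut : AutInf A) = stToAut A y := by
  induction y using St.induction with
  | one => simp
  | mul s t hs ht => simp [hs, ht]
  | x i j h a => rw [stHom_x, stToAut_x]; rfl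

lemma val_stHom_mul (y z : St A) : (D.stHom (y * z)).val =
    (D.stHom y).val + (D.stHom z).val + D.cochain (stToAut A y) (stToAut A z) := by
  rw [map_mul, Extension.val_mul, aut_stHom, aut_stHom]

lemma val_stHom_mem {W : AddSubgroup Λ} (hW : ∀ a p q b, D.ι a * D.d p * D.d q * D.ι b ∈ W)
    (y : St A) : (D.stHom y).val ∈ W := by
  induction y using St.induction with
  | one => simp
  | mul s t hs ht =>
    rw [val_stHom_mul]
    exact W.add_mem (W.add_mem hs ht) (D.cochain_mem hW _ _)
  | x i j h a => rw [stHom_x]; exact W.zero_mem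

/-- The homomorphism `K₂(A) → Λ` defined by the trace cocycle. -/
def traceHom : Additive (K2 A) →+ Λ where
  toFun k := (D.stHom (k.toMul : St A)).val
  map_zero' := by simp
  map_add' k l := by
    rw [toMul_add, Subgroup.coe_mul, val_stHom_mul, MonoidHom.mem_ker.mp k.toMul.2]
    simp

lemma traceHom_apply (k : K2 A) : D.traceHom (Additive.ofMul k) = (D.stHom k).val := rfl

/-- With `y = h₁₂(u)` and `z = h₁₃(v)`, the identity `{u, v} · zy = yz` makes the value `cochain y z
- cochain z y`. Of the diagonal entries only the first is nontrivial in both matrices. -/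
lemma traceHom_symbol (u v : Aˣ) : D.traceHom (Additive.ofMul (symbol u v)) =
    D.ι ↑u⁻¹ * D.d u * D.d v * D.ι ↑v⁻¹ - D.ι ↑v⁻¹ * D.d v * D.d u * D.ι ↑u⁻¹ := by
  have corner_eq : ∀ {y : St A} {d : ℕ → Aˣ}, IsDiagonal y d →
      corner 3 (stToAut A y) = Matrix.diagonal fun k : Fin 3 => (d k : A) := by
    intro y d hd
    ext p q
    rw [corner, entry, hd.2]
    by_cases hpq : p = q
    · subst hpq; simp
    · rw [Matrix.diagonal_apply_ne _ hpq, Finsupp.single_apply,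
        if_neg (fun e => hpq (Fin.ext e.symm)), mul_zero]
  have mem : ∀ {i j : ℕ} (h : i ≠ j) (u : Aˣ), i < 3 → j < 3 →
      stToAut A (hElt h u) ∈ fixing A 3 := by
    intro i j h u hi hj
    simp only [hElt, w, map_mul, stToAut_x]
    refine mul_mem (mul_mem (mul_mem ?_ ?_) ?_) (mul_mem (mul_mem ?_ ?_) ?_) <;>
      exact elem_mem_fixing _ ‹_› ‹_› _
  have form : ∀ {y z : St A} {d e : ℕ → Aˣ}, IsDiagonal y d → IsDiagonal z e →
      stToAut A y ∈ fixing A 3 → stToAut A z ∈ fixing A 3 →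
      D.cochain (stToAut A y) (stToAut A z) = ∑ k : Fin 3,
        D.ι ↑(d k)⁻¹ * D.d (d k) * D.d (e k) * D.ι ↑(e k)⁻¹ := by
    intro y z d e hd he hy hz
    have hdm : ∀ t : Fin 3 → A, D.dMat (Matrix.diagonal t) = Matrix.diagonal fun k => D.d (t k) :=
      fun t => Matrix.diagonal_map (map_zero _)
    have him : ∀ t : Fin 3 → A, D.ιMat (Matrix.diagonal t) = Matrix.diagonal fun k => D.ι (t k) :=
      fun t => Matrix.diagonal_map (map_zero _)
    rw [D.cochain_eq hy hz, ← map_inv, ← map_inv, corner_eq hd, corner_eq he, corner_eq hd.inv,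
      corner_eq he.inv, traceForm, hdm, hdm, him, him, Matrix.diagonal_mul_diagonal,
      Matrix.diagonal_mul_diagonal, Matrix.diagonal_mul_diagonal, Matrix.trace_diagonal]
    rfl
  set y : St A := hElt (i := 0) (j := 1) (by decide) u with hy
  set z : St A := hElt (i := 0) (j := 2) (by decide) v with hz
  have dy : IsDiagonal y (hCoeff 0 1 u) := isDiagonal_hElt _ u
  have dz : IsDiagonal z (hCoeff 0 2 v) := isDiagonal_hElt _ v
  have my : stToAut A y ∈ fixing A 3 := mem _ u (by decide) (by decide)
  have mz : stToAut A z ∈ fixing A 3 := mem _ v (by decide) (by decide)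
  have e : (symbol u v : St A) * (z * y) = y * z := by
    rw [coe_symbol, ← hy, ← hz, commutatorElement_def]
    group
  have e1 := congrArg (fun t => (D.stHom t).val) e
  simp only [val_stHom_mul D (symbol u v : St A), MonoidHom.mem_ker.mp (symbol u v).2,
    cochain_one_left, add_zero] at e1
  rw [val_stHom_mul, val_stHom_mul, form dy dz my mz, form dz dy mz my] at e1
  simp only [Fin.sum_univ_three, hCoeff] at e1
  rw [traceHom_apply]
  simp at e1
  rw [eq_sub_iff_add_eq]
  have e2 : ∀ p q r s t : Λ, p + (q + r + s) = r + q + t → p + s = t := by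
    intro p q r s t h
    calc p + s = p + (q + r + s) - (r + q) := by abel
      _ = t := by rw [h]; abel
  exact e2 _ _ _ _ _ e1

end CentralDerivation

end Cocycle

/-! ### Homomorphisms on `K₂` tested on symbols -/

section Symbols

variable {A : Type*} [CommRing A] [IsLocalRing A]

/-- A property of the values of a homomorphism on `K₂` can be checked on symbols. -/
lemma K2_hom_mem {M : Type*} [AddCommGroup M] (two : IsUnit (2 : A)) (θ : Additive (K2 A) →+ M)
    (W : AddSubgroup M) (h : ∀ u v : Aˣ, θ (Additive.ofMul (symbol u v)) ∈ W)
    (k : Additive (K2 A)) : θ k ∈ W := by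
  obtain ⟨y, hy⟩ := k
  have key : ∀ z ∈ symbolSubgroup A, ∀ hz : z ∈ K2 A, θ (Additive.ofMul ⟨z, hz⟩) ∈ W := by
    intro z hz
    have hle : symbolSubgroup A ≤ K2 A := by
      rw [symbolSubgroup, Subgroup.closure_le]
      rintro _ ⟨p, rfl⟩
      exact (symbol p.1 p.2).2
    induction hz using Subgroup.closure_induction with
    | mem z hz =>
      obtain ⟨p, rfl⟩ := hz
      exact fun _ => h p.1 p.2
    | one =>
      intro hz
      have : θ (Additive.ofMul (⟨1, hz⟩ : K2 A)) = 0 := θ.map_zero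
      rw [this]
      exact W.zero_mem
    | mul z t hz' ht' hz ht =>
      intro hzt
      have : θ (Additive.ofMul (⟨z * t, hzt⟩ : K2 A)) =
          θ (Additive.ofMul ⟨z, hle hz'⟩) + θ (Additive.ofMul ⟨t, hle ht'⟩) :=
        θ.map_add (Additive.ofMul ⟨z, hle hz'⟩) (Additive.ofMul ⟨t, hle ht'⟩)
      rw [this]
      exact W.add_mem (hz _) (ht _)
    | inv z hz' hz =>
      intro hzi
      have : θ (Additive.ofMul (⟨z⁻¹, hzi⟩ : K2 A)) = - θ (Additive.ofMul ⟨z, hle hz'⟩) :=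
        θ.map_neg (Additive.ofMul ⟨z, hle hz'⟩)
      rw [this]
      exact W.neg_mem (hz _)
  exact key y (K2_le_symbolSubgroup two hy) hy

lemma K2_hom_ext {M : Type*} [AddCommGroup M] (two : IsUnit (2 : A))
    {θ θ' : Additive (K2 A) →+ M}
    (h : ∀ u v : Aˣ, θ (Additive.ofMul (symbol u v)) = θ' (Additive.ofMul (symbol u v))) :
    θ = θ' := by
  refine DFunLike.ext _ _ fun k => ?_
  have := K2_hom_mem two (θ - θ') ⊥ (fun u v => by simp [h]) k
  exact sub_eq_zero.mp (AddSubgroup.mem_bot.mp this)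

end Symbols

/-! ### Construction of `dlog` -/

section AbsoluteForms

variable (A : Type*) [CommRing A]

/-- The universal derivation with values in the exterior algebra of absolute differentials. -/
def absDerivation : CentralDerivation A (ExteriorAlgebra A Ω[A⁄ℤ]) where
  ι := algebraMap A _
  d := (ExteriorAlgebra.ι A).toAddMonoidHom.comp
    (KaehlerDifferential.D ℤ A).toLinearMap.toAddMonoidHom
  ι_comm := Algebra.commutes
  d_mul a b := by
    simp only [AddMonoidHom.comp_apply, LinearMap.toAddMonoidHom_coe, Derivation.coeFn_coe,
      Derivation.leibniz, map_add, map_smul, Algebra.smul_def]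
    rw [add_comm, Algebra.commutes b]

variable {A}

lemma coe_ιMulti_two {R M : Type*} [CommRing R] [AddCommGroup M] [Module R M] (v w : M) :
    (exteriorPower.ιMulti R 2 ![v, w] : ExteriorAlgebra R M) =
      ExteriorAlgebra.ι R v * ExteriorAlgebra.ι R w := by
  simp [ExteriorAlgebra.ιMulti_apply]

/-- The antisymmetrised product of `a v` and `b w`, as it appears in the values of the trace
cocycle on symbols. -/
lemma antisymm_eq_two_smul {R M : Type*} [CommRing R] [AddCommGroup M] [Module R M] (a b : R)
    (v w : M) :
    algebraMap R (ExteriorAlgebra R M) a * ExteriorAlgebra.ι R v * ExteriorAlgebra.ι R w *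
        algebraMap R _ b -
      algebraMap R _ b * ExteriorAlgebra.ι R w * ExteriorAlgebra.ι R v * algebraMap R _ a =
    (2 : R) • ((exteriorPower.ιMulti R 2 ![a • v, b • w] : ⋀[R]^2 M) : ExteriorAlgebra R M) := by
  have h := ExteriorAlgebra.ι_add_mul_swap (R := R) v w
  rw [coe_ιMulti_two, map_smul, map_smul, ← Algebra.commutes, ← Algebra.commutes]
  simp only [← Algebra.smul_def, smul_mul_assoc, mul_smul_comm]
  rw [eq_neg_of_add_eq_zero_right h, smul_neg, smul_neg, sub_neg_eq_add, smul_comm b a, ← two_smul R]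

/-- Half of the trace homomorphism. -/
lemma exists_half_hom [IsLocalRing A] {R M : Type*} [CommRing R] [Invertible (2 : R)]
    [AddCommGroup M] [Module R M] (two : IsUnit (2 : A))
    (D : CentralDerivation A (ExteriorAlgebra R M)) (ω : Aˣ → Aˣ → ⋀[R]^2 M)
    (h : ∀ u v, D.traceHom (Additive.ofMul (symbol u v)) =
      (2 : R) • (ω u v : ExteriorAlgebra R M)) :
    ∃ δ : Additive (K2 A) →+ ⋀[R]^2 M, (∀ u v, δ (Additive.ofMul (symbol u v)) = ω u v) ∧
      ∀ k, (δ k : ExteriorAlgebra R M) = ⅟(2 : R) • D.traceHom k := by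
  -- The values have degree two because they do on symbols.
  have hmem : ∀ k, D.traceHom k ∈ ⋀[R]^2 M := fun k =>
    K2_hom_mem two D.traceHom (⋀[R]^2 M).toAddSubgroup (fun u v => by
      rw [h]
      exact (⋀[R]^2 M).smul_mem _ (ω u v).2) k
  refine ⟨(DistribSMul.toAddMonoidHom (⋀[R]^2 M) (⅟(2 : R))).comp
    (D.traceHom.codRestrict (⋀[R]^2 M) hmem), fun u v => ?_, fun k => rfl⟩
  apply Subtype.ext
  change ⅟(2 : R) • D.traceHom (Additive.ofMul (symbol u v)) = _
  rw [h, smul_smul, invOf_mul_self, one_smul]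

variable (A) in
/-- Existence and uniqueness of `dlog`. -/
theorem exists_unique_isDlog [IsLocalRing A] [Invertible (2 : A)] :
    ∃ δ : Additive (K2 A) →+ AbsForms A, IsDlog δ ∧ ∀ δ', IsDlog δ' → δ' = δ := by
  have two : IsUnit (2 : A) := isUnit_of_invertible _
  obtain ⟨δ, hδ, -⟩ := exists_half_hom two (absDerivation A) dlogForm (fun u v => by
    rw [CentralDerivation.traceHom_symbol]
    exact antisymm_eq_two_smul _ _ _ _)
  exact ⟨δ, hδ, fun δ' hδ' => K2_hom_ext two fun u v => (hδ' u v).trans (hδ u v).symm⟩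

end AbsoluteForms

/-! ### The `⋀² V`-valued `dlog` of a square-zero extension -/

section RelativeForms

variable {R V : Type*} [CommRing R] [AddCommGroup V] [Module R V] [Module Rᵐᵒᵖ V]
  [IsCentralScalar R V]

instance [IsLocalRing R] : IsLocalRing (TrivSqZeroExt R V) :=
  IsLocalRing.of_is_unit_or_is_unit_of_add_one fun {a b} h => by
    rw [TrivSqZeroExt.isUnit_iff_isUnit_fst, TrivSqZeroExt.isUnit_iff_isUnit_fst]
    exact IsLocalRing.isUnit_or_isUnit_of_add_one (by rw [← TrivSqZeroExt.fst_add, h]; rfl)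

instance [Invertible (2 : R)] : Invertible (2 : TrivSqZeroExt R V) :=
  (Invertible.map (algebraMap R (TrivSqZeroExt R V)) 2).copy 2
    (map_ofNat (algebraMap R (TrivSqZeroExt R V)) 2).symm

variable (R V) in
/-- The derivation `(r, v) ↦ v` with values in the exterior algebra of `V`. -/
def sndDerivation : CentralDerivation (TrivSqZeroExt R V) (ExteriorAlgebra R V) where
  ι := (algebraMap R _).comp (TrivSqZeroExt.fstHom R R V).toRingHom
  d := (ExteriorAlgebra.ι R).toAddMonoidHom.comp (TrivSqZeroExt.sndHom R V).toAddMonoidHom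
  ι_comm a z := Algebra.commutes _ z
  d_mul a b := by
    simp only [AddMonoidHom.comp_apply, LinearMap.toAddMonoidHom_coe, TrivSqZeroExt.sndHom_apply,
      TrivSqZeroExt.snd_mul, map_add, map_smul, Algebra.smul_def, op_smul_eq_smul]
    rw [add_comm, Algebra.commutes (TrivSqZeroExt.fst b)]
    rfl

lemma sndDerivation_ι (a : TrivSqZeroExt R V) :
    (sndDerivation R V).ι a = algebraMap R _ a.fst := rfl

lemma sndDerivation_d (a : TrivSqZeroExt R V) :
    (sndDerivation R V).d a = ExteriorAlgebra.ι R a.snd := rfl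

lemma sndDerivation_mem (a p q b : TrivSqZeroExt R V) :
    (sndDerivation R V).ι a * (sndDerivation R V).d p * (sndDerivation R V).d q *
      (sndDerivation R V).ι b ∈ (⋀[R]^2 V).toAddSubgroup := by
  simp only [sndDerivation_ι, sndDerivation_d]
  rw [← Algebra.commutes, ← Algebra.smul_def, ← Algebra.smul_def, smul_mul_assoc,
    ← coe_ιMulti_two]
  exact (⋀[R]^2 V).smul_mem _ ((⋀[R]^2 V).smul_mem _ (Subtype.property _))

variable [Invertible (2 : R)]

/-- By the Leibniz rule `2 · v dv = d(v²) = 0`. -/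
lemma inr_smul_D_inr (v : V) : (TrivSqZeroExt.inr v : TrivSqZeroExt R V) •
    KaehlerDifferential.D R (TrivSqZeroExt R V) (TrivSqZeroExt.inr v) = 0 := by
  have h := (KaehlerDifferential.D R (TrivSqZeroExt R V)).leibniz (TrivSqZeroExt.inr v)
    (TrivSqZeroExt.inr v)
  rw [TrivSqZeroExt.inr_mul_inr, map_zero, ← two_smul R] at h
  have := congrArg (⅟(2 : R) • ·) h.symm
  simpa [smul_smul] using this

/-- The relative logarithmic derivative in a square-zero extension. -/
lemma inv_smul_D (u : (TrivSqZeroExt R V)ˣ) :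
    (↑u⁻¹ : TrivSqZeroExt R V) • KaehlerDifferential.D R (TrivSqZeroExt R V) u =
      (↑u⁻¹ : TrivSqZeroExt R V).fst •
        KaehlerDifferential.D R (TrivSqZeroExt R V) (TrivSqZeroExt.inr (u : TrivSqZeroExt R V).snd)
      := by
  have h1 : KaehlerDifferential.D R (TrivSqZeroExt R V) (u : TrivSqZeroExt R V) =
      KaehlerDifferential.D R (TrivSqZeroExt R V)
        (TrivSqZeroExt.inr (u : TrivSqZeroExt R V).snd) := by
    conv_lhs => rw [← TrivSqZeroExt.inl_fst_add_inr_snd_eq (u : TrivSqZeroExt R V)]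
    rw [map_add, ← TrivSqZeroExt.algebraMap_eq_inl, Derivation.map_algebraMap, zero_add]
  have hfst : (↑u⁻¹ : TrivSqZeroExt R V).fst * (u : TrivSqZeroExt R V).fst = 1 := by
    rw [← TrivSqZeroExt.fst_mul, Units.inv_mul, TrivSqZeroExt.fst_one]
  have hsnd : (↑u⁻¹ : TrivSqZeroExt R V).snd = (-(↑u⁻¹ : TrivSqZeroExt R V).fst ^ 2) •
      (u : TrivSqZeroExt R V).snd := by
    have h2 : ((u : TrivSqZeroExt R V) * ↑u⁻¹).snd = 0 := by
      rw [Units.mul_inv, TrivSqZeroExt.snd_one]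
    rw [TrivSqZeroExt.snd_mul, op_smul_eq_smul] at h2
    have h3 := congrArg ((↑u⁻¹ : TrivSqZeroExt R V).fst • ·) h2
    simp only [smul_add, smul_smul, hfst, one_smul, smul_zero] at h3
    rw [eq_neg_of_add_eq_zero_left h3, neg_smul, sq]
  -- The `V`-part of `u⁻¹` is an `R`-multiple of the `V`-part `v` of `u`, and `v dv = 0`.
  conv_lhs => rw [← TrivSqZeroExt.inl_fst_add_inr_snd_eq (↑u⁻¹ : TrivSqZeroExt R V)]
  rw [h1, add_smul, hsnd, TrivSqZeroExt.inr_smul, smul_assoc (-_ : R), inr_smul_D_inr, smul_zero,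
    add_zero, ← TrivSqZeroExt.algebraMap_eq_inl, algebraMap_smul]

/-- The `⋀² V`-valued `dlog`. -/
lemma exists_dlogV [IsLocalRing R]
    {δ : Additive (K2 (TrivSqZeroExt R V)) →+ AbsForms (TrivSqZeroExt R V)} (hδ : IsDlog δ) :
    ∃ δV : Additive (K2 (TrivSqZeroExt R V)) →+ ⋀[R]^2 V,
      (∀ k, wedgeToForms R V (δV k) = absToRel (TrivSqZeroExt R V) R (δ k)) ∧
      ∀ k, (δV k : ExteriorAlgebra R V) = ⅟(2 : R) • (sndDerivation R V).traceHom k := by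
  have two : IsUnit (2 : TrivSqZeroExt R V) := isUnit_of_invertible _
  obtain ⟨δV, hδV, h⟩ := exists_half_hom (R := R) (M := V) two (sndDerivation R V)
    (fun u v => wedge ((↑u⁻¹ : TrivSqZeroExt R V).fst • (u : TrivSqZeroExt R V).snd)
      ((↑v⁻¹ : TrivSqZeroExt R V).fst • (v : TrivSqZeroExt R V).snd))
    (fun u v => by
      rw [CentralDerivation.traceHom_symbol]
      exact antisymm_eq_two_smul _ _ _ _)
  refine ⟨δV, fun k => ?_, h⟩
  have : (wedgeToForms R V).toAddMonoidHom.comp δV =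
      (absToRel (TrivSqZeroExt R V) R).toAddMonoidHom.comp δ := by
    refine K2_hom_ext two fun u v => ?_
    simp only [AddMonoidHom.comp_apply, LinearMap.toAddMonoidHom_coe]
    rw [hδV, hδ, wedgeToForms_wedge, dlogForm, absToRel, exteriorPower.map_apply_ιMulti]
    congr 1
    ext i
    fin_cases i
    · simp [inv_smul_D, TrivSqZeroExt.inr_smul]
    · simp [inv_smul_D, TrivSqZeroExt.inr_smul]
  exact DFunLike.congr_fun this k

end RelativeForms

/-! ### Injectivity of `⋀² V → Ω²_{A/R}`; absolute and relative forms -/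

section Comparison

variable (R V : Type*) [CommRing R] [AddCommGroup V] [Module R V] [Module Rᵐᵒᵖ V]
  [IsCentralScalar R V]

/-- The projection `(r, v) ↦ v` is an `R`-derivation into `V`, viewed as a module over the extension
through `R`. The exterior square of the induced map on differentials is a left inverse. -/
lemma wedgeToForms_injective : Function.Injective (wedgeToForms R V) := by
  let _ : Module (TrivSqZeroExt R V) V :=
    Module.compHom V (TrivSqZeroExt.fstHom R R V).toRingHom
  let _ : Module (TrivSqZeroExt R V) (⋀[R]^2 V) :=
    Module.compHom _ (TrivSqZeroExt.fstHom R R V).toRingHom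
  have smul_def : ∀ (a : TrivSqZeroExt R V) (v : V), a • v = a.fst • v := fun _ _ => rfl
  have smul_def' : ∀ (a : TrivSqZeroExt R V) (v : ⋀[R]^2 V), a • v = a.fst • v := fun _ _ => rfl
  have _ : IsScalarTower R (TrivSqZeroExt R V) V := ⟨fun r a v => by
    rw [smul_def, smul_def, TrivSqZeroExt.fst_smul, smul_assoc]⟩
  have _ : IsScalarTower R (TrivSqZeroExt R V) (⋀[R]^2 V) := ⟨fun r a v => by
    rw [smul_def', smul_def', TrivSqZeroExt.fst_smul, smul_assoc]⟩
  let D : Derivation R (TrivSqZeroExt R V) V := Derivation.mk' (TrivSqZeroExt.sndHom R V)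
    fun a b => by
      simp [smul_def, TrivSqZeroExt.snd_mul]
  let W : V [⋀^Fin 2]→ₗ[TrivSqZeroExt R V] ⋀[R]^2 V :=
    { exteriorPower.ιMulti R 2 with
      map_update_smul' := fun m i a v => (exteriorPower.ιMulti R 2).map_update_smul m i a.fst v }
  let π := exteriorPower.alternatingMapLinearEquiv W ∘ₗ exteriorPower.map 2 D.liftKaehlerDifferential
  have key : (π.restrictScalars R) ∘ₗ wedgeToForms R V = LinearMap.id := by
    refine exteriorPower.linearMap_ext (AlternatingMap.ext fun m => ?_)
    have hm : m = ![m 0, m 1] := by ext i; fin_cases i <;> rfl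
    change π (wedgeToForms R V (exteriorPower.ιMulti R 2 m)) = exteriorPower.ιMulti R 2 m
    rw [hm]
    change π (wedgeToForms R V (wedge (m 0) (m 1))) = _
    rw [wedgeToForms_wedge, LinearMap.comp_apply, exteriorPower.map_apply_ιMulti,
      exteriorPower.alternatingMapLinearEquiv_apply_ιMulti]
    change exteriorPower.ιMulti R 2 _ = _
    congr 1
    ext i
    fin_cases i
    · simp [D]
    · simp [D]
  exact Function.LeftInverse.injective (g := π) fun ω => LinearMap.congr_fun key ω

/-- The kernel of `Ω[A⁄ℤ] → Ω[A⁄R]` is the image of `A ⊗ Ω[R⁄ℤ]`, which is zero. -/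
lemma absToRel_bijective (A : Type*) [CommRing A] [Algebra R A] [Subsingleton Ω[R⁄ℤ]] :
    Function.Bijective (absToRel A R) := by
  have hsurj := KaehlerDifferential.map_surjective ℤ R A
  have hinj : Function.Injective (KaehlerDifferential.map ℤ R A A) := by
    rw [injective_iff_map_eq_zero]
    intro ω hω
    obtain ⟨t, rfl⟩ := (KaehlerDifferential.exact_mapBaseChange_map ℤ R A ω).mp hω
    have : ∀ s : A ⊗[R] Ω[R⁄ℤ], s = 0 := by
      intro s
      induction s using TensorProduct.induction_on with
      | zero => rfl
      | tmul a w => rw [Subsingleton.elim w 0, TensorProduct.tmul_zero]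
      | add s t hs ht => rw [hs, ht, add_zero]
    rw [this t, map_zero]
  let e := LinearEquiv.ofBijective _ ⟨hinj, hsurj⟩
  refine ⟨exteriorPower.map_injective (e.symm : Ω[A⁄R] →ₗ[A] Ω[A⁄ℤ]) ?_,
    exteriorPower.map_surjective hsurj⟩
  exact LinearMap.ext e.symm_apply_apply

end Comparison

/-! ### Finite matrices over `V` inside the exterior algebra -/

section FiniteMatrices

variable {R V : Type*} [CommRing R] [AddCommGroup V] [Module R V]

/-- `X` vanishes outside its upper left `N × N` corner. -/
def SupportedIn (N : ℕ) (X : Matrix ℕ ℕ V) : Prop := ∀ i j, N ≤ i ∨ N ≤ j → X i j = 0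

lemma SupportedIn.mono {N M : ℕ} (h : N ≤ M) {X : Matrix ℕ ℕ V} (hX : SupportedIn N X) :
    SupportedIn M X := fun i j hij => hX i j (hij.imp h.trans h.trans)

lemma SupportedIn.add {N : ℕ} {X Y : Matrix ℕ ℕ V} (hX : SupportedIn N X)
    (hY : SupportedIn N Y) : SupportedIn N (X + Y) := fun i j hij => by
  rw [Matrix.add_apply, hX i j hij, hY i j hij, add_zero]

lemma exists_supportedIn (X : MZero R V) : ∃ N, SupportedIn N (X : Matrix ℕ ℕ V) := by
  obtain ⟨X, hX, -⟩ := X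
  obtain ⟨N, hN⟩ := (hX.image fun p => max p.1 p.2).bddAbove
  refine ⟨N + 1, fun i j hij => ?_⟩
  by_contra hne
  have : max i j ≤ N := hN ⟨(i, j), hne, rfl⟩
  omega

lemma finsum_diag {N : ℕ} {X : Matrix ℕ ℕ V} (hX : SupportedIn N X) :
    ∑ᶠ i, X i i = ∑ i : Fin N, X i i := by
  rw [finsum_eq_sum_of_support_subset (s := Finset.range N), Finset.sum_range]
  intro i hi
  rw [Finset.coe_range, Set.mem_Iio]
  by_contra h
  exact hi (hX i i (Or.inl (not_lt.mp h)))

lemma SupportedIn.mem_MZero {N : ℕ} {X : Matrix ℕ ℕ V} (hX : SupportedIn N X)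
    (h : ∑ i : Fin N, X i i = 0) : X ∈ MZero R V := by
  refine ⟨((Finset.range N ×ˢ Finset.range N).finite_toSet).subset ?_, by rwa [finsum_diag hX]⟩
  rintro ⟨i, j⟩ hij
  simp only [Finset.coe_product, Set.mem_prod, Finset.coe_range, Set.mem_Iio]
  by_contra hc
  exact hij (hX i j (by omega))

lemma leftMul_apply {N : ℕ} (g : SLInf R) {X : Matrix ℕ ℕ V} (hX : SupportedIn N X) (i j : ℕ) :
    leftMul g X i j = ∑ k : Fin N, entry (g : AutInf R) i k • X k j := by
  rw [leftMul, finsum_eq_sum_of_support_subset (s := Finset.range N), Finset.sum_range]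
  intro k hk
  rw [Finset.coe_range, Set.mem_Iio]
  by_contra h
  exact hk (by simp [hX k j (Or.inl (not_lt.mp h))])

lemma SupportedIn.leftMul {N : ℕ} {g : SLInf R} (hg : (g : AutInf R) ∈ fixing R N)
    {X : Matrix ℕ ℕ V} (hX : SupportedIn N X) : SupportedIn N (leftMul g X) := by
  intro i j hij
  rw [leftMul_apply g hX]
  refine Finset.sum_eq_zero fun k _ => ?_
  rcases hij with hi | hj
  · rw [entry_of_le_left hg hi, if_neg (by omega), zero_smul]
  · rw [hX _ _ (Or.inr hj), smul_zero]

lemma conj_apply {N : ℕ} (g : SLInf R) {X : Matrix ℕ ℕ V} (hX : SupportedIn N X) (i j : ℕ) :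
    conj g X i j = ∑ p : Fin N, ∑ q : Fin N,
      (entry (g⁻¹ : AutInf R) i p * entry (g : AutInf R) q j) • X p q := by
  rw [conj, finsum_eq_sum_of_support_subset (s := Finset.range N ×ˢ Finset.range N),
    Finset.sum_product, Finset.sum_range]
  · exact Finset.sum_congr rfl fun p _ => Finset.sum_range _
  rintro ⟨p, q⟩ hpq
  simp only [Finset.coe_product, Set.mem_prod, Finset.coe_range, Set.mem_Iio]
  by_contra hc
  exact hpq (by simp [hX p q (by omega)])

lemma SupportedIn.conj {N : ℕ} {g : SLInf R} (hg : (g : AutInf R) ∈ fixing R N)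
    {X : Matrix ℕ ℕ V} (hX : SupportedIn N X) : SupportedIn N (conj g X) := by
  intro i j hij
  rw [conj_apply g hX]
  refine Finset.sum_eq_zero fun p _ => Finset.sum_eq_zero fun q _ => ?_
  rcases hij with hi | hj
  · rw [entry_of_le_left (inv_mem hg) hi, if_neg (by omega), zero_mul, zero_smul]
  · rw [entry_of_le_right hg hj, if_neg (by omega), mul_zero, zero_smul]

variable (R) in
/-- The upper left corner of a matrix with entries in `V`, with entries in the exterior algebra. -/
def extCorner (N : ℕ) (X : Matrix ℕ ℕ V) : Matrix (Fin N) (Fin N) (ExteriorAlgebra R V) :=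
  fun i j => ExteriorAlgebra.ι R (X i j)

/-- A matrix over `R` as a matrix over the exterior algebra. -/
abbrev baseMat (V : Type*) [AddCommGroup V] [Module R V] {N : ℕ} (M : Matrix (Fin N) (Fin N) R) :
    Matrix (Fin N) (Fin N) (ExteriorAlgebra R V) :=
  (algebraMap R (ExteriorAlgebra R V)).mapMatrix M

/-- `V` embeds in its exterior algebra, so identities between matrices over `V` can be checked in a
matrix ring. -/
lemma extCorner_injective {N : ℕ} {X Y : Matrix ℕ ℕ V} (hX : SupportedIn N X)
    (hY : SupportedIn N Y) (h : extCorner R N X = extCorner R N Y) : X = Y := by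
  ext i j
  by_cases hij : N ≤ i ∨ N ≤ j
  · rw [hX i j hij, hY i j hij]
  · push Not at hij
    have := congrFun (congrFun h ⟨i, hij.1⟩) ⟨j, hij.2⟩
    exact (ExteriorAlgebra.ι_inj R _ _).mp this

lemma extCorner_add (N : ℕ) (X Y : Matrix ℕ ℕ V) :
    extCorner R N (X + Y) = extCorner R N X + extCorner R N Y := by
  ext i j
  simp [extCorner]

lemma extCorner_leftMul {N : ℕ} (g : SLInf R) {X : Matrix ℕ ℕ V} (hX : SupportedIn N X) :
    extCorner R N (leftMul g X) = baseMat V (corner N (g : AutInf R)) * extCorner R N X := by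
  ext i j
  simp [extCorner, leftMul_apply g hX, Matrix.mul_apply, corner, Algebra.smul_def]

lemma extCorner_conj {N : ℕ} (g : SLInf R) {X : Matrix ℕ ℕ V} (hX : SupportedIn N X) :
    extCorner R N (conj g X) = baseMat V (corner N (g⁻¹ : AutInf R)) * extCorner R N X *
      baseMat V (corner N (g : AutInf R)) := by
  ext i j
  simp only [extCorner, conj_apply g hX, Matrix.mul_apply, corner, Finset.sum_mul, map_sum,
    map_smul, RingHom.mapMatrix_apply, Matrix.map_apply]
  rw [Finset.sum_comm]
  refine Finset.sum_congr rfl fun q _ => Finset.sum_congr rfl fun p _ => ?_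
  rw [Algebra.smul_def, map_mul, mul_assoc, Algebra.commutes (entry (g : AutInf R) _ _),
    mul_assoc]

lemma trace_extCorner (N : ℕ) (X : Matrix ℕ ℕ V) :
    (extCorner R N X).trace = ExteriorAlgebra.ι R (∑ i : Fin N, X i i) := by
  simp [Matrix.trace, extCorner]

/-- The wedge is the product of the exterior algebra, so `Tr_alt` is half an ordinary trace there.
The support of `X` alone bounds the sum. -/
lemma coe_trAlt [Invertible (2 : R)] {N : ℕ} {X Y : Matrix ℕ ℕ V} (hX : SupportedIn N X) :
    ((trAlt X Y : ⋀[R]^2 V) : ExteriorAlgebra R V) =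
      ⅟(2 : R) • (extCorner R N X * extCorner R N Y).trace := by
  rw [trAlt, finsum_eq_sum_of_support_subset (s := Finset.range N ×ˢ Finset.range N),
    Finset.sum_product, Finset.sum_range]
  · simp only [Finset.sum_range, Submodule.coe_smul, Submodule.coe_sum, Matrix.trace, Matrix.diag,
      Matrix.mul_apply, wedge, coe_ιMulti_two]
    rfl
  rintro ⟨p, q⟩ hpq
  simp only [Finset.coe_product, Set.mem_prod, Finset.coe_range, Set.mem_Iio]
  by_contra hc
  refine hpq ?_
  simp only [hX p q (by omega), wedge]
  exact (exteriorPower.ιMulti R 2).map_coord_zero 0 rfl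

lemma leftMul_inv_leftMul {N : ℕ} {g : SLInf R} (hg : (g : AutInf R) ∈ fixing R N)
    {X : Matrix ℕ ℕ V} (hX : SupportedIn N X) : leftMul g⁻¹ (leftMul g X) = X := by
  have hg' : ((g⁻¹ : SLInf R) : AutInf R) ∈ fixing R N := by simpa using inv_mem hg
  refine extCorner_injective (R := R) ((hX.leftMul hg).leftMul hg') hX ?_
  rw [extCorner_leftMul _ (hX.leftMul hg), extCorner_leftMul _ hX, ← mul_assoc, ← map_mul,
    InvMemClass.coe_inv, corner_inv_mul hg, map_one, one_mul]

lemma leftMul_leftMul_inv {N : ℕ} {g : SLInf R} (hg : (g : AutInf R) ∈ fixing R N)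
    {X : Matrix ℕ ℕ V} (hX : SupportedIn N X) : leftMul g (leftMul g⁻¹ X) = X := by
  have := leftMul_inv_leftMul (g := g⁻¹) (N := N) (by simpa using inv_mem hg) hX
  rwa [inv_inv] at this

end FiniteMatrices

/-! ### The trace of `g⁻¹ dg` -/

section LogarithmicTrace

variable {A Λ : Type*} [CommRing A] [Ring Λ] (D : CentralDerivation A Λ)

/-- The trace of `g⁻¹ dg` vanishes on elementary matrices. -/
lemma trace_log_eq_zero (y : St A) : ∃ N₀, ∀ N ≥ N₀, stToAut A y ∈ fixing A N ∧
    (D.ιMat (corner N (stToAut A y)⁻¹) * D.dMat (corner N (stToAut A y))).trace = 0 := by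
  induction y using St.induction with
  | one => exact ⟨0, fun N _ => ⟨by rw [map_one]; exact one_mem _, by simp [corner_one]⟩⟩
  | mul s t hs ht =>
    obtain ⟨N, hN⟩ := hs
    obtain ⟨M, hM⟩ := ht
    refine ⟨max N M, fun L hL => ?_⟩
    obtain ⟨h1, h2⟩ := hN L (by omega)
    obtain ⟨h3, h4⟩ := hM L (by omega)
    rw [map_mul]
    refine ⟨mul_mem h1 h3, ?_⟩
    -- `Tr(g⁻¹ dg)` is additive in `g`, by the Leibniz rule and cyclicity.
    rw [mul_inv_rev, corner_mul _ h3, corner_mul _ (inv_mem h1), D.dMat_mul, map_mul, mul_add,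
      Matrix.trace_add]
    have e1 : D.ιMat (corner L (stToAut A s)⁻¹) * D.ιMat (corner L (stToAut A s)) = 1 := by
      rw [← map_mul, corner_inv_mul h1, map_one]
    have e2 : D.ιMat (corner L (stToAut A t)) * D.ιMat (corner L (stToAut A t)⁻¹) = 1 := by
      rw [← map_mul, corner_mul_inv h3, map_one]
    rw [mul_assoc, D.trace_comm, mul_assoc, mul_assoc, e2, mul_one, h2, zero_add, mul_assoc,
      ← mul_assoc _ (D.ιMat (corner L (stToAut A s))), e1, one_mul, h4]
  | x i j h a =>
    refine ⟨i + j + 1, fun N hN => ?_⟩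
    have hi : i < N := by omega
    have hj : j < N := by omega
    rw [stToAut_x]
    refine ⟨elem_mem_fixing h hi hj a, ?_⟩
    rw [elem_inv, corner_elem h hi hj, corner_elem h hi hj]
    have hij : (⟨i, hi⟩ : Fin N) ≠ ⟨j, hj⟩ := by simpa using h
    have : D.dMat (Matrix.transvection (⟨i, hi⟩ : Fin N) ⟨j, hj⟩ a) =
        Matrix.single ⟨i, hi⟩ ⟨j, hj⟩ (D.d a) := by
      ext p q
      simp only [CentralDerivation.dMat, Matrix.transvection, Matrix.map_apply, Matrix.add_apply,
        map_add, Matrix.one_apply, D.d_ite, zero_add, Matrix.single_apply]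
      split_ifs <;> simp
    rw [this, Matrix.trace_mul_single]
    simp [CentralDerivation.ιMat, Matrix.transvection, hij, hij.symm]

end LogarithmicTrace

/-! ### The cocycle of a first-order deformation -/

section Deformations

variable {R V : Type*} [CommRing R] [AddCommGroup V] [Module R V] [Module Rᵐᵒᵖ V]
  [IsCentralScalar R V]

/-- The `V`-component of an automorphism over the square-zero extension. -/
def sndMat (g : AutInf (TrivSqZeroExt R V)) : Matrix ℕ ℕ V := fun i j => (entry g i j).snd

lemma supportedIn_sndMat {N : ℕ} {g : AutInf (TrivSqZeroExt R V)}
    (hg : g ∈ fixing (TrivSqZeroExt R V) N) : SupportedIn N (sndMat g) := by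
  intro i j hij
  rw [sndMat]
  rcases hij with hi | hj
  · rw [entry_of_le_left hg hi]
    split_ifs <;> rfl
  · rw [entry_of_le_right hg hj]
    split_ifs <;> rfl

lemma dMat_corner (N : ℕ) (g : AutInf (TrivSqZeroExt R V)) :
    (sndDerivation R V).dMat (corner N g) = extCorner R N (sndMat g) := rfl

lemma ιMat_corner {N : ℕ} {g : AutInf (TrivSqZeroExt R V)} {g₀ : AutInf R}
    (h : ∀ i j, (entry g i j).fst = entry g₀ i j) :
    (sndDerivation R V).ιMat (corner N g) = baseMat V (corner N g₀) := by
  ext i j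
  simp [CentralDerivation.ιMat, corner, sndDerivation_ι, h]

lemma exists_mem_fixing {A : Type*} [CommRing A] [IsLocalRing A] (g : SLInf A) :
    ∃ N, (g : AutInf A) ∈ fixing A N := by
  exact range_stToAut_le_finAut A ((range_stToAut A).ge g.2)

variable {Γ : Type*} [Group Γ] {ρ₀ : Γ →* SLInf R} {ρ : Γ →* SLInf (TrivSqZeroExt R V)}

variable (ρ₀ ρ) in
/-- The matrix `ρ₀⁻¹ dρ` of a first-order deformation. -/
def defMat (γ : Γ) : Matrix ℕ ℕ V := leftMul (ρ₀ γ)⁻¹ (sndMat (ρ γ : AutInf (TrivSqZeroExt R V)))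

lemma supportedIn_defMat {N : ℕ} {γ : Γ} (h₀ : (ρ₀ γ : AutInf R) ∈ fixing R N)
    (h : (ρ γ : AutInf (TrivSqZeroExt R V)) ∈ fixing (TrivSqZeroExt R V) N) :
    SupportedIn N (defMat ρ₀ ρ γ) :=
  (supportedIn_sndMat h).leftMul (by simpa using inv_mem h₀)

lemma IsDeformation.inv (hρ : IsDeformation ρ₀ ρ) (γ : Γ) (i j : ℕ) :
    (entry ((ρ γ : AutInf (TrivSqZeroExt R V))⁻¹) i j).fst = entry ((ρ₀ γ : AutInf R)⁻¹) i j := by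
  have := hρ γ⁻¹ i j
  rwa [map_inv, map_inv] at this

/-- This identifies the cocycle with `ρ⁻¹ dρ`: the structure map of `sndDerivation` sees only `ρ₀`
and its derivation only the `V`-part. The remaining properties of `c` are formal properties of `g⁻¹
dg`. -/
lemma extCorner_defMat (hρ : IsDeformation ρ₀ ρ) {N : ℕ} {γ : Γ}
    (h : (ρ γ : AutInf (TrivSqZeroExt R V)) ∈ fixing (TrivSqZeroExt R V) N) :
    extCorner R N (defMat ρ₀ ρ γ) =
      (sndDerivation R V).ιMat (corner N (ρ γ : AutInf (TrivSqZeroExt R V))⁻¹) *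
        (sndDerivation R V).dMat (corner N (ρ γ : AutInf (TrivSqZeroExt R V))) := by
  rw [defMat, extCorner_leftMul _ (supportedIn_sndMat h), dMat_corner, ιMat_corner (hρ.inv γ),
    InvMemClass.coe_inv]

variable [IsLocalRing R]

variable (ρ₀ ρ) in
/-- A common size of `ρ₀ γ` and `ρ γ`. -/
lemma exists_size (γ : Γ) : ∃ N₀, ∀ N ≥ N₀, (ρ₀ γ : AutInf R) ∈ fixing R N ∧
    (ρ γ : AutInf (TrivSqZeroExt R V)) ∈ fixing (TrivSqZeroExt R V) N := by
  obtain ⟨N, hN⟩ := exists_mem_fixing (ρ₀ γ)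
  obtain ⟨M, hM⟩ := exists_mem_fixing (ρ γ)
  exact ⟨max N M, fun L hL => ⟨fixing_mono _ (by omega) hN, fixing_mono _ (by omega) hM⟩⟩

/-- The trace vanishes because `ρ(γ)` lifts to the Steinberg group, where `trace_log_eq_zero`
applies. -/
lemma defMat_mem (hρ : IsDeformation ρ₀ ρ) (γ : Γ) : defMat ρ₀ ρ γ ∈ MZero R V := by
  obtain ⟨N, hN⟩ := exists_size ρ₀ ρ γ
  obtain ⟨y, hy⟩ := (range_stToAut (TrivSqZeroExt R V)).ge (ρ γ).2
  obtain ⟨M, hM⟩ := trace_log_eq_zero (sndDerivation R V) y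
  obtain ⟨h1, h2⟩ := hN (max N M) (by omega)
  have h3 := (hM (max N M) (by omega)).2
  rw [hy, ← extCorner_defMat hρ h2, trace_extCorner, ExteriorAlgebra.ι_eq_zero_iff] at h3
  exact (supportedIn_defMat h1 h2).mem_MZero h3

variable (ρ₀ ρ) in
/-- The cocycle of a first-order deformation. -/
def defCocycle (hρ : IsDeformation ρ₀ ρ) (γ : Γ) : MZero R V := ⟨defMat ρ₀ ρ γ, defMat_mem hρ γ⟩

lemma eqMulOneAdd_defCocycle (hρ : IsDeformation ρ₀ ρ) :
    EqMulOneAdd ρ₀ ρ (defCocycle ρ₀ ρ hρ) := by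
  intro γ i j
  obtain ⟨N, hN⟩ := exists_size ρ₀ ρ γ
  obtain ⟨h1, h2⟩ := hN N le_rfl
  change _ = _ + TrivSqZeroExt.inr (leftMul (ρ₀ γ)
    (leftMul (ρ₀ γ)⁻¹ (sndMat (ρ γ : AutInf (TrivSqZeroExt R V)))) i j)
  rw [leftMul_leftMul_inv h1 (supportedIn_sndMat h2), ← hρ γ i j]
  exact (TrivSqZeroExt.inl_fst_add_inr_snd_eq _).symm

lemma EqMulOneAdd.eq_defCocycle (hρ : IsDeformation ρ₀ ρ) {c : Γ → MZero R V}
    (hc : EqMulOneAdd ρ₀ ρ c) : c = defCocycle ρ₀ ρ hρ := by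
  funext γ
  apply Subtype.ext
  obtain ⟨N, hN⟩ := exists_size ρ₀ ρ γ
  obtain ⟨M, hM⟩ := exists_supportedIn (c γ)
  obtain ⟨h1, h2⟩ := hN (max N M) (by omega)
  have h3 : sndMat (ρ γ : AutInf (TrivSqZeroExt R V)) = leftMul (ρ₀ γ) (c γ : Matrix ℕ ℕ V) := by
    ext i j
    have := congrArg TrivSqZeroExt.snd (hc γ i j)
    simpa [sndMat] using this
  change _ = leftMul (ρ₀ γ)⁻¹ (sndMat (ρ γ : AutInf (TrivSqZeroExt R V)))
  rw [h3, leftMul_inv_leftMul h1 (hM.mono (le_max_right N M))]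

/-- This is `(gh)⁻¹ d(gh) = h⁻¹ (g⁻¹ dg) h + h⁻¹ dh`. -/
lemma defMat_mul (hρ : IsDeformation ρ₀ ρ) (γ₁ γ₂ : Γ) : defMat ρ₀ ρ (γ₁ * γ₂) =
    conj (ρ₀ γ₂) (defMat ρ₀ ρ γ₁) + defMat ρ₀ ρ γ₂ := by
  obtain ⟨N, hN⟩ := exists_size ρ₀ ρ γ₁
  obtain ⟨M, hM⟩ := exists_size ρ₀ ρ γ₂
  obtain ⟨h1, h2⟩ := hN (max N M) (by omega)
  obtain ⟨h3, h4⟩ := hM (max N M) (by omega)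
  have h5 : (ρ₀ (γ₁ * γ₂) : AutInf R) ∈ fixing R (max N M) := by
    rw [map_mul]; exact mul_mem h1 h3
  have h6 : (ρ (γ₁ * γ₂) : AutInf _) ∈ fixing (TrivSqZeroExt R V) (max N M) := by
    rw [map_mul]; exact mul_mem h2 h4
  have s1 := supportedIn_defMat h1 h2
  have s2 := supportedIn_defMat h3 h4
  refine extCorner_injective (R := R) (supportedIn_defMat h5 h6) ((s1.conj h3).add s2) ?_
  rw [extCorner_add, extCorner_conj _ s1, extCorner_defMat hρ h6, extCorner_defMat hρ h2,
    extCorner_defMat hρ h4, ← ιMat_corner (hρ.inv γ₂), ← ιMat_corner (hρ γ₂), map_mul,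
    Subgroup.coe_mul, mul_inv_rev, corner_mul _ h4, corner_mul _ (inv_mem h2),
    CentralDerivation.dMat_mul, map_mul, mul_add]
  have e1 : (sndDerivation R V).ιMat (corner (max N M) (ρ γ₁ : AutInf _)⁻¹) *
      (sndDerivation R V).ιMat (corner (max N M) (ρ γ₁ : AutInf _)) = 1 := by
    rw [← map_mul, corner_inv_mul h2, map_one]
  congr 1
  · simp only [mul_assoc]
  · rw [mul_assoc, ← mul_assoc _ ((sndDerivation R V).ιMat (corner _ (ρ γ₁ : AutInf _))), e1,
      one_mul]

/-- With `g = ρ(γ₁)` and `h = ρ(γ₂)`, cyclicity gives `Tr(h⁻¹ (g⁻¹ dg) h · h⁻¹ dh) = Tr(g⁻¹ dg · dh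
h⁻¹)`, an equality of cochains and not only of classes. -/
lemma coe_trAltCup [Invertible (2 : R)] (hρ : IsDeformation ρ₀ ρ) (γ₁ γ₂ : Γ) :
    (trAltCup ρ₀ (defCocycle ρ₀ ρ hρ) (γ₁, γ₂) : ExteriorAlgebra R V) =
      ⅟(2 : R) • (sndDerivation R V).cochain (ρ γ₁ : AutInf _) (ρ γ₂ : AutInf _) := by
  obtain ⟨N, hN⟩ := exists_size ρ₀ ρ γ₁
  obtain ⟨M, hM⟩ := exists_size ρ₀ ρ γ₂
  obtain ⟨h1, h2⟩ := hN (max N M) (by omega)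
  obtain ⟨h3, h4⟩ := hM (max N M) (by omega)
  have s1 := supportedIn_defMat h1 h2
  change ((trAlt (conj (ρ₀ γ₂) (defMat ρ₀ ρ γ₁)) (defMat ρ₀ ρ γ₂) : ⋀[R]^2 V) :
    ExteriorAlgebra R V) = _
  rw [coe_trAlt (s1.conj h3), extCorner_conj _ s1, extCorner_defMat hρ h2,
    extCorner_defMat hρ h4, CentralDerivation.cochain_eq _ h2 h4, CentralDerivation.traceForm,
    ← ιMat_corner (hρ.inv γ₂), ← ιMat_corner (hρ γ₂)]
  have e1 : (sndDerivation R V).ιMat (corner (max N M) (ρ γ₂ : AutInf _)) *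
      (sndDerivation R V).ιMat (corner (max N M) (ρ γ₂ : AutInf _)⁻¹) = 1 := by
    rw [← map_mul, corner_mul_inv h4, map_one]
  congr 1
  simp only [mul_assoc]
  rw [CentralDerivation.trace_comm, ← mul_assoc ((sndDerivation R V).ιMat
    (corner (max N M) (ρ γ₂ : AutInf _))), e1, one_mul]
  simp only [mul_assoc]

end Deformations

end SteinbergForm

end

/-! ### The proposition -/

theorem proposition2p2 {R V : Type u} [CommRing R] [IsLocalRing R] [Invertible (2 : R)]
    [AddCommGroup V] [Module R V] [Module Rᵐᵒᵖ V] [IsCentralScalar R V]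
    [Module.Free R V] [Module.Finite R V] :
    -- every element of `SL(A)`, `A = R × V`, lifts to `St(A)`
    (stToAut (TrivSqZeroExt R V)).range = SLInf (TrivSqZeroExt R V) ∧
    -- there is exactly one `dlog : K₂(A) → Ω²_A`
    ∃ δ : Additive (K2 (TrivSqZeroExt R V)) →+ AbsForms (TrivSqZeroExt R V),
      IsDlog δ ∧ (∀ δ', IsDlog δ' → δ' = δ) ∧
      -- how `⋀² V` sits in the `2`-forms
      Function.Injective (wedgeToForms R V) ∧
      (Subsingleton Ω[R⁄ℤ] → Function.Bijective (absToRel (TrivSqZeroExt R V) R)) ∧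
      -- `dlog` takes values in `⋀² V`
      ∃ δV : Additive (K2 (TrivSqZeroExt R V)) →+ ⋀[R]^2 V,
        (∀ k, wedgeToForms R V (δV k) = absToRel (TrivSqZeroExt R V) R (δ k)) ∧
        ∀ (Γ : Type u) [Group Γ] (ρ₀ : Γ →* SLInf R) (ρ : Γ →* SLInf (TrivSqZeroExt R V)),
          IsDeformation ρ₀ ρ →
          -- the cocycle `c` associated with `ρ`
          ∃ c : Γ → MZero R V, EqMulOneAdd ρ₀ ρ c ∧ (∀ c', EqMulOneAdd ρ₀ ρ c' → c' = c) ∧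
            (∀ γ₁ γ₂, (c (γ₁ * γ₂)).1 = conj (ρ₀ γ₂) (c γ₁).1 + (c γ₂).1) ∧
            -- `ω_ρ = - Tr_alt(c ∪ c)` in `H²(Γ, ⋀² V)`, for every choice of lifts `s`
            ∀ (s : Γ → St (TrivSqZeroExt R V))
              (hs : ∀ γ, stToAut (TrivSqZeroExt R V) (s γ) = ρ γ),
              ∃ (hω : (fun p : Γ × Γ => δV (Additive.ofMul (kappa ρ s hs p.1 p.2))) ∈
                    cocycles₂ (Rep.trivial R Γ (⋀[R]^2 V)))
                (hT : trAltCup ρ₀ c ∈ cocycles₂ (Rep.trivial R Γ (⋀[R]^2 V))),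
                H2π (Rep.trivial R Γ (⋀[R]^2 V)) ⟨_, hω⟩ =
                  - H2π (Rep.trivial R Γ (⋀[R]^2 V)) ⟨_, hT⟩ := by
  refine ⟨range_stToAut _, ?_⟩
  obtain ⟨δ, hδ, huniq⟩ := exists_unique_isDlog (TrivSqZeroExt R V)
  obtain ⟨δV, hδV, hval⟩ := exists_dlogV hδ
  refine ⟨δ, hδ, huniq, wedgeToForms_injective R V, fun h => absToRel_bijective R _, δV, hδV, ?_⟩
  intro Γ _ ρ₀ ρ hρ
  refine ⟨defCocycle ρ₀ ρ hρ, eqMulOneAdd_defCocycle hρ, fun c' hc' => hc'.eq_defCocycle hρ,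
    defMat_mul hρ, ?_⟩
  intro s hs
  set D := sndDerivation R V
  have hmem : ∀ y, (D.stHom y).val ∈ (⋀[R]^2 V) := fun y => D.val_stHom_mem sndDerivation_mem y
  -- The halved central coordinate of the lift `s(γ)`, with the sign that makes its coboundary `dlog
  -- κ + Tr_alt(c ∪ c)`.
  let b : Γ → ⋀[R]^2 V := fun γ => -(⅟(2 : R) • ⟨(D.stHom (s γ)).val, hmem _⟩)
  have hsum : ∀ γ₁ γ₂, δV (Additive.ofMul (kappa ρ s hs γ₁ γ₂)) +
      trAltCup ρ₀ (defCocycle ρ₀ ρ hρ) (γ₁, γ₂) = b γ₂ - b (γ₁ * γ₂) + b γ₁ := by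
    intro γ₁ γ₂
    apply Subtype.ext
    -- As `κ` lies over the identity, the central coordinate of `s(γ₁γ₂)` is the sum of those of
    -- `κ`, `s(γ₁)` and `s(γ₂)` plus the trace cochain of `ρ(γ₁), ρ(γ₂)`.
    have e : (kappa ρ s hs γ₁ γ₂ : St (TrivSqZeroExt R V)) * (s γ₁ * s γ₂) = s (γ₁ * γ₂) := by
      simp only [kappa]
      group
    have e1 := congrArg (fun t => (D.stHom t).val) e
    simp only [CentralDerivation.val_stHom_mul D (kappa ρ s hs γ₁ γ₂ : St (TrivSqZeroExt R V)),
      MonoidHom.mem_ker.mp (kappa ρ s hs γ₁ γ₂).2, CentralDerivation.cochain_one_left,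
      CentralDerivation.val_stHom_mul D (s γ₁), hs, add_zero] at e1
    rw [Submodule.coe_add, hval, coe_trAltCup hρ, CentralDerivation.traceHom_apply]
    simp only [b, Submodule.coe_add, Submodule.coe_sub, Submodule.coe_neg, Submodule.coe_smul]
    rw [← e1, ← smul_add]
    simp only [smul_add]
    abel
  have hT : trAltCup ρ₀ (defCocycle ρ₀ ρ hρ) ∈ cocycles₂ (Rep.trivial R Γ (⋀[R]^2 V)) := by
    rw [mem_cocycles₂_iff]
    intro g h j
    have hfin : ∀ γ, (ρ γ : AutInf (TrivSqZeroExt R V)) ∈ finAut _ := fun γ =>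
      exists_mem_fixing (ρ γ)
    have := D.cochain_cocycle (hfin g) (hfin h) (hfin j)
    apply Subtype.ext
    change (trAltCup ρ₀ (defCocycle ρ₀ ρ hρ) (g * h, j) : ExteriorAlgebra R V) +
      (trAltCup ρ₀ (defCocycle ρ₀ ρ hρ) (g, h) : ExteriorAlgebra R V) =
      (trAltCup ρ₀ (defCocycle ρ₀ ρ hρ) (h, j) : ExteriorAlgebra R V) +
      (trAltCup ρ₀ (defCocycle ρ₀ ρ hρ) (g, h * j) : ExteriorAlgebra R V)
    rw [coe_trAltCup hρ, coe_trAltCup hρ, coe_trAltCup hρ, coe_trAltCup hρ, ← smul_add,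
      ← smul_add, map_mul, map_mul, Subgroup.coe_mul, Subgroup.coe_mul, ← this, add_comm]
  have hb : (fun p : Γ × Γ => δV (Additive.ofMul (kappa ρ s hs p.1 p.2))) +
      trAltCup ρ₀ (defCocycle ρ₀ ρ hρ) ∈ coboundaries₂ (Rep.trivial R Γ (⋀[R]^2 V)) :=
    ⟨b, funext fun p => (hsum p.1 p.2).symm⟩
  -- A coboundary minus a cocycle, so no computation with `κ` is needed.
  have hω : (fun p : Γ × Γ => δV (Additive.ofMul (kappa ρ s hs p.1 p.2))) ∈
      cocycles₂ (Rep.trivial R Γ (⋀[R]^2 V)) := by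
    have := Submodule.sub_mem _ (coboundaries₂_le_cocycles₂ _ hb) hT
    rwa [add_sub_cancel_right] at this
  refine ⟨hω, hT, ?_⟩
  rw [eq_neg_iff_add_eq_zero, ← map_add, H2π_eq_zero_iff]
  exact hb
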